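/- Let $n\ge 3$. Let $(T,\langle\,,\rangle)$ be a Euclidean vector space of dimension $2n+1$ with an almost contact metric structure: a unit vector $\xi$ and a linear map $F:T\to T$ such that $F\xi=0$ and, on $V=\xi^{\perp}$, $F^2=-I$ and $\langle FX,FY\rangle=\langle X,Y\rangle$. Let $H=U(n)\times 1$ be the group of linear isometries of $T$ that commute with $F$ and fix $\xi$. It acts on $\otimes^3T^*$ by $(ah)_{XYZ}=h_{a^{-1}X\,a^{-1}Y\,a^{-1}Z}$, and $\otimes^3T^*$ has the inner product $\langle h,h'\rangle=\sum_{i,j,k}h_{E_iE_jE_k}h'_{E_iE_jE_k}$ for an orthonormal basis $(E_i)$ of $T$. Put $$\bar T(T)=\{h\in\otimes^3T^*: h_{XYZ}=-h_{XZY}\ (X,Y,Z\in T),\quad h_{XYZ}=-h_{X\,FY\,FZ}\ (X\in T,\ Y,Z\in V)\},$$ and, for an orthonormal basis $E_1,\dots,E_n,FE_1,\dots,FE_n$ of $V$ and $U\in T$, $$\beta(U)=\sum_{i=1}^n(h_{E_iE_iU}+h_{FE_i\,FE_i\,U}),\qquad \bar\beta(U)=\sum_{i=1}^n(h_{E_i\,FE_i\,U}-h_{FE_i\,E_i\,U}).$$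 Let $\bar T_1,\dots,\bar T_{12}$ be the subspaces of those $h\in\bar T(T)$ that satisfy, for all $X,Y,Z\in V$: - $\bar T_1$: $h_{XYZ}=-h_{YXZ}$ and $h_{XY\xi}=h_{\xi X\xi}=h_{\xi XY}=0$; - $\bar T_2$: $h_{XYZ}+h_{YZX}+h_{ZXY}=0$ and $h_{XY\xi}=h_{\xi X\xi}=h_{\xi XY}=0$; - $\bar T_3$: $h_{XYZ}-h_{FX\,FY\,Z}=\beta(Z)=0$ and $h_{XY\xi}=h_{\xi X\xi}=h_{\xi XY}=0$; - $\bar T_4$: $h_{XYZ}=\frac1{2(n-1)}\big(\langle X,Y\rangle\beta(Z)-\langle X,Z\rangle\beta(Y)-\langle X,FY\rangle\beta(FZ)+\langle X,FZ\rangle\beta(FY)\big)$ and $h_{XY\xi}=h_{\xi X\xi}=h_{\xi XY}=0$; - $\bar T_5$: $h_{XY\xi}=-h_{YX\xi}$, $h_{FX\,FY\,\xi}=h_{XY\xi}$, $\bar\beta(\xi)=0$ and $h_{XYZ}=h_{\xi X\xi}=h_{\xi XY}=0$; - $\bar T_6$: $h_{XY\xi}=-h_{YX\xi}$, $h_{FX\,FY\,\xi}=-h_{XY\xi}$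 and $h_{XYZ}=h_{\xi X\xi}=h_{\xi XY}=0$; - $\bar T_7$: $h_{XY\xi}=\frac1{2n}\langle FX,Y\rangle\bar\beta(\xi)$ and $h_{XYZ}=h_{\xi X\xi}=h_{\xi XY}=0$; - $\bar T_8$: $h_{XY\xi}=h_{YX\xi}$, $h_{FX\,FY\,\xi}=h_{XY\xi}$, $\beta(\xi)=0$ and $h_{XYZ}=h_{\xi X\xi}=h_{\xi XY}=0$; - $\bar T_9$: $h_{XY\xi}=h_{YX\xi}$, $h_{FX\,FY\,\xi}=-h_{XY\xi}$ and $h_{XYZ}=h_{\xi X\xi}=h_{\xi XY}=0$; - $\bar T_{10}$: $h_{XY\xi}=\frac1{2n}\langle X,Y\rangle\beta(\xi)$ and $h_{XYZ}=h_{\xi X\xi}=h_{\xi XY}=0$; - $\bar T_{11}$: $h_{XYZ}=h_{XY\xi}=h_{\xi XY}=0$; - $\bar T_{12}$: $h_{\xi XY}=-h_{\xi YX}=-h_{\xi\,FX\,FY}$ and $h_{XYZ}=h_{XY\xi}=h_{\xi X\xi}=0$. Then $\bar T(T)=\bigoplus_{i=1}^{12}\bar T_i$ is an orthogonal direct sum,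 and each $\bar T_i$ is invariant and irreducible (in particular nonzero) under $H$. The dimensions of $\bar T_1,\dots,\bar T_{12}$ are, in this order, $$\tfrac13n(n-1)(n-2),\ \tfrac23n(n-1)(n+1),\ n(n+1)(n-2),\ 2n,\ n^2-1,\ n^2-n,\ 1,\ n^2-1,\ n^2+n,\ 1,\ 2n,\ n^2-n,$$ and $\dim\bar T(T)=(2n+1)n(n+1)$. The subspaces $\bar T_\alpha=\bigoplus_{i\in\alpha}\bar T_i$, $\alpha\subseteq\{1,\dots,12\}$, are invariant under $H$ and pairwise distinct, so there are $2^{12}$ of them. This gives $2^{12}$ classes of almost contact metric structures. Let $(F,\xi)$ be a smooth almost contact metric structure on a Riemannian manifold $M$ of dimension $2n+1$ (so that each $T_pM$ is as above), let $\nabla$ be the Levi-Civita connection, $\pi_1=I+F^2$, $\pi_2=-F^2$, and $$\bar\nabla_XY=\pi_1\nabla_X\pi_1Y+\tfrac12\pi_2\big(\nabla_X\pi_2Y-F\nabla_XF\pi_2Y\big).$$ Then $h_{XYZ}=\langle\nabla_XY-\bar\nabla_XY,Z\rangle$ defines a unique tensor $h_p$ at every point $p$ (the second fundamental tensor), and $h_p\in\bar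 T(T_pM)$. Say that the structure is of the class $\bar T_\alpha$ if $h_p\in\bar T_\alpha(T_pM)$ for all $p\in M$. Then there is exactly one $\alpha\subseteq\{1,\dots,12\}$ such that, for every $\gamma\subseteq\{1,\dots,12\}$, the structure is of the class $\bar T_\gamma$ if and only if $\alpha\subseteq\gamma$. -/

import Mathlib

open Bundle
open scoped Manifold ContDiff

noncomputable section

namespace ACM

/-! ## Linear algebra of an almost contact metric vector space -/

section Algebra

/-- Covariant tensors `h` of type `(0,3)` on `T`, with `h X Y Z` for `h_{XYZ}`. -/
abbrev Tensor3 (T : Type*) [NormedAddCommGroup T] [InnerProductSpace ℝ T] : Type _ :=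
  T →ₗ[ℝ] T →ₗ[ℝ] T →ₗ[ℝ] ℝ

variable {T : Type*} [NormedAddCommGroup T] [InnerProductSpace ℝ T]

/-- The hyperplane `V = L^⊥` orthogonal to the line `L` spanned by `ξ`. -/
def V (ξ : T) : Submodule ℝ T := (Submodule.span ℝ {ξ})ᗮ

/-- `(⟨ , ⟩, F, ξ)` is an almost contact metric structure on the Euclidean vector space `T`:
`ξ` is a unit vector, `F ξ = 0`, and on `V = ξ^⊥` the map `F` is isometric with `F² = -I`. -/
structure IsAlmostContactMetric (F : T →ₗ[ℝ] T) (ξ : T) : Prop where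
  norm_xi : ‖ξ‖ = 1
  map_xi : F ξ = 0
  sq_eq_neg : ∀ X ∈ V ξ, F (F X) = -X
  inner_map : ∀ X ∈ V ξ, ∀ Y ∈ V ξ, inner ℝ (F X) (F Y) = inner ℝ X Y

/-- The group `U(n) × 1`: the linear isometries of `T` that commute with `F` and fix `ξ`. -/
def structureGroup (F : T →ₗ[ℝ] T) (ξ : T) : Subgroup (T ≃ₗᵢ[ℝ] T) where
  carrier := {a | (∀ X, a (F X) = F (a X)) ∧ a ξ = ξ}
  one_mem' := ⟨fun _ => rfl, rfl⟩
  mul_mem' := by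
    rintro a b ⟨ha, ha'⟩ ⟨hb, hb'⟩
    refine ⟨fun X => ?_, ?_⟩
    · simp [LinearIsometryEquiv.coe_mul, hb, ha]
    · simp [LinearIsometryEquiv.coe_mul, hb', ha']
  inv_mem' := by
    rintro a ⟨ha, ha'⟩
    refine ⟨fun X => ?_, ?_⟩
    · change a.symm (F X) = F (a.symm X)
      rw [a.symm_apply_eq, ha, a.apply_symm_apply]
    · change a.symm ξ = ξ
      rw [a.symm_apply_eq, ha']

/-- The action of isometries on tensors: `(a h)_{XYZ} = h_{a⁻¹X a⁻¹Y a⁻¹Z}`. -/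
def act (a : T ≃ₗᵢ[ℝ] T) (h : Tensor3 T) : Tensor3 T :=
  LinearMap.mk₂ ℝ
    (fun X Y => (h (a⁻¹ X) (a⁻¹ Y)).comp (a⁻¹).toLinearEquiv.toLinearMap)
    (fun _ _ _ => by ext; simp) (fun _ _ _ => by ext; simp)
    (fun _ _ _ => by ext; simp) (fun _ _ _ => by ext; simp)

lemma act_apply (a : T ≃ₗᵢ[ℝ] T) (h : Tensor3 T) (X Y Z : T) :
    act a h X Y Z = h (a⁻¹ X) (a⁻¹ Y) (a⁻¹ Z) := rfl

/-- A space of tensors is invariant under `U(n) × 1`. -/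
def IsInvariant (F : T →ₗ[ℝ] T) (ξ : T) (W : Submodule ℝ (Tensor3 T)) : Prop :=
  ∀ a ∈ structureGroup F ξ, ∀ h ∈ W, act a h ∈ W

/-- A space of tensors is irreducible under `U(n) × 1`: it is nonzero, and its only invariant
subspaces are `0` and itself. -/
def IsIrreducible (F : T →ₗ[ℝ] T) (ξ : T) (W : Submodule ℝ (Tensor3 T)) : Prop :=
  W ≠ ⊥ ∧ ∀ W' : Submodule ℝ (Tensor3 T), W' ≤ W → IsInvariant F ξ W' → W' = ⊥ ∨ W' = W

/-- The space `T̄(T)` of tensors with `h_{XYZ} = -h_{XZY}` for all `X, Y, Z`, and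
`h_{XYZ} = -h_{X FY FZ}` for all `X` and all `Y, Z ∈ V`. -/
def Tbar (F : T →ₗ[ℝ] T) (ξ : T) : Submodule ℝ (Tensor3 T) where
  carrier := {h | (∀ X Y Z, h X Y Z = -h X Z Y) ∧
    ∀ X, ∀ Y ∈ V ξ, ∀ Z ∈ V ξ, h X Y Z = -h X (F Y) (F Z)}
  zero_mem' := by simp
  add_mem' := by
    rintro h k ⟨h1, h2⟩ ⟨k1, k2⟩
    refine ⟨fun X Y Z => ?_, fun X Y hY Z hZ => ?_⟩
    · simp only [LinearMap.add_apply]; rw [h1 X Y Z, k1 X Y Z]; ring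
    · simp only [LinearMap.add_apply]; rw [h2 X Y hY Z hZ, k2 X Y hY Z hZ]; ring
  smul_mem' := by
    rintro c h ⟨h1, h2⟩
    refine ⟨fun X Y Z => ?_, fun X Y hY Z hZ => ?_⟩
    · simp only [LinearMap.smul_apply, smul_eq_mul]; rw [h1 X Y Z]; ring
    · simp only [LinearMap.smul_apply, smul_eq_mul]; rw [h2 X Y hY Z hZ]; ring

variable [FiniteDimensional ℝ T]

/-- The inner product `⟨h, h'⟩ = ∑_{i,j,k} h_{E_i E_j E_k} h'_{E_i E_j E_k}` of tensors, for an
orthonormal basis `E` of `T` (the value does not depend on the basis). -/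
def tensorInner (h h' : Tensor3 T) : ℝ :=
  let E := stdOrthonormalBasis ℝ T
  ∑ i, ∑ j, ∑ k, h (E i) (E j) (E k) * h' (E i) (E j) (E k)

/-- `β(U) = ∑ h_{e e U}`, the sum over an orthonormal basis `e` of `V` (the value does not depend
on the basis). For a basis `E_1, …, E_n, F E_1, …, F E_n` this is
`∑_{i ≤ n} (h_{E_i E_i U} + h_{F E_i F E_i U})`. -/
def beta (ξ : T) (h : Tensor3 T) (U : T) : ℝ :=
  let e := stdOrthonormalBasis ℝ (V ξ)
  ∑ i, h (e i) (e i) U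

/-- `β̄(U) = ∑ h_{e Fe U}`, the sum over an orthonormal basis `e` of `V` (the value does not depend
on the basis). For a basis `E_1, …, E_n, F E_1, …, F E_n` this is
`∑_{i ≤ n} (h_{E_i F E_i U} - h_{F E_i E_i U})`, as `F² = -I` on `V`. -/
def betaBar (F : T →ₗ[ℝ] T) (ξ : T) (h : Tensor3 T) (U : T) : ℝ :=
  let e := stdOrthonormalBasis ℝ (V ξ)
  ∑ i, h (e i) (F (e i)) U

/-- `h_{XYZ} = 0` for `X, Y, Z ∈ V`. -/
def ZeroVVV (ξ : T) (h : Tensor3 T) : Prop :=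
  ∀ X ∈ V ξ, ∀ Y ∈ V ξ, ∀ Z ∈ V ξ, h X Y Z = 0

/-- `h_{XYξ} = 0` for `X, Y ∈ V`. -/
def ZeroVVxi (ξ : T) (h : Tensor3 T) : Prop :=
  ∀ X ∈ V ξ, ∀ Y ∈ V ξ, h X Y ξ = 0

/-- `h_{ξXξ} = 0` for `X ∈ V`. -/
def ZeroXiVxi (ξ : T) (h : Tensor3 T) : Prop :=
  ∀ X ∈ V ξ, h ξ X ξ = 0

/-- `h_{ξXY} = 0` for `X, Y ∈ V`. -/
def ZeroXiVV (ξ : T) (h : Tensor3 T) : Prop :=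
  ∀ X ∈ V ξ, ∀ Y ∈ V ξ, h ξ X Y = 0

/-- The defining conditions of the twelve subspaces of `T̄(T)`, where `dim T = 2n + 1`.
The index `i : Fin 12` stands for the subspace `T̄_{i+1}`. -/
def tableCondition (n : ℕ) (F : T →ₗ[ℝ] T) (ξ : T) (h : Tensor3 T) : Fin 12 → Prop
  -- `T̄_1`
  | 0 => (∀ X ∈ V ξ, ∀ Y ∈ V ξ, ∀ Z ∈ V ξ, h X Y Z = -h Y X Z) ∧
      ZeroVVxi ξ h ∧ ZeroXiVxi ξ h ∧ ZeroXiVV ξ h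
  -- `T̄_2`
  | 1 => (∀ X ∈ V ξ, ∀ Y ∈ V ξ, ∀ Z ∈ V ξ, h X Y Z + h Y Z X + h Z X Y = 0) ∧
      ZeroVVxi ξ h ∧ ZeroXiVxi ξ h ∧ ZeroXiVV ξ h
  -- `T̄_3`
  | 2 => (∀ X ∈ V ξ, ∀ Y ∈ V ξ, ∀ Z ∈ V ξ, h X Y Z - h (F X) (F Y) Z = 0) ∧
      (∀ Z ∈ V ξ, beta ξ h Z = 0) ∧
      ZeroVVxi ξ h ∧ ZeroXiVxi ξ h ∧ ZeroXiVV ξ h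
  -- `T̄_4`
  | 3 => (∀ X ∈ V ξ, ∀ Y ∈ V ξ, ∀ Z ∈ V ξ,
        h X Y Z = 1 / (2 * ((n : ℝ) - 1)) *
          (inner ℝ X Y * beta ξ h Z - inner ℝ X Z * beta ξ h Y
            - inner ℝ X (F Y) * beta ξ h (F Z) + inner ℝ X (F Z) * beta ξ h (F Y))) ∧
      ZeroVVxi ξ h ∧ ZeroXiVxi ξ h ∧ ZeroXiVV ξ h
  -- `T̄_5`
  | 4 => (∀ X ∈ V ξ, ∀ Y ∈ V ξ, h X Y ξ = -h Y X ξ) ∧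
      (∀ X ∈ V ξ, ∀ Y ∈ V ξ, h (F X) (F Y) ξ = h X Y ξ) ∧ betaBar F ξ h ξ = 0 ∧
      ZeroVVV ξ h ∧ ZeroXiVxi ξ h ∧ ZeroXiVV ξ h
  -- `T̄_6`
  | 5 => (∀ X ∈ V ξ, ∀ Y ∈ V ξ, h X Y ξ = -h Y X ξ) ∧
      (∀ X ∈ V ξ, ∀ Y ∈ V ξ, h (F X) (F Y) ξ = -h X Y ξ) ∧
      ZeroVVV ξ h ∧ ZeroXiVxi ξ h ∧ ZeroXiVV ξ h
  -- `T̄_7`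
  | 6 => (∀ X ∈ V ξ, ∀ Y ∈ V ξ,
        h X Y ξ = 1 / (2 * (n : ℝ)) * (inner ℝ (F X) Y * betaBar F ξ h ξ)) ∧
      ZeroVVV ξ h ∧ ZeroXiVxi ξ h ∧ ZeroXiVV ξ h
  -- `T̄_8`
  | 7 => (∀ X ∈ V ξ, ∀ Y ∈ V ξ, h X Y ξ = h Y X ξ) ∧
      (∀ X ∈ V ξ, ∀ Y ∈ V ξ, h (F X) (F Y) ξ = h X Y ξ) ∧ beta ξ h ξ = 0 ∧
      ZeroVVV ξ h ∧ ZeroXiVxi ξ h ∧ ZeroXiVV ξ h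
  -- `T̄_9`
  | 8 => (∀ X ∈ V ξ, ∀ Y ∈ V ξ, h X Y ξ = h Y X ξ) ∧
      (∀ X ∈ V ξ, ∀ Y ∈ V ξ, h (F X) (F Y) ξ = -h X Y ξ) ∧
      ZeroVVV ξ h ∧ ZeroXiVxi ξ h ∧ ZeroXiVV ξ h
  -- `T̄_10`
  | 9 => (∀ X ∈ V ξ, ∀ Y ∈ V ξ,
        h X Y ξ = 1 / (2 * (n : ℝ)) * (inner ℝ X Y * beta ξ h ξ)) ∧
      ZeroVVV ξ h ∧ ZeroXiVxi ξ h ∧ ZeroXiVV ξ h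
  -- `T̄_11`
  | 10 => ZeroVVV ξ h ∧ ZeroVVxi ξ h ∧ ZeroXiVV ξ h
  -- `T̄_12`
  | 11 => (∀ X ∈ V ξ, ∀ Y ∈ V ξ, h ξ X Y = -h ξ Y X) ∧
      (∀ X ∈ V ξ, ∀ Y ∈ V ξ, h ξ X Y = -h ξ (F X) (F Y)) ∧
      ZeroVVV ξ h ∧ ZeroVVxi ξ h ∧ ZeroXiVxi ξ h

lemma beta_add (ξ : T) (h k : Tensor3 T) (U : T) :
    beta ξ (h + k) U = beta ξ h U + beta ξ k U := by
  simp [beta, Finset.sum_add_distrib]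

lemma beta_smul (ξ : T) (c : ℝ) (h : Tensor3 T) (U : T) :
    beta ξ (c • h) U = c * beta ξ h U := by
  simp [beta, Finset.mul_sum]

lemma betaBar_add (F : T →ₗ[ℝ] T) (ξ : T) (h k : Tensor3 T) (U : T) :
    betaBar F ξ (h + k) U = betaBar F ξ h U + betaBar F ξ k U := by
  simp [betaBar, Finset.sum_add_distrib]

lemma betaBar_smul (F : T →ₗ[ℝ] T) (ξ : T) (c : ℝ) (h : Tensor3 T) (U : T) :
    betaBar F ξ (c • h) U = c * betaBar F ξ h U := by
  simp [betaBar, Finset.mul_sum]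

lemma tableCondition_add (n : ℕ) (F : T →ₗ[ℝ] T) (ξ : T) (i : Fin 12) {h k : Tensor3 T}
    (hh : tableCondition n F ξ h i) (hk : tableCondition n F ξ k i) :
    tableCondition n F ξ (h + k) i := by
  fin_cases i <;>
  simp only [tableCondition, ZeroVVV, ZeroVVxi, ZeroXiVxi, ZeroXiVV, LinearMap.add_apply,
    beta_add, betaBar_add] at hh hk ⊢ <;>
  grind

lemma tableCondition_smul (n : ℕ) (F : T →ₗ[ℝ] T) (ξ : T) (i : Fin 12) (c : ℝ) {h : Tensor3 T}
    (hh : tableCondition n F ξ h i) : tableCondition n F ξ (c • h) i := by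
  fin_cases i <;>
  simp only [tableCondition, ZeroVVV, ZeroVVxi, ZeroXiVxi, ZeroXiVV, LinearMap.smul_apply,
    smul_eq_mul, beta_smul, betaBar_smul] at hh ⊢ <;>
  grind

/-- The twelve subspaces `T̄_1, …, T̄_12` of `T̄(T)` (with `T̄_{i+1}` at the index `i`). -/
def TbarSub (n : ℕ) (F : T →ₗ[ℝ] T) (ξ : T) (i : Fin 12) : Submodule ℝ (Tensor3 T) where
  carrier := {h | h ∈ Tbar F ξ ∧ tableCondition n F ξ h i}
  zero_mem' := by
    refine ⟨zero_mem _, ?_⟩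
    fin_cases i <;>
    simp [tableCondition, ZeroVVV, ZeroVVxi, ZeroXiVxi, ZeroXiVV, beta, betaBar]
  add_mem' := fun hh hk => ⟨add_mem hh.1 hk.1, tableCondition_add n F ξ i hh.2 hk.2⟩
  smul_mem' := fun c _ hh =>
    ⟨Submodule.smul_mem _ c hh.1, tableCondition_smul n F ξ i c hh.2⟩

/-- The dimensions of the twelve subspaces. -/
def tableDim (n : ℚ) : Fin 12 → ℚ
  | 0 => n * (n - 1) * (n - 2) / 3
  | 1 => 2 * n * (n - 1) * (n + 1) / 3
  | 2 => n * (n + 1) * (n - 2)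
  | 3 => 2 * n
  | 4 => n ^ 2 - 1
  | 5 => n ^ 2 - n
  | 6 => 1
  | 7 => n ^ 2 - 1
  | 8 => n ^ 2 + n
  | 9 => 1
  | 10 => 2 * n
  | 11 => n ^ 2 - n

/-- The sum `T̄_α` of the subspaces `T̄_i` with `i ∈ α`. -/
def TbarClass (n : ℕ) (F : T →ₗ[ℝ] T) (ξ : T) (α : Finset (Fin 12)) :
    Submodule ℝ (Tensor3 T) :=
  ⨆ i ∈ α, TbarSub n F ξ i

end Algebra

/-! ## Almost contact metric manifolds -/

section Manifold

variable {n : ℕ} {M : Type*} [TopologicalSpace M]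
  [ChartedSpace (EuclideanSpace ℝ (Fin (2 * n + 1))) M]

instance (p : M) : FiniteDimensional ℝ (TangentSpace (𝓡 (2 * n + 1)) p) :=
  inferInstanceAs (FiniteDimensional ℝ (EuclideanSpace ℝ (Fin (2 * n + 1))))

variable [IsManifold (𝓡 (2 * n + 1)) ∞ M]
  [RiemannianBundle (fun x : M => TangentSpace (𝓡 (2 * n + 1)) x)]

variable (n M) in
/-- An almost contact metric structure `(F, ξ)` on the Riemannian manifold `M` of dimension
`2n + 1`: a smooth field `F` of endomorphisms and a smooth vector field `ξ` that form, with the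
Riemannian metric, an almost contact metric structure on every tangent space. -/
structure AlmostContactMetricStructure where
  F : ∀ x : M, TangentSpace (𝓡 (2 * n + 1)) x →L[ℝ] TangentSpace (𝓡 (2 * n + 1)) x
  ξ : ∀ x : M, TangentSpace (𝓡 (2 * n + 1)) x
  smooth_F : ContMDiff (𝓡 (2 * n + 1))
    ((𝓡 (2 * n + 1)).prod
      𝓘(ℝ, EuclideanSpace ℝ (Fin (2 * n + 1)) →L[ℝ] EuclideanSpace ℝ (Fin (2 * n + 1)))) ∞
    (fun x => TotalSpace.mk'
      (EuclideanSpace ℝ (Fin (2 * n + 1)) →L[ℝ] EuclideanSpace ℝ (Fin (2 * n + 1)))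
      (E := fun x : M =>
        TangentSpace (𝓡 (2 * n + 1)) x →L[ℝ] TangentSpace (𝓡 (2 * n + 1)) x) x (F x))
  smooth_xi : ContMDiff (𝓡 (2 * n + 1)) (𝓡 (2 * n + 1)).tangent ∞
    (fun x => (⟨x, ξ x⟩ : TangentBundle (𝓡 (2 * n + 1)) M))
  isAlmostContactMetric : ∀ x, IsAlmostContactMetric (F x).toLinearMap (ξ x)

/-- `∇` is the Levi-Civita connection: it is torsion-free and compatible with the metric. -/
def IsLeviCivita [IsContMDiffRiemannianBundle (𝓡 (2 * n + 1)) ∞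
      (EuclideanSpace ℝ (Fin (2 * n + 1))) (fun x : M => TangentSpace (𝓡 (2 * n + 1)) x)]
    (cov : CovariantDerivative (𝓡 (2 * n + 1)) (EuclideanSpace ℝ (Fin (2 * n + 1)))
      (TangentSpace (𝓡 (2 * n + 1)) : M → Type _)) : Prop :=
  haveI : IsContMDiffRiemannianBundle (𝓡 (2 * n + 1)) 1 (EuclideanSpace ℝ (Fin (2 * n + 1)))
      (TangentSpace (𝓡 (2 * n + 1)) : M → Type _) :=
    IsContMDiffRiemannianBundle.of_le (n := ∞)
      (E := fun x : M => TangentSpace (𝓡 (2 * n + 1)) x) (by norm_cast)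
  cov.torsion = 0 ∧ cov.IsMetricCompatible

namespace AlmostContactMetricStructure

variable (S : AlmostContactMetricStructure n M)
  (cov : CovariantDerivative (𝓡 (2 * n + 1)) (EuclideanSpace ℝ (Fin (2 * n + 1)))
      (TangentSpace (𝓡 (2 * n + 1)) : M → Type _))

/-- The projection `π₁ = I + F²` onto the line `L` spanned by `ξ`. -/
def proj1 (x : M) :
    TangentSpace (𝓡 (2 * n + 1)) x →L[ℝ] TangentSpace (𝓡 (2 * n + 1)) x :=
  ContinuousLinearMap.id ℝ _ + (S.F x).comp (S.F x)

/-- The projection `π₂ = -F²` onto `V = ξ^⊥`. -/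
def proj2 (x : M) :
    TangentSpace (𝓡 (2 * n + 1)) x →L[ℝ] TangentSpace (𝓡 (2 * n + 1)) x :=
  -(S.F x).comp (S.F x)

/-- The canonical connection
`∇̄_X Y = π₁ ∇_X (π₁ Y) + ½ π₂ (∇_X (π₂ Y) - F ∇_X (F π₂ Y))` at the point `p`. -/
def canonicalConnection (Y : ∀ x : M, TangentSpace (𝓡 (2 * n + 1)) x) (p : M)
    (X : TangentSpace (𝓡 (2 * n + 1)) p) : TangentSpace (𝓡 (2 * n + 1)) p :=
  S.proj1 p (cov (fun x => S.proj1 x (Y x)) p X) +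
    (1 / 2 : ℝ) • S.proj2 p (cov (fun x => S.proj2 x (Y x)) p X
      - S.F p (cov (fun x => S.F x (S.proj2 x (Y x))) p X))

/-- `h` is the second fundamental tensor at `p` of the structure:
`h_{XYZ} = ⟨∇_X Y - ∇̄_X Y, Z⟩`, for all vector fields `Y` that are differentiable at `p`. -/
def IsSecondFundamentalTensorAt (p : M)
    (h : Tensor3 (TangentSpace (𝓡 (2 * n + 1)) p)) : Prop :=
  ∀ (X Z : TangentSpace (𝓡 (2 * n + 1)) p) (Y : ∀ x : M, TangentSpace (𝓡 (2 * n + 1)) x),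
    MDifferentiableAt (𝓡 (2 * n + 1)) (𝓡 (2 * n + 1)).tangent
        (fun x => (⟨x, Y x⟩ : TangentBundle (𝓡 (2 * n + 1)) M)) p →
      h X (Y p) Z = inner ℝ (cov Y p X - S.canonicalConnection cov Y p X) Z

/-- The structure is of the class `T̄_α`: at every point `p` its second fundamental tensor `h_p`
lies in `T̄_α(T_p M)`. -/
def IsOfClass (α : Finset (Fin 12)) : Prop :=
  ∀ p : M, ∃ h ∈ TbarClass n (S.F p).toLinearMap (S.ξ p) α,
    S.IsSecondFundamentalTensorAt cov p h

end AlmostContactMetricStructure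

end Manifold

end ACM

end

/-! An almost contact metric vector space is a Hermitian space `V` plus the line of `ξ`, and
everything is read off in unitary frames `e_1, …, e_n, Fe_1, …, Fe_n, ξ`. Frames exist
(`IsAlmostContactMetric.exists_frame`), and the structure group is transitive on them
(`IsUnitaryFrame.exists_mem_structureGroup`). Traces and inner products may therefore be computed in
any frame, which makes them invariant.

Orthogonality and spanning. A tensor in `Tbar` is given by four blocks of components: on `V × V ×
V`, on `V × V × ξ`, on `ξ × V × ξ` and on `ξ × V × V`; each of the twelve subspaces lives in one
block. Inside a block they are told apart by the behaviour under exchange of arguments, by the sign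
under `(X, Y) ↦ (FX, FY)`, by the cyclic sum, or by a trace. Each of these differences forces the
inner product to vanish (`IsUnitaryFrame.sum_VVV_eq_zero`, `IsUnitaryFrame.sum_VVxi_eq_zero`), and
the corresponding projections, written out explicitly, show that the twelve subspaces span
(`iSup_TbarSub`).

Dimensions. No bases of the large summands are built. Counting the components that determine a
tensor bounds each summand from above; three of the bounds hold for a sum of two summands, one of
which has its dimension found separately. From below, `Tbar` has a complement contained in the sum
of two spaces of tensors that are again bounded by counting components (`le_finrank_Tbar`). The
upper bounds add up to exactly this lower bound, so all of them are equalities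
(`finrank_TbarSub_and_Tbar`).

Irreducibility. The criterion `isIrreducible_of_weight` is a real form of a weight argument. Take a
component functional `ℓ` in a frame that is an eigenvector of some elements of the diagonal torus.
Suppose that only `0` has `ℓ` vanishing on its whole orbit, and that the vectors of the same weight
form at most a plane, turned by a quarter turn `j` in one frame vector. Then an invariant subspace
either meets this plane trivially and is `0`, or contains the vector that represents `ℓ`, and hence
everything. Verifying the hypotheses is linear algebra in frames: sign changes and quarter turns
isolate a component, while permutations and rotations by 45 degrees spread the vanishing of one
component in all frames to all components. One-dimensional summands need no argument.

Manifolds. The difference of the two connections is an expression in the covariant derivatives of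
`Y`, `FY`, `F²Y` in which the derivatives of a scalar factor cancel, so it is a tensor
(`tensorialAt_connectionDifference`). Metric compatibility, applied to inner products of these
fields, puts it in `Tbar`. By orthogonality, membership in a partial sum means orthogonality to the
omitted summands, so the least class consists of the indices that are detected at some point
(`existsUnique_isOfClass`). -/

noncomputable section

namespace ACM

/-! ### Unitary frames of an almost contact metric vector space -/

section Frames

variable {T : Type*} [NormedAddCommGroup T] [InnerProductSpace ℝ T] {F : T →ₗ[ℝ] T} {ξ : T}

lemma mem_V {X : T} : X ∈ V ξ ↔ inner ℝ ξ X = 0 :=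
  Submodule.mem_orthogonal_singleton_iff_inner_right

namespace IsAlmostContactMetric

variable (hS : IsAlmostContactMetric F ξ)
include hS

lemma inner_xi_xi : inner ℝ ξ ξ = (1 : ℝ) := by
  rw [real_inner_self_eq_norm_sq, hS.norm_xi]; norm_num

lemma sub_mem_V (X : T) : X - (inner ℝ ξ X : ℝ) • ξ ∈ V ξ := by
  rw [mem_V, inner_sub_right, inner_smul_right, hS.inner_xi_xi]; ring

/-- Write `F X = w + c ξ` with `w ∈ V`. Then `F w = F (F X) = -X`, so `w` has the length of `X`; but
`F X` has this length too, which leaves `c² = 0`. -/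
lemma map_mem_of_mem {X : T} (hX : X ∈ V ξ) : F X ∈ V ξ := by
  set c : ℝ := inner ℝ ξ (F X) with hc
  set w := F X - c • ξ with hw
  have hwV : w ∈ V ξ := hS.sub_mem_V _
  have hFX : F X = w + c • ξ := by rw [hw]; abel
  have hFw : F w = -X := by
    rw [hw, map_sub, map_smul, hS.map_xi, smul_zero, sub_zero, hS.sq_eq_neg X hX]
  have h1 := hS.inner_map w hwV w hwV
  rw [hFw, inner_neg_neg] at h1
  have h2 := hS.inner_map X hX X hX
  have h3 : inner ℝ ξ w = (0 : ℝ) := mem_V.1 hwV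
  rw [hFX] at h2
  simp only [inner_add_left, inner_add_right, inner_smul_left, inner_smul_right,
    real_inner_comm ξ w, h3, hS.inner_xi_xi, h1] at h2
  have h4 : c = 0 := by
    have : c * c = 0 := by simpa using h2
    simpa using this
  rw [mem_V, ← hc, h4]

lemma map_eq_map_sub (X : T) : F X = F (X - (inner ℝ ξ X : ℝ) • ξ) := by
  simp [hS.map_xi]

lemma map_mem (X : T) : F X ∈ V ξ := by
  rw [hS.map_eq_map_sub]; exact hS.map_mem_of_mem (hS.sub_mem_V X)

@[simp] lemma inner_xi_map (X : T) : inner ℝ ξ (F X) = (0 : ℝ) := mem_V.1 (hS.map_mem X)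

/-- On `V` an isometry with square `-1` is skew. This extends to `T` because `F` kills `ξ` and has
its image in `V`. -/
lemma inner_map_left (X Y : T) : inner ℝ (F X) Y = -(inner ℝ X (F Y) : ℝ) := by
  have h : ∀ X ∈ V ξ, ∀ Y ∈ V ξ, inner ℝ (F X) Y = -(inner ℝ X (F Y) : ℝ) := by
    intro X hX Y hY
    have := hS.inner_map _ hX _ (hS.map_mem Y)
    rw [hS.sq_eq_neg _ hY, inner_neg_right] at this
    linarith
  have h1 : inner ℝ (F X) Y = (inner ℝ (F X) (Y - (inner ℝ ξ Y : ℝ) • ξ) : ℝ) := by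
    rw [inner_sub_right, inner_smul_right, real_inner_comm ξ (F X), hS.inner_xi_map]; ring
  have h2 : inner ℝ X (F Y) = (inner ℝ (X - (inner ℝ ξ X : ℝ) • ξ) (F Y) : ℝ) := by
    rw [inner_sub_left, inner_smul_left, hS.inner_xi_map]; simp
  rw [h1, h2, hS.map_eq_map_sub X, hS.map_eq_map_sub Y]
  exact h _ (hS.sub_mem_V X) _ (hS.sub_mem_V Y)

end IsAlmostContactMetric

/-- A partial unitary frame: the vectors `e a` lie in `V`, and the `e a` and `F (e a)` are
orthonormal. -/
structure IsUnitaryFrame (F : T →ₗ[ℝ] T) (ξ : T) {m : ℕ} (e : Fin m → T) : Prop where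
  mem : ∀ a, e a ∈ V ξ
  inner_eq : ∀ a b, inner ℝ (e a) (e b) = if a = b then (1 : ℝ) else 0
  inner_map_eq : ∀ a b, inner ℝ (e a) (F (e b)) = (0 : ℝ)

/-- The vectors `e a`, `F (e a)` of a frame. -/
def frameV (F : T →ₗ[ℝ] T) {m : ℕ} (e : Fin m → T) : Fin m ⊕ Fin m → T :=
  Sum.elim e fun a => F (e a)

/-- The vectors `e a`, `F (e a)` and `ξ` of a frame. -/
def frameT (F : T →ₗ[ℝ] T) (ξ : T) {m : ℕ} (e : Fin m → T) : (Fin m ⊕ Fin m) ⊕ Unit → T :=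
  Sum.elim (frameV F e) fun _ => ξ

namespace IsUnitaryFrame

variable {m : ℕ} {e : Fin m → T} (he : IsUnitaryFrame F ξ e) (hS : IsAlmostContactMetric F ξ)
include he hS

lemma frameV_mem (i : Fin m ⊕ Fin m) : frameV F e i ∈ V ξ := by
  rcases i with a | a
  · exact he.mem a
  · exact hS.map_mem _

lemma map_map (a : Fin m) : F (F (e a)) = -e a := hS.sq_eq_neg _ (he.mem a)

lemma orthonormal_frameV : Orthonormal ℝ (frameV F e) := by
  rw [orthonormal_iff_ite]
  rintro (a | a) (b | b)
  · simpa [frameV] using he.inner_eq a b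
  · simpa [frameV] using he.inner_map_eq a b
  · simpa [frameV, real_inner_comm] using he.inner_map_eq b a
  · simpa [frameV, hS.inner_map _ (he.mem a) _ (he.mem b)] using he.inner_eq a b

lemma orthonormal_frameT : Orthonormal ℝ (frameT F ξ e) := by
  have h1 := orthonormal_iff_ite.1 (he.orthonormal_frameV hS)
  have h2 : ∀ i, inner ℝ ξ (frameV F e i) = (0 : ℝ) := fun i => mem_V.1 (he.frameV_mem hS i)
  rw [orthonormal_iff_ite]
  rintro (a | a) (b | b)
  · simpa [frameT] using h1 a b
  · simpa [frameT, real_inner_comm] using h2 a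
  · simpa [frameT] using h2 b
  · simp [frameT, hS.norm_xi]

end IsUnitaryFrame

lemma IsAlmostContactMetric.finrank_V [FiniteDimensional ℝ T] (hS : IsAlmostContactMetric F ξ)
    {n : ℕ} (hT : Module.finrank ℝ T = 2 * n + 1) : Module.finrank ℝ (V ξ) = 2 * n := by
  have h1 := Submodule.finrank_add_finrank_orthogonal (Submodule.span ℝ {ξ})
  rw [finrank_span_singleton (by rintro rfl; simpa using hS.norm_xi), hT] at h1
  change Module.finrank ℝ ↥(V ξ) = _
  change 1 + Module.finrank ℝ ↥(V ξ) = _ at h1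
  omega

/-- Unitary frames of every length up to `n` exist. -/
lemma IsAlmostContactMetric.exists_frame_le [FiniteDimensional ℝ T]
    (hS : IsAlmostContactMetric F ξ) {n : ℕ} (hT : Module.finrank ℝ T = 2 * n + 1) (k : ℕ)
    (hk : k ≤ n) : ∃ e : Fin k → T, IsUnitaryFrame F ξ e := by
  induction k with
  | zero => exact ⟨fun a => a.elim0, ⟨fun a => a.elim0, fun a => a.elim0, fun a => a.elim0⟩⟩
  | succ k ih =>
    obtain ⟨e, he⟩ := ih (by omega)
    set S := Submodule.span ℝ (Set.range (frameT F ξ e))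
    have hfr : Module.finrank ℝ S ≤ 2 * k + 1 := by
      have := finrank_range_le_card (R := ℝ) (frameT F ξ e)
      simp only [Set.finrank, Fintype.card_sum, Fintype.card_fin, Fintype.card_unit] at this
      change Module.finrank ℝ S ≤ _ at this
      omega
    have h1 := Submodule.finrank_add_finrank_orthogonal S
    -- The vectors already chosen, with `ξ`, span at most `2k + 1 < 2n + 1` dimensions.
    have : 0 < Module.finrank ℝ Sᗮ := by omega
    rw [Module.finrank_pos_iff_exists_ne_zero] at this
    obtain ⟨⟨x, hx⟩, hx0⟩ := this
    have hx0 : x ≠ 0 := by simpa using hx0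
    have hxS : ∀ i, inner ℝ (frameT F ξ e i) x = (0 : ℝ) := fun i =>
      Submodule.inner_right_of_mem_orthogonal (Submodule.subset_span (Set.mem_range_self i)) hx
    set u := (‖x‖⁻¹ : ℝ) • x
    have hu : ∀ i, inner ℝ (frameT F ξ e i) u = (0 : ℝ) := fun i => by
      rw [inner_smul_right, hxS, mul_zero]
    have huu : inner ℝ u u = (1 : ℝ) := by
      rw [real_inner_self_eq_norm_sq, norm_smul, norm_inv, norm_norm,
        inv_mul_cancel₀ (norm_ne_zero_iff.2 hx0)]; norm_num
    have huV : u ∈ V ξ := mem_V.2 (hu (Sum.inr ()))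
    have hue : ∀ a, inner ℝ (e a) u = (0 : ℝ) := fun a => hu (Sum.inl (Sum.inl a))
    have huFe : ∀ a, inner ℝ (F (e a)) u = (0 : ℝ) := fun a => hu (Sum.inl (Sum.inr a))
    -- Skewness of `F` makes `F u` orthogonal to `u` and, with `huFe`, to the earlier `e a`, so
    -- extending the frame by `u` alone suffices.
    have huFu : inner ℝ u (F u) = (0 : ℝ) := by
      have := hS.inner_map_left u u
      rw [real_inner_comm] at this; linarith
    refine ⟨Fin.cons u e, ⟨?_, ?_, ?_⟩⟩
    · intro a; refine Fin.cases huV (fun a => ?_) a; exact he.mem a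
    · intro a b
      refine Fin.cases ?_ (fun a => ?_) a <;> refine Fin.cases ?_ (fun b => ?_) b
      · simpa only [Fin.cons_zero, if_true] using huu
      · simp [real_inner_comm, hue, (Fin.succ_ne_zero _).symm]
      · simp [hue]
      · simp [he.inner_eq]
    · intro a b
      refine Fin.cases ?_ (fun a => ?_) a <;> refine Fin.cases ?_ (fun b => ?_) b
      · simp [huFu]
      · simpa [real_inner_comm] using huFe b
      · have := hS.inner_map_left (e a) u
        rw [huFe] at this
        simp; linarith
      · simp [he.inner_map_eq]

lemma IsAlmostContactMetric.exists_frame [FiniteDimensional ℝ T]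
    (hS : IsAlmostContactMetric F ξ) {n : ℕ} (hT : Module.finrank ℝ T = 2 * n + 1) :
    ∃ e : Fin n → T, IsUnitaryFrame F ξ e :=
  hS.exists_frame_le hT n le_rfl

/-- The sum `∑ B(b_i, b_i)` does not depend on the orthonormal basis. -/
lemma sum_orthonormalBasis_eq {E ι κ : Type*} [NormedAddCommGroup E] [InnerProductSpace ℝ E]
    [Fintype ι] [Fintype κ] (b : OrthonormalBasis ι ℝ E) (c : OrthonormalBasis κ ℝ E)
    (B : E →ₗ[ℝ] E →ₗ[ℝ] ℝ) : ∑ i, B (b i) (b i) = ∑ j, B (c j) (c j) := by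
  classical
  have h1 : ∀ i, B (b i) (b i) =
      ∑ j, ∑ k, (inner ℝ (c j) (b i) * inner ℝ (b i) (c k)) * B (c j) (c k) := by
    intro i
    conv_lhs => rw [← c.sum_repr' (b i)]
    simp only [map_sum, LinearMap.sum_apply, map_smul, LinearMap.smul_apply, smul_eq_mul,
      Finset.mul_sum]
    rw [Finset.sum_comm]
    refine Finset.sum_congr rfl fun j _ => Finset.sum_congr rfl fun k _ => ?_
    rw [real_inner_comm (b i) (c k)]; ring
  simp_rw [h1]
  rw [Finset.sum_comm]
  refine Finset.sum_congr rfl fun j _ => ?_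
  rw [Finset.sum_comm]
  -- Parseval in the basis `b` turns the coefficient matrix into the Gram matrix of `c`.
  simp_rw [← Finset.sum_mul, b.sum_inner_mul_inner, orthonormal_iff_ite.1 c.orthonormal]
  simp

section Bases

variable [FiniteDimensional ℝ T] {n : ℕ} {e : Fin n → T}

/-- The orthonormal basis of `T` given by a unitary frame. -/
def IsUnitaryFrame.basisT (he : IsUnitaryFrame F ξ e) (hS : IsAlmostContactMetric F ξ)
    (hT : Module.finrank ℝ T = 2 * n + 1) :
    OrthonormalBasis ((Fin n ⊕ Fin n) ⊕ Unit) ℝ T :=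
  OrthonormalBasis.mk (he.orthonormal_frameT hS)
    ((he.orthonormal_frameT hS).linearIndependent.span_eq_top_of_card_eq_finrank'
      (by simp [hT]; ring)).ge

/-- The orthonormal basis of `V` given by a unitary frame. -/
def IsUnitaryFrame.basisV (he : IsUnitaryFrame F ξ e) (hS : IsAlmostContactMetric F ξ)
    (hT : Module.finrank ℝ T = 2 * n + 1) :
    OrthonormalBasis (Fin n ⊕ Fin n) ℝ (V ξ) :=
  have h : Orthonormal ℝ fun i => (⟨frameV F e i, he.frameV_mem hS i⟩ : V ξ) :=
    (Submodule.subtypeₗᵢ (V ξ)).orthonormal_comp_iff.1 (he.orthonormal_frameV hS)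
  OrthonormalBasis.mk h (h.linearIndependent.span_eq_top_of_card_eq_finrank'
    (by simp [hS.finrank_V hT]; ring)).ge

variable (he : IsUnitaryFrame F ξ e) (hS : IsAlmostContactMetric F ξ)
  (hT : Module.finrank ℝ T = 2 * n + 1)

@[simp] lemma IsUnitaryFrame.basisT_apply (i) : he.basisT hS hT i = frameT F ξ e i := by
  simp [IsUnitaryFrame.basisT]

@[simp] lemma IsUnitaryFrame.basisV_apply (i) : (he.basisV hS hT i : T) = frameV F e i := by
  simp [IsUnitaryFrame.basisV]

include he hS hT

/-- The traces `beta` and `betaBar` are defined with an arbitrary chosen basis; this makes them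
computable in every unitary frame. -/
lemma IsUnitaryFrame.sum_V (B : T →ₗ[ℝ] T →ₗ[ℝ] ℝ) {ι : Type*} [Fintype ι]
    (b : OrthonormalBasis ι ℝ (V ξ)) :
    ∑ i, B (b i) (b i) = ∑ a, (B (e a) (e a) + B (F (e a)) (F (e a))) := by
  have := sum_orthonormalBasis_eq b (he.basisV hS hT) (B.domRestrict₁₂ (V ξ) (V ξ))
  simp only [LinearMap.domRestrict₁₂_apply, he.basisV_apply, Fintype.sum_sum_type, frameV,
    Sum.elim_inl, Sum.elim_inr] at this
  rw [this, Finset.sum_add_distrib]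

lemma IsUnitaryFrame.beta_eq (h : Tensor3 T) (U : T) :
    beta ξ h U = ∑ a, (h (e a) (e a) U + h (F (e a)) (F (e a)) U) :=
  he.sum_V hS hT (LinearMap.compr₂ h (LinearMap.applyₗ U)) _

lemma IsUnitaryFrame.betaBar_eq (h : Tensor3 T) (U : T) :
    betaBar F ξ h U = ∑ a, (h (e a) (F (e a)) U - h (F (e a)) (e a) U) := by
  have := he.sum_V hS hT ((LinearMap.compr₂ h (LinearMap.applyₗ U)).compl₂ F)
    (stdOrthonormalBasis ℝ (V ξ))
  simp only [LinearMap.compl₂_apply, LinearMap.compr₂_apply, LinearMap.applyₗ_apply_apply,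
    he.map_map hS, map_neg] at this
  rw [betaBar]
  simpa [sub_eq_add_neg] using this

/-- Vectors of `V` are combinations of the frame vectors. -/
lemma IsUnitaryFrame.mem_induction {p : T → Prop} (h1 : ∀ a, p (e a)) (h2 : ∀ a, p (F (e a)))
    (hadd : ∀ X Y, p X → p Y → p (X + Y)) (hsmul : ∀ (c : ℝ) X, p X → p (c • X)) (h0 : p 0)
    {X : T} (hX : X ∈ V ξ) : p X := by
  have h3 := (he.basisV hS hT).sum_repr ⟨X, hX⟩
  have h4 : X = ∑ i, (he.basisV hS hT).repr ⟨X, hX⟩ i • frameV F e i := by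
    have := congrArg (Subtype.val) h3
    simp only [Submodule.coe_sum, Submodule.coe_smul, he.basisV_apply] at this
    exact this.symm
  rw [h4]
  refine Finset.sum_induction _ p hadd h0 ?_
  rintro (a | a) _
  · exact hsmul _ _ (h1 a)
  · exact hsmul _ _ (h2 a)

lemma IsUnitaryFrame.linearMap_eq_zero {N : Type*} [AddCommGroup N] [Module ℝ N] (L : T →ₗ[ℝ] N)
    (h1 : ∀ a, L (e a) = 0) (h2 : ∀ a, L (F (e a)) = 0) : ∀ X ∈ V ξ, L X = 0 := fun X hX =>
  he.mem_induction hS hT (p := fun X => L X = 0) h1 h2 (by simp +contextual)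
    (by simp +contextual) (by simp) hX

/-- Any two unitary frames are related by an element of `U(n) × 1`. -/
lemma IsUnitaryFrame.exists_mem_structureGroup {e' : Fin n → T} (he' : IsUnitaryFrame F ξ e') :
    ∃ g ∈ structureGroup F ξ, ∀ a, g (e a) = e' a := by
  set g := (he.basisT hS hT).equiv (he'.basisT hS hT) (Equiv.refl _)
  have hg : ∀ i, g (frameT F ξ e i) = frameT F ξ e' i := fun i => by
    rw [← he.basisT_apply hS hT, ← he'.basisT_apply hS hT, OrthonormalBasis.equiv_apply_basis]
    rfl
  have h1 : ∀ a, g (e a) = e' a := fun a => hg (Sum.inl (Sum.inl a))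
  have h2 : ∀ a, g (F (e a)) = F (e' a) := fun a => hg (Sum.inl (Sum.inr a))
  have h3 : g ξ = ξ := hg (Sum.inr ())
  refine ⟨g, ⟨fun X => ?_, h3⟩, h1⟩
  have h4 : g.toLinearEquiv.toLinearMap ∘ₗ F = F ∘ₗ g.toLinearEquiv.toLinearMap := by
    refine (he.basisT hS hT).toBasis.ext ?_
    rintro ((a | a) | a)
    · simp [frameT, frameV, h1, h2]
    · simp [frameT, frameV, h2, he.map_map hS, he'.map_map hS, h1]
    · simp [frameT, h3, hS.map_xi]
  exact LinearMap.congr_fun h4 X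

end Bases

end Frames

/-! ### The action of the structure group and the invariant inner product -/

section Action

variable {T : Type*} [NormedAddCommGroup T] [InnerProductSpace ℝ T] {F : T →ₗ[ℝ] T} {ξ : T}

lemma map_mem_V {g : T ≃ₗᵢ[ℝ] T} (hg : g ∈ structureGroup F ξ) {X : T} (hX : X ∈ V ξ) :
    g X ∈ V ξ := by
  rw [mem_V] at hX ⊢
  have h1 : g ξ = ξ := hg.2
  rw [← h1, g.inner_map_map, hX]

lemma IsUnitaryFrame.map {m : ℕ} {e : Fin m → T} (he : IsUnitaryFrame F ξ e) {g : T ≃ₗᵢ[ℝ] T}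
    (hg : g ∈ structureGroup F ξ) : IsUnitaryFrame F ξ fun a => g (e a) where
  mem a := map_mem_V hg (he.mem a)
  inner_eq a b := by rw [g.inner_map_map, he.inner_eq]
  inner_map_eq a b := by rw [← hg.1, g.inner_map_map, he.inner_map_eq]

lemma act_add (g : T ≃ₗᵢ[ℝ] T) (h k : Tensor3 T) : act g (h + k) = act g h + act g k := rfl

lemma act_smul (g : T ≃ₗᵢ[ℝ] T) (c : ℝ) (h : Tensor3 T) : act g (c • h) = c • act g h := rfl

lemma act_mul (g g' : T ≃ₗᵢ[ℝ] T) (h : Tensor3 T) : act (g * g') h = act g (act g' h) := by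
  ext X Y Z
  simp only [act_apply, mul_inv_rev, LinearIsometryEquiv.coe_mul, Function.comp]

lemma act_inv_act (g : T ≃ₗᵢ[ℝ] T) (h : Tensor3 T) : act g⁻¹ (act g h) = h := by
  rw [← act_mul]; ext X Y Z; simp [act_apply]

/-- The action of an isometry as a linear map. -/
def actₗ (g : T ≃ₗᵢ[ℝ] T) : Tensor3 T →ₗ[ℝ] Tensor3 T where
  toFun := act g
  map_add' := act_add g
  map_smul' := act_smul g

@[simp] lemma actₗ_apply (g : T ≃ₗᵢ[ℝ] T) (h : Tensor3 T) : actₗ g h = act g h := rfl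

lemma isInvariant_Tbar : IsInvariant F ξ (Tbar F ξ) := by
  rintro g hg h ⟨h1, h2⟩
  have hg' := inv_mem hg
  refine ⟨fun X Y Z => h1 _ _ _, fun X Y hY Z hZ => ?_⟩
  simp only [act_apply]
  rw [h2 _ _ (map_mem_V hg' hY) _ (map_mem_V hg' hZ), hg'.1, hg'.1]

variable [FiniteDimensional ℝ T]

section Traces

variable {n : ℕ} (hS : IsAlmostContactMetric F ξ) (hT : Module.finrank ℝ T = 2 * n + 1)
include hS hT

/-- Acting on the tensor amounts to taking the trace in the frame moved by `g⁻¹`, which is again a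
unitary frame. -/
lemma beta_act {g : T ≃ₗᵢ[ℝ] T} (hg : g ∈ structureGroup F ξ) (h : Tensor3 T) (U : T) :
    beta ξ (act g h) U = beta ξ h (g⁻¹ U) := by
  obtain ⟨e, he⟩ := hS.exists_frame hT
  rw [he.beta_eq hS hT, (he.map (inv_mem hg)).beta_eq hS hT]
  simp only [act_apply, (inv_mem hg).1]

lemma betaBar_act {g : T ≃ₗᵢ[ℝ] T} (hg : g ∈ structureGroup F ξ) (h : Tensor3 T) (U : T) :
    betaBar F ξ (act g h) U = betaBar F ξ h (g⁻¹ U) := by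
  obtain ⟨e, he⟩ := hS.exists_frame hT
  rw [he.betaBar_eq hS hT, (he.map (inv_mem hg)).betaBar_eq hS hT]
  simp only [act_apply, (inv_mem hg).1]

lemma isInvariant_TbarSub (i : Fin 12) : IsInvariant F ξ (TbarSub n F ξ i) := by
  rintro g hg h ⟨h1, h2⟩
  refine ⟨isInvariant_Tbar g hg h h1, ?_⟩
  have hk : ∀ X ∈ V ξ, g⁻¹ X ∈ V ξ := fun X hX => map_mem_V (inv_mem hg) hX
  have hF : ∀ X, F (g⁻¹ X) = g⁻¹ (F X) := fun X => ((inv_mem hg).1 X).symm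
  have hξ : g⁻¹ ξ = ξ := (inv_mem hg).2
  have hi : ∀ X Y, inner ℝ (g⁻¹ X) (g⁻¹ Y) = (inner ℝ X Y : ℝ) := g⁻¹.inner_map_map
  have hVVV : ZeroVVV ξ h → ZeroVVV ξ (act g h) := fun H X hX Y hY Z hZ =>
    H _ (hk X hX) _ (hk Y hY) _ (hk Z hZ)
  have hVVxi : ZeroVVxi ξ h → ZeroVVxi ξ (act g h) := fun H X hX Y hY => by
    rw [act_apply, hξ, H _ (hk X hX) _ (hk Y hY)]
  have hXiVxi : ZeroXiVxi ξ h → ZeroXiVxi ξ (act g h) := fun H X hX => by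
    rw [act_apply, hξ, H _ (hk X hX)]
  have hXiVV : ZeroXiVV ξ h → ZeroXiVV ξ (act g h) := fun H X hX Y hY => by
    rw [act_apply, hξ, H _ (hk X hX) _ (hk Y hY)]
  match i, h2 with
  | 0, ⟨a, b, c, d⟩ =>
    exact ⟨fun X hX Y hY Z hZ => a _ (hk X hX) _ (hk Y hY) _ (hk Z hZ), hVVxi b, hXiVxi c, hXiVV d⟩
  | 1, ⟨a, b, c, d⟩ =>
    exact ⟨fun X hX Y hY Z hZ => a _ (hk X hX) _ (hk Y hY) _ (hk Z hZ), hVVxi b, hXiVxi c, hXiVV d⟩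
  | 2, ⟨a, a', b, c, d⟩ =>
    refine ⟨fun X hX Y hY Z hZ => ?_, fun Z hZ => ?_, hVVxi b, hXiVxi c, hXiVV d⟩
    · simpa only [act_apply, hF] using a _ (hk X hX) _ (hk Y hY) _ (hk Z hZ)
    · rw [beta_act hS hT hg, a' _ (hk Z hZ)]
  | 3, ⟨a, b, c, d⟩ =>
    refine ⟨fun X hX Y hY Z hZ => ?_, hVVxi b, hXiVxi c, hXiVV d⟩
    rw [act_apply, a _ (hk X hX) _ (hk Y hY) _ (hk Z hZ)]
    simp only [beta_act hS hT hg, hF, hi]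
  | 4, ⟨a, a', a'', b, c, d⟩ =>
    refine ⟨fun X hX Y hY => ?_, fun X hX Y hY => ?_, ?_, hVVV b, hXiVxi c, hXiVV d⟩
    · simpa only [act_apply, hF, hξ] using a _ (hk X hX) _ (hk Y hY)
    · simpa only [act_apply, hF, hξ] using a' _ (hk X hX) _ (hk Y hY)
    · rw [betaBar_act hS hT hg, hξ, a'']
  | 5, ⟨a, a', b, c, d⟩ =>
    refine ⟨fun X hX Y hY => ?_, fun X hX Y hY => ?_, hVVV b, hXiVxi c, hXiVV d⟩
    · simpa only [act_apply, hF, hξ] using a _ (hk X hX) _ (hk Y hY)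
    · simpa only [act_apply, hF, hξ] using a' _ (hk X hX) _ (hk Y hY)
  | 6, ⟨a, b, c, d⟩ =>
    refine ⟨fun X hX Y hY => ?_, hVVV b, hXiVxi c, hXiVV d⟩
    rw [act_apply, hξ, a _ (hk X hX) _ (hk Y hY)]
    simp only [betaBar_act hS hT hg, hF, hi, hξ]
  | 7, ⟨a, a', a'', b, c, d⟩ =>
    refine ⟨fun X hX Y hY => ?_, fun X hX Y hY => ?_, ?_, hVVV b, hXiVxi c, hXiVV d⟩
    · simpa only [act_apply, hF, hξ] using a _ (hk X hX) _ (hk Y hY)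
    · simpa only [act_apply, hF, hξ] using a' _ (hk X hX) _ (hk Y hY)
    · rw [beta_act hS hT hg, hξ, a'']
  | 8, ⟨a, a', b, c, d⟩ =>
    refine ⟨fun X hX Y hY => ?_, fun X hX Y hY => ?_, hVVV b, hXiVxi c, hXiVV d⟩
    · simpa only [act_apply, hF, hξ] using a _ (hk X hX) _ (hk Y hY)
    · simpa only [act_apply, hF, hξ] using a' _ (hk X hX) _ (hk Y hY)
  | 9, ⟨a, b, c, d⟩ =>
    refine ⟨fun X hX Y hY => ?_, hVVV b, hXiVxi c, hXiVV d⟩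
    rw [act_apply, hξ, a _ (hk X hX) _ (hk Y hY)]
    simp only [beta_act hS hT hg, hi, hξ]
  | 10, ⟨b, c, d⟩ => exact ⟨hVVV b, hVVxi c, hXiVV d⟩
  | 11, ⟨a, a', b, c, d⟩ =>
    refine ⟨fun X hX Y hY => ?_, fun X hX Y hY => ?_, hVVV b, hVVxi c, hXiVxi d⟩
    · simpa only [act_apply, hF, hξ] using a _ (hk X hX) _ (hk Y hY)
    · simpa only [act_apply, hF, hξ] using a' _ (hk X hX) _ (hk Y hY)

end Traces

/-- The inner product of tensors as a bilinear form. -/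
def tensorForm (T : Type*) [NormedAddCommGroup T] [InnerProductSpace ℝ T]
    [FiniteDimensional ℝ T] : LinearMap.BilinForm ℝ (Tensor3 T) :=
  LinearMap.mk₂ ℝ tensorInner
    (fun _ _ _ => by simp [tensorInner, add_mul, Finset.sum_add_distrib])
    (fun _ _ _ => by simp [tensorInner, Finset.mul_sum, mul_assoc])
    (fun _ _ _ => by simp [tensorInner, mul_add, Finset.sum_add_distrib])
    (fun _ _ _ => by simp [tensorInner, Finset.mul_sum, mul_left_comm])

@[simp] lemma tensorForm_apply (h k : Tensor3 T) : tensorForm T h k = tensorInner h k := rfl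

/-- The basis is changed in one slot at a time; with the other slots fixed, each change is an
instance of `sum_orthonormalBasis_eq`. -/
lemma tensorInner_eq {ι : Type*} [Fintype ι] (b : OrthonormalBasis ι ℝ T) (h k : Tensor3 T) :
    tensorInner h k = ∑ i, ∑ j, ∑ l, h (b i) (b j) (b l) * k (b i) (b j) (b l) := by
  set c := stdOrthonormalBasis ℝ T
  have h3 : ∀ X Y X' Y', ∑ l, h X Y (c l) * k X' Y' (c l) = ∑ l, h X Y (b l) * k X' Y' (b l) :=
    fun X Y X' Y' => sum_orthonormalBasis_eq c b
      ((LinearMap.mul ℝ ℝ).compl₁₂ (h X Y) (k X' Y'))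
  have h2 : ∀ X X', ∑ j, ∑ l, h X (c j) (b l) * k X' (c j) (b l) =
      ∑ j, ∑ l, h X (b j) (b l) * k X' (b j) (b l) := fun X X' => by
    have := sum_orthonormalBasis_eq c b (∑ l, (LinearMap.mul ℝ ℝ).compl₁₂
      ((h X).flip (b l)) ((k X').flip (b l)))
    simpa using this
  have h1 : ∑ i, ∑ j, ∑ l, h (c i) (b j) (b l) * k (c i) (b j) (b l) =
      ∑ i, ∑ j, ∑ l, h (b i) (b j) (b l) * k (b i) (b j) (b l) := by
    have := sum_orthonormalBasis_eq c b (∑ j, ∑ l, (LinearMap.mul ℝ ℝ).compl₁₂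
      (LinearMap.applyₗ (b l) ∘ₗ h.flip (b j)) (LinearMap.applyₗ (b l) ∘ₗ k.flip (b j)))
    simpa using this
  rw [← h1, tensorInner]
  simp only [c] at *
  simp_rw [h3, h2]

/-- Computed in a basis moved by `g`, the left side has literally the terms of the right side. -/
lemma tensorInner_act (g : T ≃ₗᵢ[ℝ] T) (h k : Tensor3 T) :
    tensorInner (act g h) (act g k) = tensorInner h k := by
  rw [tensorInner_eq ((stdOrthonormalBasis ℝ T).map g) (act g h),
    tensorInner_eq (stdOrthonormalBasis ℝ T) h]
  simp [act_apply]

lemma tensorInner_comm (h k : Tensor3 T) : tensorInner h k = tensorInner k h := by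
  simp [tensorInner, mul_comm]

lemma tensorInner_act_left (g : T ≃ₗᵢ[ℝ] T) (h k : Tensor3 T) :
    tensorInner (act g h) k = tensorInner h (act g⁻¹ k) := by
  rw [← tensorInner_act g⁻¹, act_inv_act]

lemma eq_zero_of_tensorInner_self {h : Tensor3 T} (hh : tensorInner h h = 0) : h = 0 := by
  set c := stdOrthonormalBasis ℝ T
  have h1 : ∀ i j l, h (c i) (c j) (c l) = 0 := by
    intro i j l
    have hp : ∀ i j l, 0 ≤ h (c i) (c j) (c l) * h (c i) (c j) (c l) := fun i j l =>
      mul_self_nonneg _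
    rw [tensorInner, Finset.sum_eq_zero_iff_of_nonneg fun i _ => Finset.sum_nonneg fun j _ =>
      Finset.sum_nonneg fun l _ => hp i j l] at hh
    have h2 := hh i (Finset.mem_univ _)
    rw [Finset.sum_eq_zero_iff_of_nonneg fun j _ => Finset.sum_nonneg fun l _ => hp i j l] at h2
    have h3 := h2 j (Finset.mem_univ _)
    rw [Finset.sum_eq_zero_iff_of_nonneg fun l _ => hp i j l] at h3
    simpa using h3 l (Finset.mem_univ _)
  refine c.toBasis.ext fun i => c.toBasis.ext fun j => c.toBasis.ext fun l => ?_
  simpa using h1 i j l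

end Action

/-! ### Pairwise orthogonality of the twelve subspaces -/

section Orthogonality

variable {T : Type*} [NormedAddCommGroup T] [InnerProductSpace ℝ T] {F : T →ₗ[ℝ] T} {ξ : T}

section Tbar

variable {h : Tensor3 T} (hh : h ∈ Tbar F ξ)
include hh

lemma Tbar_swap (X Y Z : T) : h X Y Z = -h X Z Y := hh.1 X Y Z

lemma Tbar_self (X Y : T) : h X Y Y = 0 := by
  have := hh.1 X Y Y; linarith

lemma Tbar_map_map (X : T) {Y Z : T} (hY : Y ∈ V ξ) (hZ : Z ∈ V ξ) :
    h X (F Y) (F Z) = -h X Y Z := by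
  have := hh.2 X Y hY Z hZ; linarith

lemma Tbar_map_left (hS : IsAlmostContactMetric F ξ) (X : T) {Y Z : T} (hY : Y ∈ V ξ)
    (hZ : Z ∈ V ξ) : h X (F Y) Z = h X Y (F Z) := by
  have := hh.2 X Y hY _ (hS.map_mem Z)
  rw [hS.sq_eq_neg _ hZ, map_neg] at this; linarith

end Tbar

variable [FiniteDimensional ℝ T] {n : ℕ}

section Conditions

variable {h : Tensor3 T} {i : Fin 12} (hh : h ∈ TbarSub n F ξ i)
include hh

lemma TbarSub_zeroVVV (hi : 4 ≤ i) : ZeroVVV ξ h := by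
  match i, hh.2 with
  | 4, ⟨_, _, _, a, _⟩ | 5, ⟨_, _, a, _⟩ | 6, ⟨_, a, _⟩ | 7, ⟨_, _, _, a, _⟩ | 8, ⟨_, _, a, _⟩
  | 9, ⟨_, a, _⟩ | 10, ⟨a, _⟩ | 11, ⟨_, _, a, _⟩ => exact a
  | 0, _ | 1, _ | 2, _ | 3, _ => exact absurd hi (by decide)

lemma TbarSub_zeroVVxi (hi : i < 4 ∨ 10 ≤ i) : ZeroVVxi ξ h := by
  match i, hh.2 with
  | 0, ⟨_, a, _⟩ | 1, ⟨_, a, _⟩ | 2, ⟨_, _, a, _⟩ | 3, ⟨_, a, _⟩ | 10, ⟨_, a, _⟩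
  | 11, ⟨_, _, _, a, _⟩ => exact a
  | 4, _ | 5, _ | 6, _ | 7, _ | 8, _ | 9, _ => exact absurd hi (by decide)

lemma TbarSub_zeroXiVxi (hi : i ≠ 10) : ZeroXiVxi ξ h := by
  match i, hh.2 with
  | 0, ⟨_, _, a, _⟩ | 1, ⟨_, _, a, _⟩ | 2, ⟨_, _, _, a, _⟩ | 3, ⟨_, _, a, _⟩
  | 4, ⟨_, _, _, _, a, _⟩ | 5, ⟨_, _, _, a, _⟩ | 6, ⟨_, _, a, _⟩ | 7, ⟨_, _, _, _, a, _⟩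
  | 8, ⟨_, _, _, a, _⟩ | 9, ⟨_, _, a, _⟩ | 11, ⟨_, _, _, _, a⟩ => exact a
  | 10, _ => exact absurd rfl hi

lemma TbarSub_zeroXiVV (hi : i ≠ 11) : ZeroXiVV ξ h := by
  match i, hh.2 with
  | 0, ⟨_, _, _, a⟩ | 1, ⟨_, _, _, a⟩ | 2, ⟨_, _, _, _, a⟩ | 3, ⟨_, _, _, a⟩
  | 4, ⟨_, _, _, _, _, a⟩ | 5, ⟨_, _, _, _, a⟩ | 6, ⟨_, _, _, a⟩ | 7, ⟨_, _, _, _, _, a⟩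
  | 8, ⟨_, _, _, _, a⟩ | 9, ⟨_, _, _, a⟩ | 10, ⟨_, _, a⟩ => exact a
  | 11, _ => exact absurd rfl hi

lemma TbarSub_skew (hS : IsAlmostContactMetric F ξ) (hi : i = 4 ∨ i = 5 ∨ i = 6) :
    ∀ X ∈ V ξ, ∀ Y ∈ V ξ, h Y X ξ = -h X Y ξ := by
  rcases hi with rfl | rfl | rfl
  · exact fun X hX Y hY => hh.2.1 Y hY X hX
  · exact fun X hX Y hY => hh.2.1 Y hY X hX
  · intro X hX Y hY
    rw [hh.2.1 X hX Y hY, hh.2.1 Y hY X hX, hS.inner_map_left, real_inner_comm Y (F X)]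
    ring

lemma TbarSub_symm (hi : i = 7 ∨ i = 8 ∨ i = 9) :
    ∀ X ∈ V ξ, ∀ Y ∈ V ξ, h Y X ξ = h X Y ξ := by
  rcases hi with rfl | rfl | rfl
  · exact fun X hX Y hY => hh.2.1 Y hY X hX
  · exact fun X hX Y hY => hh.2.1 Y hY X hX
  · intro X hX Y hY
    rw [hh.2.1 X hX Y hY, hh.2.1 Y hY X hX, real_inner_comm]

lemma TbarSub_map_eq (hS : IsAlmostContactMetric F ξ) (hi : i = 4 ∨ i = 6 ∨ i = 7 ∨ i = 9) :
    ∀ X ∈ V ξ, ∀ Y ∈ V ξ, h (F X) (F Y) ξ = h X Y ξ := by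
  rcases hi with rfl | rfl | rfl | rfl
  · exact hh.2.2.1
  · intro X hX Y hY
    rw [hh.2.1 X hX Y hY, hh.2.1 _ (hS.map_mem X) _ (hS.map_mem Y),
      hS.inner_map _ (hS.map_mem X) _ hY]
  · exact hh.2.2.1
  · intro X hX Y hY
    rw [hh.2.1 X hX Y hY, hh.2.1 _ (hS.map_mem X) _ (hS.map_mem Y), hS.inner_map _ hX _ hY]

lemma TbarSub_map_eq_neg (hi : i = 5 ∨ i = 8) :
    ∀ X ∈ V ξ, ∀ Y ∈ V ξ, h (F X) (F Y) ξ = -h X Y ξ := by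
  rcases hi with rfl | rfl <;> exact hh.2.2.1

end Conditions

/-- The tensors in `T̄_1` and `T̄_2` satisfy `h_{FX FY Z} = -h_{XYZ}`. -/
lemma TbarSub_map_VVV_neg (hS : IsAlmostContactMetric F ξ) {h : Tensor3 T} {i : Fin 12}
    (hh : h ∈ TbarSub n F ξ i) (hi : i = 0 ∨ i = 1) :
    ∀ X ∈ V ξ, ∀ Y ∈ V ξ, ∀ Z ∈ V ξ, h (F X) (F Y) Z = -h X Y Z := by
  intro X hX Y hY Z hZ
  have hFX := hS.map_mem X
  have hFY := hS.map_mem Y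
  have hFZ := hS.map_mem Z
  rcases hi with rfl | rfl
  · have a := hh.2.1
    -- Here `h` is totally skew, so the rule for `F` in the last two slots carries over to the first
    -- two.
    rw [Tbar_swap hh.1, a _ hFX _ hZ _ hFY, neg_neg, Tbar_map_map hh.1 _ hX hY, a _ hZ _ hX _ hY,
      Tbar_swap hh.1 X Z Y]
    ring
  · have a := hh.2.1
    have m := fun X {Y Z} hY hZ => Tbar_map_left hh.1 hS X (Y := Y) (Z := Z) hY hZ
    have m' := fun X {Y Z} hY hZ => Tbar_map_map hh.1 X (Y := Y) (Z := Z) hY hZ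
    -- With `A, B, C` for `h (F X) (F Y) Z` and its cyclic analogues, the three identities give `A +
    -- B`, `B + C` and `C + A` as values of `h` on `X, Y, Z`. Solving for `A` and using the cyclic
    -- identity once more gives `A = -h X Y Z`.
    have h1 := a _ hFX _ hFY _ hZ
    have h2 := a _ hFY _ hFZ _ hX
    have h3 := a _ hFZ _ hFX _ hY
    rw [← m _ hZ hX, m' _ hX hY] at h1
    rw [← m _ hX hY, m' _ hY hZ] at h2
    rw [← m _ hY hZ, m' _ hZ hX] at h3
    linarith [a _ hX _ hY _ hZ]

/-- `β` as a linear functional. -/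
def betaₗ (ξ : T) (h : Tensor3 T) : T →ₗ[ℝ] ℝ where
  toFun := beta ξ h
  map_add' X Y := by simp [beta, Finset.sum_add_distrib]
  map_smul' c X := by simp [beta, Finset.mul_sum]

lemma betaₗ_apply (ξ : T) (h : Tensor3 T) (U : T) : betaₗ ξ h U = beta ξ h U := rfl

lemma beta_neg_right (h : Tensor3 T) (U : T) : beta ξ h (-U) = -beta ξ h U :=
  map_neg (betaₗ ξ h) U

lemma TbarSub_map_VVV (hS : IsAlmostContactMetric F ξ) {h : Tensor3 T} {i : Fin 12}
    (hh : h ∈ TbarSub n F ξ i) (hi : i = 2 ∨ i = 3) :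
    ∀ X ∈ V ξ, ∀ Y ∈ V ξ, ∀ Z ∈ V ξ, h (F X) (F Y) Z = h X Y Z := by
  intro X hX Y hY Z hZ
  rcases hi with rfl | rfl
  · have := hh.2.1 X hX Y hY Z hZ; linarith
  · rw [hh.2.1 X hX Y hY Z hZ, hh.2.1 _ (hS.map_mem X) _ (hS.map_mem Y) Z hZ,
      hS.inner_map _ hX _ hY, hS.inner_map _ hX _ hZ, hS.sq_eq_neg _ hY, beta_neg_right,
      inner_neg_right, hS.inner_map_left X Z, hS.inner_map_left X Y]
    ring

section Sums

variable {m : ℕ} {e : Fin m → T}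

omit [FiniteDimensional ℝ T] in
-- `F` exchanges the two halves of the frame up to sign, which an even function does not see.
lemma IsUnitaryFrame.sum_frameV_map (he : IsUnitaryFrame F ξ e)
    (hS : IsAlmostContactMetric F ξ) {f : T → ℝ} (hf : ∀ X, f (-X) = f X) :
    ∑ i, f (F (frameV F e i)) = ∑ i, f (frameV F e i) := by
  simp [frameV, he.map_map hS, hf, add_comm]

end Sums

variable {e : Fin n → T} (he : IsUnitaryFrame F ξ e) (hS : IsAlmostContactMetric F ξ)
  (hT : Module.finrank ℝ T = 2 * n + 1)
include he hS hT

/-- The factors `2` come from skewness in the last two slots: a component with `ξ` in one of them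
occurs twice up to sign, and one with `ξ` in both vanishes. -/
lemma IsUnitaryFrame.tensorInner_Tbar {h k : Tensor3 T} (hh : h ∈ Tbar F ξ) (hk : k ∈ Tbar F ξ) :
    tensorInner h k =
      ∑ i, ∑ j, ∑ l, h (frameV F e i) (frameV F e j) (frameV F e l) *
        k (frameV F e i) (frameV F e j) (frameV F e l) +
      2 * ∑ i, ∑ j, h (frameV F e i) (frameV F e j) ξ * k (frameV F e i) (frameV F e j) ξ +
      ∑ i, ∑ j, h ξ (frameV F e i) (frameV F e j) * k ξ (frameV F e i) (frameV F e j) +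
      2 * ∑ i, h ξ (frameV F e i) ξ * k ξ (frameV F e i) ξ := by
  have sh : ∀ X i, h X ξ (frameV F e i) = -h X (frameV F e i) ξ := fun X Y => Tbar_swap hh _ _ _
  have sk : ∀ X i, k X ξ (frameV F e i) = -k X (frameV F e i) ξ := fun X Y => Tbar_swap hk _ _ _
  rw [tensorInner_eq (he.basisT hS hT)]
  simp only [he.basisT_apply hS hT, frameT]
  rw [Fintype.sum_sum_type]
  simp only [Fintype.sum_sum_type (α₁ := Fin n ⊕ Fin n), Sum.elim_inl, Sum.elim_inr,
    Finset.univ_unique, Finset.sum_singleton, sh, sk, neg_mul_neg, Finset.sum_add_distrib,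
    Tbar_self hh, zero_mul, add_zero]
  ring

lemma IsUnitaryFrame.sum_inner_smul (L : T →ₗ[ℝ] ℝ) {Y : T} (hY : Y ∈ V ξ) :
    ∑ i, L (frameV F e i) * inner ℝ (frameV F e i) Y = L Y := by
  have h1 := congrArg (Subtype.val) ((he.basisV hS hT).sum_repr' ⟨Y, hY⟩)
  simp only [Submodule.coe_sum, Submodule.coe_smul, he.basisV_apply, Submodule.coe_inner] at h1
  conv_rhs => rw [← h1]
  simp [mul_comm]

lemma IsUnitaryFrame.beta_eq_sum (h : Tensor3 T) (U : T) :
    beta ξ h U = ∑ i, h (frameV F e i) (frameV F e i) U := by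
  rw [he.beta_eq hS hT]; simp [frameV, Finset.sum_add_distrib]

lemma IsUnitaryFrame.betaBar_eq_sum (h : Tensor3 T) (U : T) :
    betaBar F ξ h U = ∑ i, h (frameV F e i) (F (frameV F e i)) U := by
  rw [he.betaBar_eq hS hT]; simp [frameV, Finset.sum_add_distrib, he.map_map hS, sub_eq_add_neg]

/-- Orthogonality among the first four subspaces. -/
lemma IsUnitaryFrame.sum_VVV_eq_zero {i j : Fin 12} (hij : i < j) (hj : j < 4) {h k : Tensor3 T}
    (hh : h ∈ TbarSub n F ξ i) (hk : k ∈ TbarSub n F ξ j) :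
    ∑ i, ∑ j, ∑ l, h (frameV F e i) (frameV F e j) (frameV F e l) *
        k (frameV F e i) (frameV F e j) (frameV F e l) = 0 := by
  have hv := he.frameV_mem hS
  have key : (i = 0 ∧ j = 1) ∨ (i = 2 ∧ j = 3) ∨ ((i = 0 ∨ i = 1) ∧ (j = 2 ∨ j = 3)) := by
    clear hh hk; revert i j; decide
  rcases key with ⟨rfl, rfl⟩ | ⟨rfl, rfl⟩ | ⟨h1, h2⟩
  · have a := hh.2.1
    have b := hk.2.1
    set S := ∑ i, ∑ j, ∑ l, h (frameV F e i) (frameV F e j) (frameV F e l) *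
        k (frameV F e i) (frameV F e j) (frameV F e l) with hSdef
    -- `h` is totally skew, hence cyclically invariant. So the sum is unchanged when the arguments
    -- of `k` are cycled, and three times the sum pairs `h` with the vanishing cyclic sum of `k`.
    have cyc : ∀ X ∈ V ξ, ∀ Y ∈ V ξ, ∀ Z ∈ V ξ, h X Y Z = h Y Z X := fun X hX Y hY Z hZ => by
      rw [a X hX Y hY Z hZ, Tbar_swap hh.1, neg_neg]
    have h1 : S = ∑ i, ∑ j, ∑ l, h (frameV F e i) (frameV F e j) (frameV F e l) *
        k (frameV F e j) (frameV F e l) (frameV F e i) := by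
      rw [hSdef, Finset.sum_comm_cycle]
      refine Finset.sum_congr rfl fun i _ => Finset.sum_congr rfl fun j _ =>
        Finset.sum_congr rfl fun l _ => ?_
      rw [cyc _ (hv i) _ (hv j) _ (hv l)]
    have h2 : S = ∑ i, ∑ j, ∑ l, h (frameV F e i) (frameV F e j) (frameV F e l) *
        k (frameV F e l) (frameV F e i) (frameV F e j) := by
      rw [h1, Finset.sum_comm_cycle]
      refine Finset.sum_congr rfl fun i _ => Finset.sum_congr rfl fun j _ =>
        Finset.sum_congr rfl fun l _ => ?_
      rw [cyc _ (hv i) _ (hv j) _ (hv l)]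
    have h3 : ∑ i, ∑ j, ∑ l, (h (frameV F e i) (frameV F e j) (frameV F e l) *
        k (frameV F e i) (frameV F e j) (frameV F e l) +
        h (frameV F e i) (frameV F e j) (frameV F e l) *
        k (frameV F e j) (frameV F e l) (frameV F e i) +
        h (frameV F e i) (frameV F e j) (frameV F e l) *
        k (frameV F e l) (frameV F e i) (frameV F e j)) = 0 := by
      refine Finset.sum_eq_zero fun i _ => Finset.sum_eq_zero fun j _ =>
        Finset.sum_eq_zero fun l _ => ?_
      rw [← mul_add, ← mul_add, b _ (hv _) _ (hv _) _ (hv _), mul_zero]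
    simp only [Finset.sum_add_distrib] at h3
    linarith
  · have a := TbarSub_map_VVV hS hh (Or.inl rfl)
    have a0 : ∀ i, beta ξ h (frameV F e i) = 0 := fun i => hh.2.2.1 _ (hv i)
    have b := hk.2.1
    have hY : ∀ i, beta ξ h (F (frameV F e i)) = 0 := fun i => hh.2.2.1 _ (hS.map_mem _)
    set c : ℝ := 1 / (2 * ((n : ℝ) - 1))
    set θ := beta ξ k
    -- `k` is built from the metric, `F` and its trace form. Contracting its first slot against `h`
    -- leaves terms in which `h` has two equal arguments; the remaining summation turns them into
    -- traces of `h`, which are zero.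
    have s1 : ∀ j l, ∑ i, h (frameV F e i) (frameV F e j) (frameV F e l) *
        k (frameV F e i) (frameV F e j) (frameV F e l) =
        c * (h (frameV F e j) (frameV F e j) (frameV F e l) * θ (frameV F e l) +
          h (frameV F e l) (frameV F e l) (frameV F e j) * θ (frameV F e j) +
          h (frameV F e j) (frameV F e j) (F (frameV F e l)) * θ (F (frameV F e l)) +
          h (frameV F e l) (frameV F e l) (F (frameV F e j)) * θ (F (frameV F e j))) := by
      intro j l
      have e1 : ∀ Y ∈ V ξ, ∑ i, h (frameV F e i) (frameV F e j) (frameV F e l) *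
          inner ℝ (frameV F e i) Y = h Y (frameV F e j) (frameV F e l) := fun Y hY =>
        he.sum_inner_smul hS hT ((LinearMap.applyₗ (frameV F e l)).comp (h.flip (frameV F e j))) hY
      have e2 : ∀ X ∈ V ξ, ∀ Z ∈ V ξ, h (F X) X Z = -h X X (F Z) := fun X hX Z hZ => by
        rw [← a _ (hS.map_mem X) _ hX _ hZ, hS.sq_eq_neg _ hX, map_neg, LinearMap.neg_apply,
          LinearMap.neg_apply, Tbar_map_left hh.1 hS _ hX hZ]
      have e3 : ∀ i, h (frameV F e i) (frameV F e j) (frameV F e l) *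
        k (frameV F e i) (frameV F e j) (frameV F e l) = c * (
          h (frameV F e i) (frameV F e j) (frameV F e l) * inner ℝ (frameV F e i) (frameV F e j)
            * θ (frameV F e l) -
          h (frameV F e i) (frameV F e j) (frameV F e l) * inner ℝ (frameV F e i) (frameV F e l)
            * θ (frameV F e j) -
          h (frameV F e i) (frameV F e j) (frameV F e l) *
            inner ℝ (frameV F e i) (F (frameV F e j)) * θ (F (frameV F e l)) +
          h (frameV F e i) (frameV F e j) (frameV F e l) *
            inner ℝ (frameV F e i) (F (frameV F e l)) * θ (F (frameV F e j))) := fun i => by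
        rw [b _ (hv _) _ (hv _) _ (hv _)]; ring
      simp_rw [e3, ← Finset.mul_sum, Finset.sum_add_distrib, Finset.sum_sub_distrib,
        ← Finset.sum_mul, e1 _ (hv _), e1 _ (hS.map_mem _)]
      rw [e2 _ (hv j) _ (hv l), Tbar_swap hh.1 (F (frameV F e l)) (frameV F e j),
        e2 _ (hv l) _ (hv j), Tbar_swap hh.1 (frameV F e l) (frameV F e j) (frameV F e l)]
      ring
    rw [Finset.sum_comm_cycle, Finset.sum_comm_cycle]
    simp_rw [s1, ← Finset.mul_sum, Finset.sum_add_distrib]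
    have t : ∀ U : Fin n ⊕ Fin n → T, (∀ i, beta ξ h (U i) = 0) →
        ∑ l, ∑ j, h (frameV F e j) (frameV F e j) (U l) * θ (U l) = 0 := fun U hU => by
      simp_rw [← Finset.sum_mul, ← he.beta_eq_sum hS hT, hU, zero_mul, Finset.sum_const_zero]
    have t1 := t (frameV F e) a0
    have t2 := t (fun i => F (frameV F e i)) hY
    have t3 := t1
    have t4 := t2
    rw [Finset.sum_comm] at t3 t4
    rw [t1, t2, t3, t4]; ring
  · have h1 := TbarSub_map_VVV_neg hS hh h1
    have h2 := TbarSub_map_VVV hS hk h2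
    -- The two tensors have opposite sign under `(X, Y) ↦ (FX, FY)`. The substitution permutes the
    -- frame up to sign, so the sum equals its negative.
    set f : T → T → T → ℝ := fun X Y Z => h X Y Z * k X Y Z
    have e1 : ∑ i, ∑ j, ∑ l, f (F (frameV F e i)) (F (frameV F e j)) (frameV F e l) =
        ∑ i, ∑ j, ∑ l, f (frameV F e i) (frameV F e j) (frameV F e l) := by
      rw [he.sum_frameV_map hS (f := fun X => ∑ j, ∑ l, f X (F (frameV F e j)) (frameV F e l))
        (by simp [f])]
      refine Finset.sum_congr rfl fun i _ => ?_
      rw [he.sum_frameV_map hS (f := fun Y => ∑ l, f (frameV F e i) Y (frameV F e l))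
        (by simp [f])]
    have e2 : ∑ i, ∑ j, ∑ l, f (F (frameV F e i)) (F (frameV F e j)) (frameV F e l) =
        -∑ i, ∑ j, ∑ l, f (frameV F e i) (frameV F e j) (frameV F e l) := by
      simp only [f, h1 _ (hv _) _ (hv _) _ (hv _), h2 _ (hv _) _ (hv _) _ (hv _), neg_mul,
        Finset.sum_neg_distrib]
    change ∑ i, ∑ j, ∑ l, f (frameV F e i) (frameV F e j) (frameV F e l) = 0
    linarith

/-- Three reasons cover all pairs: one form is skew and the other symmetric; they have opposite sign
under `F` in both slots; or one is a multiple of `⟨FX, Y⟩` or `⟨X, Y⟩` and the pairing is the trace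
that vanishes for the other. -/
lemma IsUnitaryFrame.sum_VVxi_eq_zero {i j : Fin 12} (hij : i < j) (hi : 4 ≤ i) (hj : j < 10)
    {h k : Tensor3 T} (hh : h ∈ TbarSub n F ξ i) (hk : k ∈ TbarSub n F ξ j) :
    ∑ i, ∑ j, h (frameV F e i) (frameV F e j) ξ * k (frameV F e i) (frameV F e j) ξ = 0 := by
  have hv := he.frameV_mem hS
  have swap : (∀ X ∈ V ξ, ∀ Y ∈ V ξ, h Y X ξ = -h X Y ξ) →
      (∀ X ∈ V ξ, ∀ Y ∈ V ξ, k Y X ξ = k X Y ξ) →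
      ∑ i, ∑ j, h (frameV F e i) (frameV F e j) ξ * k (frameV F e i) (frameV F e j) ξ = 0 := by
    intro a b
    have e1 : ∑ i, ∑ j, h (frameV F e i) (frameV F e j) ξ * k (frameV F e i) (frameV F e j) ξ =
        -∑ i, ∑ j, h (frameV F e i) (frameV F e j) ξ * k (frameV F e i) (frameV F e j) ξ := by
      conv_lhs => rw [Finset.sum_comm]
      simp only [← Finset.sum_neg_distrib]
      refine Finset.sum_congr rfl fun i _ => Finset.sum_congr rfl fun j _ => ?_
      rw [a _ (hv i) _ (hv j), b _ (hv i) _ (hv j), neg_mul]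
    linarith
  have rot : (∀ X ∈ V ξ, ∀ Y ∈ V ξ, h (F X) (F Y) ξ * k (F X) (F Y) ξ = -(h X Y ξ * k X Y ξ)) →
      ∑ i, ∑ j, h (frameV F e i) (frameV F e j) ξ * k (frameV F e i) (frameV F e j) ξ = 0 := by
    intro a
    set f : T → T → ℝ := fun X Y => h X Y ξ * k X Y ξ
    have e1 : ∑ i, ∑ j, f (F (frameV F e i)) (F (frameV F e j)) =
        ∑ i, ∑ j, f (frameV F e i) (frameV F e j) := by
      rw [he.sum_frameV_map hS (f := fun X => ∑ j, f X (F (frameV F e j))) (by simp [f])]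
      refine Finset.sum_congr rfl fun i _ => ?_
      rw [he.sum_frameV_map hS (f := fun Y => f (frameV F e i) Y) (by simp [f])]
    have e2 : ∑ i, ∑ j, f (F (frameV F e i)) (F (frameV F e j)) =
        -∑ i, ∑ j, f (frameV F e i) (frameV F e j) := by
      simp only [← Finset.sum_neg_distrib]
      exact Finset.sum_congr rfl fun i _ => Finset.sum_congr rfl fun j _ =>
        a _ (hv i) _ (hv j)
    change ∑ i, ∑ j, f (frameV F e i) (frameV F e j) = 0
    linarith
  have key : ((i = 4 ∨ i = 5 ∨ i = 6) ∧ (j = 7 ∨ j = 8 ∨ j = 9)) ∨ (i = 4 ∧ j = 6) ∨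
      (i = 7 ∧ j = 9) ∨ ((i = 4 ∨ i = 6 ∨ i = 7 ∨ i = 9) ∧ (j = 5 ∨ j = 8)) ∨
      ((i = 5 ∨ i = 8) ∧ (j = 4 ∨ j = 6 ∨ j = 7 ∨ j = 9)) := by
    clear hh hk; revert i j; decide
  rcases key with ⟨h1, h2⟩ | ⟨rfl, rfl⟩ | ⟨rfl, rfl⟩ | ⟨h1, h2⟩ | ⟨h1, h2⟩
  · exact swap (TbarSub_skew hh hS h1) (TbarSub_symm hk h2)
  · have h0 := hh.2.2.2.1
    rw [he.betaBar_eq_sum hS hT] at h0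
    have e1 : ∀ i, ∑ j, h (frameV F e i) (frameV F e j) ξ * k (frameV F e i) (frameV F e j) ξ =
        (1 / (2 * (n : ℝ)) * betaBar F ξ k ξ) * h (frameV F e i) (F (frameV F e i)) ξ := by
      intro i
      have e2 := he.sum_inner_smul hS hT ((LinearMap.applyₗ ξ).comp (h (frameV F e i)))
        (hS.map_mem (frameV F e i))
      simp only [LinearMap.comp_apply, LinearMap.applyₗ_apply_apply] at e2
      rw [← e2, Finset.mul_sum]
      refine Finset.sum_congr rfl fun j _ => ?_
      rw [hk.2.1 _ (hv i) _ (hv j), real_inner_comm]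
      ring
    simp_rw [e1, ← Finset.mul_sum, h0, mul_zero]
  · have h0 := hh.2.2.2.1
    rw [he.beta_eq_sum hS hT] at h0
    have e1 : ∀ i, ∑ j, h (frameV F e i) (frameV F e j) ξ * k (frameV F e i) (frameV F e j) ξ =
        (1 / (2 * (n : ℝ)) * beta ξ k ξ) * h (frameV F e i) (frameV F e i) ξ := by
      intro i
      have e2 := he.sum_inner_smul hS hT ((LinearMap.applyₗ ξ).comp (h (frameV F e i))) (hv i)
      simp only [LinearMap.comp_apply, LinearMap.applyₗ_apply_apply] at e2
      rw [← e2, Finset.mul_sum]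
      refine Finset.sum_congr rfl fun j _ => ?_
      rw [hk.2.1 _ (hv i) _ (hv j), real_inner_comm]
      ring
    simp_rw [e1, ← Finset.mul_sum, h0, mul_zero]
  · refine rot fun X hX Y hY => ?_
    rw [TbarSub_map_eq hh hS h1 X hX Y hY, TbarSub_map_eq_neg hk h2 X hX Y hY, mul_neg]
  · refine rot fun X hX Y hY => ?_
    rw [TbarSub_map_eq_neg hh h1 X hX Y hY, TbarSub_map_eq hk hS h2 X hX Y hY, neg_mul]

omit he in
lemma tensorInner_TbarSub_of_lt {i j : Fin 12} (hij : i < j) {h k : Tensor3 T}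
    (hh : h ∈ TbarSub n F ξ i) (hk : k ∈ TbarSub n F ξ j) : tensorInner h k = 0 := by
  obtain ⟨e, he⟩ := hS.exists_frame hT
  have hv := he.frameV_mem hS
  rw [he.tensorInner_Tbar hS hT hh.1 hk.1]
  have h1 : ∑ i, ∑ j, ∑ l, h (frameV F e i) (frameV F e j) (frameV F e l) *
        k (frameV F e i) (frameV F e j) (frameV F e l) = 0 := by
    by_cases hj : j < 4
    · exact he.sum_VVV_eq_zero hS hT hij hj hh hk
    · have := TbarSub_zeroVVV hk (not_lt.1 hj)
      simp [this _ (hv _) _ (hv _) _ (hv _)]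
  have h2 : ∑ i, ∑ j, h (frameV F e i) (frameV F e j) ξ * k (frameV F e i) (frameV F e j) ξ
      = 0 := by
    by_cases hj : j < 10
    · by_cases hi : 4 ≤ i
      · exact he.sum_VVxi_eq_zero hS hT hij hi hj hh hk
      · have := TbarSub_zeroVVxi hh (Or.inl (not_le.1 hi))
        simp [this _ (hv _) _ (hv _)]
    · have := TbarSub_zeroVVxi hk (Or.inr (not_lt.1 hj))
      simp [this _ (hv _) _ (hv _)]
  have h3 : ∑ i, ∑ j, h ξ (frameV F e i) (frameV F e j) * k ξ (frameV F e i) (frameV F e j)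
      = 0 := by
    have := TbarSub_zeroXiVV hh (ne_of_lt (lt_of_lt_of_le hij (Fin.le_last j)))
    simp [this _ (hv _) _ (hv _)]
  have h4 : ∑ i, h ξ (frameV F e i) ξ * k ξ (frameV F e i) ξ = 0 := by
    by_cases hj : j = 10
    · have := TbarSub_zeroXiVxi hh (ne_of_lt (hj ▸ hij))
      simp [this _ (hv _)]
    · have := TbarSub_zeroXiVxi hk hj
      simp [this _ (hv _)]
  rw [h1, h2, h3, h4]; ring

omit he in
lemma tensorInner_TbarSub {i j : Fin 12} (hij : i ≠ j) {h k : Tensor3 T}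
    (hh : h ∈ TbarSub n F ξ i) (hk : k ∈ TbarSub n F ξ j) : tensorInner h k = 0 := by
  rcases lt_or_gt_of_ne hij with h1 | h1
  · exact tensorInner_TbarSub_of_lt hS hT h1 hh hk
  · rw [tensorInner_comm, tensorInner_TbarSub_of_lt hS hT h1 hk hh]

omit he in
-- The sum of the other subspaces lies in the orthogonal complement of the given one, and the inner
-- product is definite.
lemma iSupIndep_TbarSub : iSupIndep (TbarSub n F ξ) := by
  intro i
  have h1 : (⨆ j, ⨆ (_ : j ≠ i), TbarSub n F ξ j) ≤
      (tensorForm T).orthogonal (TbarSub n F ξ i) := by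
    refine iSup₂_le fun j hj k hk => ?_
    rw [LinearMap.BilinForm.mem_orthogonal_iff]
    exact fun h hh => tensorInner_TbarSub hS hT hj.symm hh hk
  rw [Submodule.disjoint_def]
  intro h hh hk
  exact eq_zero_of_tensorInner_self (h1 hk h hh)

end Orthogonality

/-! ### Explicit projections: the twelve subspaces span -/

section Decomposition

set_option maxSynthPendingDepth 3

variable {T : Type*} [NormedAddCommGroup T] [InnerProductSpace ℝ T] {F : T →ₗ[ℝ] T} {ξ : T}

/-- The orthogonal projection along `ξ`. -/
def hor (ξ : T) : T →ₗ[ℝ] T := LinearMap.id - (innerₗ T ξ).smulRight ξ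

lemma hor_apply (X : T) : hor ξ X = X - (inner ℝ ξ X : ℝ) • ξ := rfl

lemma hor_of_mem {X : T} (hX : X ∈ V ξ) : hor ξ X = X := by
  rw [hor_apply, mem_V.1 hX, zero_smul, sub_zero]

lemma IsAlmostContactMetric.hor_mem (hS : IsAlmostContactMetric F ξ) (X : T) : hor ξ X ∈ V ξ :=
  hS.sub_mem_V X

lemma IsAlmostContactMetric.hor_xi (hS : IsAlmostContactMetric F ξ) : hor ξ ξ = 0 := by
  rw [hor_apply, hS.inner_xi_xi, one_smul, sub_self]

lemma hor_add_smul (X : T) : hor ξ X + (inner ℝ ξ X : ℝ) • ξ = X := by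
  rw [hor_apply]; abel

/-- The tensor `h_{AX BY CZ}`. -/
def pull (A B C : T →ₗ[ℝ] T) (h : Tensor3 T) : Tensor3 T :=
  LinearMap.mk₂ ℝ (fun X Y => (h (A X) (B Y)).comp C)
    (fun _ _ _ => by ext; simp) (fun _ _ _ => by ext; simp)
    (fun _ _ _ => by ext; simp) (fun _ _ _ => by ext; simp)

@[simp] lemma pull_apply (A B C : T →ₗ[ℝ] T) (h : Tensor3 T) (X Y Z : T) :
    pull A B C h X Y Z = h (A X) (B Y) (C Z) := rfl

/-- The tensor `h_{YZX}`. -/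
def cyc (h : Tensor3 T) : Tensor3 T :=
  LinearMap.mk₂ ℝ (fun X Y => (h Y).flip X)
    (fun _ _ _ => by ext; simp) (fun _ _ _ => by ext; simp)
    (fun _ _ _ => by ext; simp) (fun _ _ _ => by ext; simp)

@[simp] lemma cyc_apply (h : Tensor3 T) (X Y Z : T) : cyc h X Y Z = h Y Z X := rfl

/-- The part of `h` on `V × V × V`. -/
abbrev horT (h : Tensor3 T) (ξ : T) : Tensor3 T := pull (hor ξ) (hor ξ) (hor ξ) h

/-- The tensor with `h_{XYξ} = b(X, Y) = -h_{XξY}` on `V`, and no other components. -/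
def liftB (ξ : T) (b : T →ₗ[ℝ] T →ₗ[ℝ] ℝ) : Tensor3 T :=
  LinearMap.mk₂ ℝ (fun X Y => b (hor ξ X) (hor ξ Y) • innerₗ T ξ -
      (inner ℝ ξ Y : ℝ) • (b (hor ξ X)).comp (hor ξ))
    (fun _ _ _ => by ext; simp; ring) (fun _ _ _ => by ext; simp; ring)
    (fun _ _ _ => by ext; simp [inner_add_right]; ring)
    (fun _ _ _ => by ext; simp [inner_smul_right]; ring)

lemma liftB_apply (b : T →ₗ[ℝ] T →ₗ[ℝ] ℝ) (X Y Z : T) : liftB ξ b X Y Z =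
    b (hor ξ X) (hor ξ Y) * inner ℝ ξ Z - inner ℝ ξ Y * b (hor ξ X) (hor ξ Z) := rfl

/-- The tensor with `h_{ξYξ} = u(Y) = -h_{ξξY}` on `V`, and no other components. -/
def liftL (ξ : T) (u : T →ₗ[ℝ] ℝ) : Tensor3 T :=
  LinearMap.mk₂ ℝ (fun X Y => (inner ℝ ξ X : ℝ) • (u (hor ξ Y) • innerₗ T ξ -
      (inner ℝ ξ Y : ℝ) • u.comp (hor ξ)))
    (fun _ _ _ => by ext; simp [inner_add_right]; ring)
    (fun _ _ _ => by ext; simp [inner_smul_right]; ring)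
    (fun _ _ _ => by ext; simp [inner_add_right]; ring)
    (fun _ _ _ => by ext; simp [inner_smul_right]; ring)

lemma liftL_apply (u : T →ₗ[ℝ] ℝ) (X Y Z : T) : liftL ξ u X Y Z =
    inner ℝ ξ X * (u (hor ξ Y) * inner ℝ ξ Z - inner ℝ ξ Y * u (hor ξ Z)) := rfl

/-- The tensor with `h_{ξYZ} = b(Y, Z)` on `V`, and no other components. -/
def liftXi (ξ : T) (b : T →ₗ[ℝ] T →ₗ[ℝ] ℝ) : Tensor3 T :=
  LinearMap.mk₂ ℝ (fun X Y => (inner ℝ ξ X : ℝ) • (b (hor ξ Y)).comp (hor ξ))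
    (fun _ _ _ => by ext; simp [inner_add_right]; ring)
    (fun _ _ _ => by ext; simp [inner_smul_right]; ring)
    (fun _ _ _ => by ext; simp; ring) (fun _ _ _ => by ext; simp; ring)

lemma liftXi_apply (b : T →ₗ[ℝ] T →ₗ[ℝ] ℝ) (X Y Z : T) : liftXi ξ b X Y Z =
    inner ℝ ξ X * b (hor ξ Y) (hor ξ Z) := rfl

/-- The tensor `⟨X, Y⟩θ(Z) - ⟨X, Z⟩θ(Y) - ⟨X, FY⟩θ(FZ) + ⟨X, FZ⟩θ(FY)`. -/
def traceTensor (F : T →ₗ[ℝ] T) (θ : T →ₗ[ℝ] ℝ) : Tensor3 T :=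
  LinearMap.mk₂ ℝ (fun X Y => (inner ℝ X Y : ℝ) • θ - θ Y • innerₗ T X -
      (inner ℝ X (F Y) : ℝ) • θ.comp F + θ (F Y) • (innerₗ T X).comp F)
    (fun _ _ _ => by ext; simp [inner_add_left]; ring)
    (fun _ _ _ => by ext; simp [inner_smul_left]; ring)
    (fun _ _ _ => by ext; simp [inner_add_right]; ring)
    (fun _ _ _ => by ext; simp [inner_smul_right]; ring)

lemma traceTensor_apply (θ : T →ₗ[ℝ] ℝ) (X Y Z : T) : traceTensor F θ X Y Z =
    inner ℝ X Y * θ Z - inner ℝ X Z * θ Y - inner ℝ X (F Y) * θ (F Z) +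
      inner ℝ X (F Z) * θ (F Y) := by
  change inner ℝ X Y * θ Z - θ Y * inner ℝ X Z - inner ℝ X (F Y) * θ (F Z) +
      θ (F Y) * inner ℝ X (F Z) = _
  ring

section Membership

variable (hS : IsAlmostContactMetric F ξ)
include hS

lemma horT_mem_Tbar {t : Tensor3 T}
    (h1 : ∀ X ∈ V ξ, ∀ Y ∈ V ξ, ∀ Z ∈ V ξ, t X Y Z = -t X Z Y)
    (h2 : ∀ X ∈ V ξ, ∀ Y ∈ V ξ, ∀ Z ∈ V ξ, t X (F Y) (F Z) = -t X Y Z) :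
    horT t ξ ∈ Tbar F ξ := by
  refine ⟨fun X Y Z => h1 _ (hS.hor_mem X) _ (hS.hor_mem Y) _ (hS.hor_mem Z),
    fun X Y hY Z hZ => ?_⟩
  simp only [pull_apply, hor_of_mem hY, hor_of_mem hZ, hor_of_mem (hS.map_mem _)]
  rw [h2 _ (hS.hor_mem X) _ hY _ hZ, neg_neg]

lemma liftB_mem_Tbar (b : T →ₗ[ℝ] T →ₗ[ℝ] ℝ) : liftB ξ b ∈ Tbar F ξ := by
  refine ⟨fun X Y Z => ?_, fun X Y hY Z hZ => ?_⟩
  · simp only [liftB_apply]; ring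
  · simp [liftB_apply, mem_V.1 hY, mem_V.1 hZ, hS.inner_xi_map]

lemma liftL_mem_Tbar (u : T →ₗ[ℝ] ℝ) : liftL ξ u ∈ Tbar F ξ := by
  refine ⟨fun X Y Z => ?_, fun X Y hY Z hZ => ?_⟩
  · simp only [liftL_apply]; ring
  · simp [liftL_apply, mem_V.1 hY, mem_V.1 hZ, hS.inner_xi_map]

lemma horT_zeroVVxi (t : Tensor3 T) : ZeroVVxi ξ (horT t ξ) := fun X _ Y _ => by simp [hS.hor_xi]

lemma horT_zeroXiVxi (t : Tensor3 T) : ZeroXiVxi ξ (horT t ξ) := fun X _ => by simp [hS.hor_xi]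

lemma horT_zeroXiVV (t : Tensor3 T) : ZeroXiVV ξ (horT t ξ) := fun X _ Y _ => by simp [hS.hor_xi]

omit hS in
lemma liftB_zeroVVV (b : T →ₗ[ℝ] T →ₗ[ℝ] ℝ) : ZeroVVV ξ (liftB ξ b) := fun X _ Y hY Z hZ => by
  simp [liftB_apply, mem_V.1 hY, mem_V.1 hZ]

lemma liftB_zeroXiVxi (b : T →ₗ[ℝ] T →ₗ[ℝ] ℝ) : ZeroXiVxi ξ (liftB ξ b) := fun X _ => by
  simp [liftB_apply, hS.hor_xi]

lemma liftB_zeroXiVV (b : T →ₗ[ℝ] T →ₗ[ℝ] ℝ) : ZeroXiVV ξ (liftB ξ b) := fun X _ Y _ => by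
  simp [liftB_apply, hS.hor_xi]

lemma liftB_apply_xi (b : T →ₗ[ℝ] T →ₗ[ℝ] ℝ) {X Y : T} (hX : X ∈ V ξ) (hY : Y ∈ V ξ) :
    liftB ξ b X Y ξ = b X Y := by
  simp [liftB_apply, hS.hor_xi, hor_of_mem hX, hor_of_mem hY, hS.norm_xi]

variable [FiniteDimensional ℝ T] {n : ℕ}

omit hS in
lemma beta_sub (h k : Tensor3 T) (U : T) : beta ξ (h - k) U = beta ξ h U - beta ξ k U := by
  simp [beta]

omit hS in
lemma beta_horT (t : Tensor3 T) {Z : T} (hZ : Z ∈ V ξ) : beta ξ (horT t ξ) Z = beta ξ t Z := by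
  simp [beta, hor_of_mem hZ, hor_of_mem (Submodule.coe_mem _)]

lemma beta_liftB (b : T →ₗ[ℝ] T →ₗ[ℝ] ℝ) :
    beta ξ (liftB ξ b) ξ =
      ∑ i, b (stdOrthonormalBasis ℝ (V ξ) i) (stdOrthonormalBasis ℝ (V ξ) i) := by
  simp only [beta, liftB_apply_xi hS b (Submodule.coe_mem _) (Submodule.coe_mem _)]

lemma betaBar_liftB (b : T →ₗ[ℝ] T →ₗ[ℝ] ℝ) :
    betaBar F ξ (liftB ξ b) ξ =
      ∑ i, b (stdOrthonormalBasis ℝ (V ξ) i) (F (stdOrthonormalBasis ℝ (V ξ) i)) := by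
  simp only [betaBar, liftB_apply_xi hS b (Submodule.coe_mem _) (hS.map_mem _)]

variable (hT : Module.finrank ℝ T = 2 * n + 1)
include hT

/-- The four terms of `traceTensor` contribute `2n θ(U)`, `-θ(U)`, `0` and `θ(F(FU)) = -θ(U)`. This
is the origin of the constant `2(n - 1)`, and of the need for `n ≠ 1` when it is inverted. -/
lemma beta_traceTensor (θ : T →ₗ[ℝ] ℝ) {U : T} (hU : U ∈ V ξ) :
    beta ξ (traceTensor F θ) U = 2 * ((n : ℝ) - 1) * θ U := by
  obtain ⟨e, he⟩ := hS.exists_frame hT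
  have e1 := he.sum_inner_smul hS hT θ hU
  have e2 := he.sum_inner_smul hS hT (θ.comp F) (hS.map_mem U)
  simp only [LinearMap.comp_apply, hS.sq_eq_neg _ hU, map_neg] at e2
  have e3 : ∀ X, inner ℝ X (F X) = (0 : ℝ) := fun X => by
    have := hS.inner_map_left X X
    rw [real_inner_comm] at this; linarith
  have e4 : ∀ i, inner ℝ (frameV F e i) (frameV F e i) = (1 : ℝ) := fun i => by
    have := orthonormal_iff_ite.1 (he.orthonormal_frameV hS) i i
    simpa using this
  rw [he.beta_eq_sum hS hT]
  simp only [traceTensor_apply, Finset.sum_add_distrib, Finset.sum_sub_distrib, e3, e4, zero_mul,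
    mul_comm (inner ℝ _ _ : ℝ) (θ _), e1, e2]
  simp
  ring

lemma sum_inner_V : ∑ i, inner ℝ (stdOrthonormalBasis ℝ (V ξ) i : T)
    (stdOrthonormalBasis ℝ (V ξ) i : T) = (2 * n : ℝ) := by
  have : ∀ i, inner ℝ (stdOrthonormalBasis ℝ (V ξ) i : T)
    (stdOrthonormalBasis ℝ (V ξ) i : T) = (1 : ℝ) := fun i => by
    have := orthonormal_iff_ite.1 (stdOrthonormalBasis ℝ (V ξ)).orthonormal i i
    rwa [if_pos rfl] at this
  simp only [this, Finset.sum_const, Finset.card_univ, Fintype.card_fin, hS.finrank_V hT]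
  simp

variable (hn : 2 ≤ n)

omit hT [FiniteDimensional ℝ T] in
lemma traceTensor_map_map (θ : T →ₗ[ℝ] ℝ) : ∀ X ∈ V ξ, ∀ Y ∈ V ξ, ∀ Z ∈ V ξ,
    traceTensor F θ (F X) (F Y) Z = traceTensor F θ X Y Z := by
  intro X hX Y hY Z hZ
  simp only [traceTensor_apply, hS.inner_map _ hX _ hY, hS.inner_map _ hX _ hZ, hS.sq_eq_neg _ hY,
    map_neg, inner_neg_right, hS.inner_map_left X Z, hS.inner_map_left X Y]
  ring

omit hS hT [FiniteDimensional ℝ T] in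
lemma traceTensor_skew (θ : T →ₗ[ℝ] ℝ) (X Y Z : T) :
    traceTensor F θ X Y Z = -traceTensor F θ X Z Y := by
  simp only [traceTensor_apply]
  ring

omit hT [FiniteDimensional ℝ T] in
lemma traceTensor_map (θ : T →ₗ[ℝ] ℝ) : ∀ X ∈ V ξ, ∀ Y ∈ V ξ, ∀ Z ∈ V ξ,
    traceTensor F θ X (F Y) (F Z) = -traceTensor F θ X Y Z := by
  intro X hX Y hY Z hZ
  simp only [traceTensor_apply, hS.sq_eq_neg _ hY, hS.sq_eq_neg _ hZ, map_neg, inner_neg_right]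
  ring

include hn in
lemma horT_traceTensor_mem (θ : T →ₗ[ℝ] ℝ) :
    horT (traceTensor F θ) ξ ∈ TbarSub n F ξ 3 := by
  refine ⟨horT_mem_Tbar hS (fun X _ Y _ Z _ => traceTensor_skew θ X Y Z) (traceTensor_map hS θ), ?_,
    horT_zeroVVxi hS _, horT_zeroXiVxi hS _, horT_zeroXiVV hS _⟩
  intro X hX Y hY Z hZ
  have hb : ∀ U ∈ V ξ, beta ξ (horT (traceTensor F θ) ξ) U = 2 * ((n : ℝ) - 1) * θ U :=
    fun U hU => by rw [beta_horT _ hU, beta_traceTensor hS hT θ hU]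
  have hn1 : (n : ℝ) - 1 ≠ 0 := by
    have : (2 : ℝ) ≤ n := by exact_mod_cast hn
    linarith
  rw [hb Y hY, hb Z hZ, hb _ (hS.map_mem Y), hb _ (hS.map_mem Z)]
  simp only [pull_apply, hor_of_mem hX, hor_of_mem hY, hor_of_mem hZ, traceTensor_apply]
  field_simp

include hn in
-- The involution `X, Y ↦ FX, FY` on the first two slots splits `h` into an odd part `m` and an even
-- part `p`. The odd part splits further into its cyclic mean and a rest with vanishing cyclic sum,
-- the even part into a trace tensor and a trace-free rest.
lemma horT_mem_iSup {h : Tensor3 T} (hh : h ∈ Tbar F ξ) :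
    horT h ξ ∈ ⨆ i, TbarSub n F ξ i := by
  have s := Tbar_swap hh
  have f : ∀ X, ∀ Y ∈ V ξ, ∀ Z ∈ V ξ, h X (F Y) (F Z) = -h X Y Z :=
    fun X Y hY Z hZ => Tbar_map_map hh X hY hZ
  have f' : ∀ X, ∀ Y ∈ V ξ, ∀ Z ∈ V ξ, h X (F Y) Z = h X Y (F Z) :=
    fun X Y hY Z hZ => Tbar_map_left hh hS X hY hZ
  have F2 := hS.sq_eq_neg
  set q := pull F F LinearMap.id h with hq
  have hqa : ∀ X Y Z, q X Y Z = h (F X) (F Y) Z := fun X Y Z => rfl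
  have qs : ∀ X ∈ V ξ, ∀ Y ∈ V ξ, ∀ Z ∈ V ξ, q X Y Z = -q X Z Y := fun X hX Y hY Z hZ => by
    rw [hqa, hqa, s, f' _ _ hZ _ hY]
  have qf : ∀ X ∈ V ξ, ∀ Y ∈ V ξ, ∀ Z ∈ V ξ, q X (F Y) (F Z) = -q X Y Z :=
    fun X hX Y hY Z hZ => by rw [hqa, hqa, f _ _ (hS.map_mem _) _ hZ]
  have qF : ∀ X ∈ V ξ, ∀ Y ∈ V ξ, ∀ Z ∈ V ξ, q (F X) (F Y) Z = h X Y Z :=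
    fun X hX Y hY Z hZ => by rw [hqa, F2 _ hX, F2 _ hY]; simp
  set m := (1 / 2 : ℝ) • (h - q) with hm
  set p := (1 / 2 : ℝ) • (h + q) with hp
  have hma : ∀ X Y Z, m X Y Z = 1 / 2 * (h X Y Z - q X Y Z) := fun X Y Z => rfl
  have hpa : ∀ X Y Z, p X Y Z = 1 / 2 * (h X Y Z + q X Y Z) := fun X Y Z => rfl
  have ms : ∀ X ∈ V ξ, ∀ Y ∈ V ξ, ∀ Z ∈ V ξ, m X Y Z = -m X Z Y := fun X hX Y hY Z hZ => by
    rw [hma, hma, s, qs X hX Y hY Z hZ]; ring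
  have ps : ∀ X ∈ V ξ, ∀ Y ∈ V ξ, ∀ Z ∈ V ξ, p X Y Z = -p X Z Y := fun X hX Y hY Z hZ => by
    rw [hpa, hpa, s, qs X hX Y hY Z hZ]; ring
  have mf : ∀ X ∈ V ξ, ∀ Y ∈ V ξ, ∀ Z ∈ V ξ, m X (F Y) (F Z) = -m X Y Z :=
    fun X hX Y hY Z hZ => by rw [hma, hma, f _ _ hY _ hZ, qf _ hX _ hY _ hZ]; ring
  have pf : ∀ X ∈ V ξ, ∀ Y ∈ V ξ, ∀ Z ∈ V ξ, p X (F Y) (F Z) = -p X Y Z :=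
    fun X hX Y hY Z hZ => by rw [hpa, hpa, f _ _ hY _ hZ, qf _ hX _ hY _ hZ]; ring
  have mF : ∀ X ∈ V ξ, ∀ Y ∈ V ξ, ∀ Z ∈ V ξ, m (F X) (F Y) Z = -m X Y Z :=
    fun X hX Y hY Z hZ => by rw [hma, hma, ← hqa, qF _ hX _ hY _ hZ]; ring
  have pF : ∀ X ∈ V ξ, ∀ Y ∈ V ξ, ∀ Z ∈ V ξ, p (F X) (F Y) Z = p X Y Z :=
    fun X hX Y hY Z hZ => by rw [hpa, hpa, ← hqa, qF _ hX _ hY _ hZ]; ring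
  have mF' : ∀ X ∈ V ξ, ∀ Y ∈ V ξ, ∀ Z ∈ V ξ, m (F X) Y (F Z) = -m X Y Z :=
    fun X hX Y hY Z hZ => by
      rw [ms _ (hS.map_mem X) _ hY _ (hS.map_mem Z), mF _ hX _ hZ _ hY, ms _ hX _ hZ _ hY]; ring
  -- Since `m` is skew in the last two slots, its cyclic mean is totally skew. It stays in `Tbar`
  -- because `m` changes sign when `F` is applied in any two slots.
  set t0 := (1 / 3 : ℝ) • (m + cyc m + cyc (cyc m))
  have h0 : ∀ X Y Z, t0 X Y Z = 1 / 3 * (m X Y Z + m Y Z X + m Z X Y) := fun X Y Z => rfl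
  have c0s : ∀ X ∈ V ξ, ∀ Y ∈ V ξ, ∀ Z ∈ V ξ, t0 X Y Z = -t0 X Z Y := fun X hX Y hY Z hZ => by
    rw [h0, h0]
    linarith [ms X hX Y hY Z hZ, ms Y hY Z hZ X hX, ms Z hZ X hX Y hY]
  have c0f : ∀ X ∈ V ξ, ∀ Y ∈ V ξ, ∀ Z ∈ V ξ, t0 X (F Y) (F Z) = -t0 X Y Z :=
    fun X hX Y hY Z hZ => by
      rw [h0, h0, mf X hX Y hY Z hZ, mF Y hY Z hZ X hX, mF' Z hZ X hX Y hY]; ring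
  have m0 : horT t0 ξ ∈ TbarSub n F ξ 0 := by
    refine ⟨horT_mem_Tbar hS c0s c0f, fun X hX Y hY Z hZ => ?_,
      horT_zeroVVxi hS _, horT_zeroXiVxi hS _, horT_zeroXiVV hS _⟩
    simp only [pull_apply, hor_of_mem hX, hor_of_mem hY, hor_of_mem hZ, h0]
    linarith [ms X hX Y hY Z hZ, ms Y hY Z hZ X hX, ms Z hZ X hX Y hY]
  have m1 : horT (m - t0) ξ ∈ TbarSub n F ξ 1 := by
    refine ⟨horT_mem_Tbar hS (fun X hX Y hY Z hZ => ?_) (fun X hX Y hY Z hZ => ?_),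
      fun X hX Y hY Z hZ => ?_, horT_zeroVVxi hS _, horT_zeroXiVxi hS _, horT_zeroXiVV hS _⟩
    · simp only [LinearMap.sub_apply]
      linarith [ms X hX Y hY Z hZ, c0s X hX Y hY Z hZ]
    · simp only [LinearMap.sub_apply]
      linarith [mf X hX Y hY Z hZ, c0f X hX Y hY Z hZ]
    · simp only [pull_apply, hor_of_mem hX, hor_of_mem hY, hor_of_mem hZ, LinearMap.sub_apply, h0]
      ring
  have hn1 : (n : ℝ) - 1 ≠ 0 := by
    have : (2 : ℝ) ≤ n := by exact_mod_cast hn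
    linarith
  -- The factor is the inverse of that in `beta_traceTensor`, so `t3` has the same trace on `V` as
  -- `p`.
  set t3 := traceTensor F ((1 / (2 * ((n : ℝ) - 1))) • betaₗ ξ p)
  have m3 : horT t3 ξ ∈ TbarSub n F ξ 3 := horT_traceTensor_mem hS hT hn _
  have m2 : horT (p - t3) ξ ∈ TbarSub n F ξ 2 := by
    refine ⟨horT_mem_Tbar hS (fun X hX Y hY Z hZ => ?_) (fun X hX Y hY Z hZ => ?_),
      fun X hX Y hY Z hZ => ?_, fun Z hZ => ?_,
      horT_zeroVVxi hS _, horT_zeroXiVxi hS _, horT_zeroXiVV hS _⟩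
    · simp only [LinearMap.sub_apply]
      linarith [ps X hX Y hY Z hZ, traceTensor_skew (F := F)
        ((1 / (2 * ((n : ℝ) - 1))) • betaₗ ξ p) X Y Z]
    · simp only [LinearMap.sub_apply]
      linarith [pf X hX Y hY Z hZ, traceTensor_map hS
        ((1 / (2 * ((n : ℝ) - 1))) • betaₗ ξ p) X hX Y hY Z hZ]
    · simp only [pull_apply, hor_of_mem hX, hor_of_mem hY, hor_of_mem hZ,
        hor_of_mem (hS.map_mem _), LinearMap.sub_apply]
      linarith [pF X hX Y hY Z hZ, traceTensor_map_map hS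
        ((1 / (2 * ((n : ℝ) - 1))) • betaₗ ξ p) X hX Y hY Z hZ]
    · rw [beta_horT _ hZ, beta_sub,
        beta_traceTensor hS hT _ hZ, LinearMap.smul_apply, betaₗ_apply, smul_eq_mul]
      field_simp
      rw [sub_self, mul_zero]
  have hsum : horT h ξ = horT t0 ξ + horT (m - t0) ξ + horT (p - t3) ξ + horT t3 ξ := by
    ext X Y Z
    simp only [pull_apply, LinearMap.add_apply, LinearMap.sub_apply, hma, hpa]
    ring
  rw [hsum]
  exact add_mem (add_mem (add_mem (Submodule.mem_iSup_of_mem _ m0) (Submodule.mem_iSup_of_mem _ m1))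
    (Submodule.mem_iSup_of_mem _ m2)) (Submodule.mem_iSup_of_mem _ m3)

variable (hn0 : n ≠ 0)

include hn0 in
lemma liftB_omega_mem (c : ℝ) :
    liftB ξ (c • (innerₗ T).comp F) ∈ TbarSub n F ξ 6 := by
  refine ⟨liftB_mem_Tbar hS _, fun X hX Y hY => ?_, liftB_zeroVVV _, liftB_zeroXiVxi hS _,
    liftB_zeroXiVV hS _⟩
  rw [liftB_apply_xi hS _ hX hY, betaBar_liftB hS]
  have hn1 : (n : ℝ) ≠ 0 := by exact_mod_cast hn0
  simp only [LinearMap.smul_apply, LinearMap.comp_apply, innerₗ_apply_apply, smul_eq_mul,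
    hS.inner_map _ (Submodule.coe_mem _) _ (Submodule.coe_mem _), ← Finset.mul_sum,
    sum_inner_V hS hT]
  field_simp

include hn0 in
lemma liftB_inner_mem (c : ℝ) : liftB ξ (c • innerₗ T) ∈ TbarSub n F ξ 9 := by
  refine ⟨liftB_mem_Tbar hS _, fun X hX Y hY => ?_, liftB_zeroVVV _, liftB_zeroXiVxi hS _,
    liftB_zeroXiVV hS _⟩
  rw [liftB_apply_xi hS _ hX hY, beta_liftB hS]
  have hn1 : (n : ℝ) ≠ 0 := by exact_mod_cast hn0
  simp only [LinearMap.smul_apply, innerₗ_apply_apply, smul_eq_mul, ← Finset.mul_sum,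
    sum_inner_V hS hT]
  field_simp

include hn0 in
-- The form splits into four parts by symmetry and by the sign under `F` in both slots. The two
-- `F`-invariant parts still contain a multiple of `⟨FX, Y⟩` or of `⟨X, Y⟩`, which is split off.
lemma liftB_mem_iSup (b : T →ₗ[ℝ] T →ₗ[ℝ] ℝ) : liftB ξ b ∈ ⨆ i, TbarSub n F ξ i := by
  have hn1 : (n : ℝ) ≠ 0 := by exact_mod_cast hn0
  set r := b.compl₁₂ F F
  have hra : ∀ X Y, r X Y = b (F X) (F Y) := fun _ _ => rfl
  have hrF : ∀ X ∈ V ξ, ∀ Y ∈ V ξ, b (F (F X)) (F (F Y)) = b X Y := fun X hX Y hY => by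
    rw [hS.sq_eq_neg _ hX, hS.sq_eq_neg _ hY]; simp
  have b4 : ∀ k : T →ₗ[ℝ] T →ₗ[ℝ] ℝ, liftB ξ k ∈ Tbar F ξ := liftB_mem_Tbar hS
  set a4 := (1 / 4 : ℝ) • (b - b.flip + r - r.flip)
  set a5 := (1 / 4 : ℝ) • (b - b.flip - r + r.flip)
  set a7 := (1 / 4 : ℝ) • (b + b.flip + r + r.flip)
  set a8 := (1 / 4 : ℝ) • (b + b.flip - r - r.flip)
  have e4 : ∀ X Y, a4 X Y = 1 / 4 * (b X Y - b Y X + b (F X) (F Y) - b (F Y) (F X)) :=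
    fun _ _ => rfl
  have e5 : ∀ X Y, a5 X Y = 1 / 4 * (b X Y - b Y X - b (F X) (F Y) + b (F Y) (F X)) :=
    fun _ _ => rfl
  have e7 : ∀ X Y, a7 X Y = 1 / 4 * (b X Y + b Y X + b (F X) (F Y) + b (F Y) (F X)) :=
    fun _ _ => rfl
  have e8 : ∀ X Y, a8 X Y = 1 / 4 * (b X Y + b Y X - b (F X) (F Y) - b (F Y) (F X)) :=
    fun _ _ => rfl
  -- `⟨FX, Y⟩` has `betaBar`-trace `2n` and `⟨X, Y⟩` has `beta`-trace `2n`, so subtracting `c6` and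
  -- `c9` times them removes the traces.
  set c6 : ℝ := 1 / (2 * n) * ∑ i, a4 (stdOrthonormalBasis ℝ (V ξ) i)
    (F (stdOrthonormalBasis ℝ (V ξ) i)) with hc6
  set c9 : ℝ := 1 / (2 * n) * ∑ i, a7 (stdOrthonormalBasis ℝ (V ξ) i)
    (stdOrthonormalBasis ℝ (V ξ) i) with hc9
  have m6 := liftB_omega_mem (n := n) hS hT hn0 c6
  have m9 := liftB_inner_mem (n := n) hS hT hn0 c9
  have m5 : liftB ξ a5 ∈ TbarSub n F ξ 5 := by
    refine ⟨liftB_mem_Tbar hS _, fun X hX Y hY => ?_, fun X hX Y hY => ?_, liftB_zeroVVV _,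
      liftB_zeroXiVxi hS _, liftB_zeroXiVV hS _⟩
    · rw [liftB_apply_xi hS _ hX hY, liftB_apply_xi hS _ hY hX, e5, e5]; ring
    · rw [liftB_apply_xi hS _ hX hY, liftB_apply_xi hS _ (hS.map_mem X) (hS.map_mem Y), e5, e5,
        hrF _ hX _ hY, hrF _ hY _ hX]; ring
  have m8 : liftB ξ a8 ∈ TbarSub n F ξ 8 := by
    refine ⟨liftB_mem_Tbar hS _, fun X hX Y hY => ?_, fun X hX Y hY => ?_, liftB_zeroVVV _,
      liftB_zeroXiVxi hS _, liftB_zeroXiVV hS _⟩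
    · rw [liftB_apply_xi hS _ hX hY, liftB_apply_xi hS _ hY hX, e8, e8]; ring
    · rw [liftB_apply_xi hS _ hX hY, liftB_apply_xi hS _ (hS.map_mem X) (hS.map_mem Y), e8, e8,
        hrF _ hX _ hY, hrF _ hY _ hX]; ring
  have m4 : liftB ξ (a4 - c6 • (innerₗ T).comp F) ∈ TbarSub n F ξ 4 := by
    refine ⟨liftB_mem_Tbar hS _, fun X hX Y hY => ?_, fun X hX Y hY => ?_, ?_, liftB_zeroVVV _,
      liftB_zeroXiVxi hS _, liftB_zeroXiVV hS _⟩
    · rw [liftB_apply_xi hS _ hX hY, liftB_apply_xi hS _ hY hX]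
      simp only [LinearMap.sub_apply, LinearMap.smul_apply, LinearMap.comp_apply,
        innerₗ_apply_apply, smul_eq_mul, e4]
      rw [hS.inner_map_left X Y, real_inner_comm (F Y) X]; ring
    · rw [liftB_apply_xi hS _ hX hY, liftB_apply_xi hS _ (hS.map_mem X) (hS.map_mem Y)]
      simp only [LinearMap.sub_apply, LinearMap.smul_apply, LinearMap.comp_apply,
        innerₗ_apply_apply, smul_eq_mul, e4, hrF _ hX _ hY, hrF _ hY _ hX]
      rw [hS.inner_map _ (hS.map_mem X) _ hY]; ring
    · rw [betaBar_liftB hS]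
      simp only [LinearMap.sub_apply, LinearMap.smul_apply, LinearMap.comp_apply,
        innerₗ_apply_apply, smul_eq_mul, Finset.sum_sub_distrib,
        hS.inner_map _ (Submodule.coe_mem _) _ (Submodule.coe_mem _), ← Finset.mul_sum,
        sum_inner_V hS hT]
      rw [hc6]; field_simp; ring
  have m7 : liftB ξ (a7 - c9 • innerₗ T) ∈ TbarSub n F ξ 7 := by
    refine ⟨liftB_mem_Tbar hS _, fun X hX Y hY => ?_, fun X hX Y hY => ?_, ?_, liftB_zeroVVV _,
      liftB_zeroXiVxi hS _, liftB_zeroXiVV hS _⟩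
    · rw [liftB_apply_xi hS _ hX hY, liftB_apply_xi hS _ hY hX]
      simp only [LinearMap.sub_apply, LinearMap.smul_apply, innerₗ_apply_apply, smul_eq_mul, e7]
      rw [real_inner_comm]; ring
    · rw [liftB_apply_xi hS _ hX hY, liftB_apply_xi hS _ (hS.map_mem X) (hS.map_mem Y)]
      simp only [LinearMap.sub_apply, LinearMap.smul_apply,
        innerₗ_apply_apply, smul_eq_mul, e7, hrF _ hX _ hY, hrF _ hY _ hX]
      rw [hS.inner_map _ hX _ hY]; ring
    · rw [beta_liftB hS]
      simp only [LinearMap.sub_apply, LinearMap.smul_apply,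
        innerₗ_apply_apply, smul_eq_mul, Finset.sum_sub_distrib, ← Finset.mul_sum,
        sum_inner_V hS hT]
      rw [hc9]; field_simp; ring
  have hsum : liftB ξ b = liftB ξ (a4 - c6 • (innerₗ T).comp F) + liftB ξ a5 +
      liftB ξ (c6 • (innerₗ T).comp F) + liftB ξ (a7 - c9 • innerₗ T) + liftB ξ a8 +
      liftB ξ (c9 • innerₗ T) := by
    ext X Y Z
    simp only [liftB_apply, LinearMap.add_apply, LinearMap.sub_apply, e4, e5, e7, e8]
    ring
  rw [hsum]
  exact add_mem (add_mem (add_mem (add_mem (add_mem (Submodule.mem_iSup_of_mem _ m4)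
    (Submodule.mem_iSup_of_mem _ m5)) (Submodule.mem_iSup_of_mem _ m6))
    (Submodule.mem_iSup_of_mem _ m7)) (Submodule.mem_iSup_of_mem _ m8))
    (Submodule.mem_iSup_of_mem _ m9)

omit hT in
lemma liftL_mem (u : T →ₗ[ℝ] ℝ) : liftL ξ u ∈ TbarSub n F ξ 10 := by
  refine ⟨liftL_mem_Tbar hS u, fun X hX Y hY Z hZ => ?_, fun X hX Y hY => ?_, fun X hX Y hY => ?_⟩
  · simp [liftL_apply, mem_V.1 hX]
  · simp [liftL_apply, mem_V.1 hX]
  · simp [liftL_apply, mem_V.1 hX, mem_V.1 hY]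

omit hT in
lemma liftXi_mem {h : Tensor3 T} (hh : h ∈ Tbar F ξ) : liftXi ξ (h ξ) ∈ TbarSub n F ξ 11 := by
  have h1 : ∀ X ∈ V ξ, ∀ Y ∈ V ξ, liftXi ξ (h ξ) ξ X Y = h ξ X Y := fun X hX Y hY => by
    simp [liftXi_apply, hS.norm_xi, hor_of_mem hX, hor_of_mem hY]
  refine ⟨⟨fun X Y Z => ?_, fun X Y hY Z hZ => ?_⟩, fun X hX Y hY => ?_, fun X hX Y hY => ?_,
    fun X hX Y hY Z hZ => ?_, fun X hX Y hY => ?_, fun X hX => ?_⟩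
  · rw [liftXi_apply, liftXi_apply, Tbar_swap hh]; ring
  · rw [liftXi_apply, liftXi_apply, hor_of_mem hY, hor_of_mem hZ, hor_of_mem (hS.map_mem _),
      hor_of_mem (hS.map_mem _), Tbar_map_map hh _ hY hZ]; ring
  · rw [h1 _ hX _ hY, h1 _ hY _ hX, Tbar_swap hh]
  · rw [h1 _ hX _ hY, h1 _ (hS.map_mem X) _ (hS.map_mem Y), Tbar_map_map hh _ hX hY, neg_neg]
  · simp [liftXi_apply, mem_V.1 hX]
  · simp [liftXi_apply, mem_V.1 hX]
  · simp [liftXi_apply, hS.hor_xi]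

include hn in
/-- The twelve subspaces span `T̄(T)`. -/
lemma iSup_TbarSub : (⨆ i, TbarSub n F ξ i) = Tbar F ξ := by
  refine le_antisymm (iSup_le fun i h hh => hh.1) fun h hh => ?_
  -- Each argument is split into its part in `V` and its part along `ξ`. Skewness kills the terms
  -- with `ξ` in both last slots and matches those with `ξ` in the middle.
  have hsum : h = horT h ξ + liftB ξ (h.compr₂ (LinearMap.applyₗ ξ)) +
      liftL ξ ((LinearMap.applyₗ ξ).comp (h ξ)) + liftXi ξ (h ξ) := by
    ext X Y Z
    simp only [LinearMap.add_apply, pull_apply, liftB_apply, liftL_apply, liftXi_apply,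
      LinearMap.compr₂_apply, LinearMap.comp_apply, LinearMap.applyₗ_apply_apply]
    conv_lhs => rw [← hor_add_smul (ξ := ξ) X, ← hor_add_smul (ξ := ξ) Y, ← hor_add_smul (ξ := ξ) Z]
    simp only [map_add, map_smul, LinearMap.add_apply, LinearMap.smul_apply, smul_eq_mul,
      Tbar_self hh, Tbar_swap hh _ ξ (hor ξ Z)]
    ring
  rw [hsum]
  exact add_mem (add_mem (add_mem (horT_mem_iSup hS hT hn hh) (liftB_mem_iSup hS hT (by omega) _))
    (Submodule.mem_iSup_of_mem _ (liftL_mem hS _))) (Submodule.mem_iSup_of_mem _ (liftXi_mem hS hh))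

end Membership

end Decomposition

/-! ### Counting components: index sets and vanishing criteria -/

section Dimension

set_option maxSynthPendingDepth 3

section General

variable {E : Type*} [AddCommGroup E] [Module ℝ E]

/-- The source of nearly all upper bounds: functionals that separate the elements of `W` embed it in
a coordinate space. -/
lemma finrank_le_of_coords {W : Submodule ℝ E} {ι : Type*} [Fintype ι] (φ : ι → E →ₗ[ℝ] ℝ)
    (h : ∀ x ∈ W, (∀ i, φ i x = 0) → x = 0) : Module.finrank ℝ W ≤ Fintype.card ι := by
  have := LinearMap.finrank_le_finrank_of_injective (f := (LinearMap.pi φ).comp W.subtype) (by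
    rw [← LinearMap.ker_eq_bot, LinearMap.ker_eq_bot']
    rintro ⟨x, hx⟩ hx0
    have : x = 0 := h x hx fun i => congrFun hx0 i
    simpa using this)
  simpa using this

lemma finrank_iSup_le [FiniteDimensional ℝ E] {ι : Type*} [Fintype ι] (W : ι → Submodule ℝ E) :
    Module.finrank ℝ ↥(⨆ i, W i) ≤ ∑ i, Module.finrank ℝ (W i) := by
  classical
  rw [← Finset.sup_univ_eq_iSup]
  refine Finset.induction_on Finset.univ ?_ ?_
  · rw [Finset.sup_empty, finrank_bot]; exact Nat.zero_le _
  · intro a s ha ih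
    rw [Finset.sup_insert, Finset.sum_insert ha]
    exact (Submodule.finrank_add_le_finrank_add_finrank _ _).trans (by omega)

lemma finrank_add_of_disjoint [FiniteDimensional ℝ E] {A B : Submodule ℝ E} (h : Disjoint A B) :
    Module.finrank ℝ ↥(A ⊔ B) = Module.finrank ℝ A + Module.finrank ℝ B := by
  have := Submodule.finrank_sup_add_finrank_inf_eq A B
  rwa [h.eq_bot, finrank_bot, add_zero] at this

/-- Ordered pairs `a < b`. -/
abbrev LtPair (n : ℕ) := Σ b : Fin n, Fin b

/-- Ordered pairs `a ≤ b`. -/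
abbrev LePair (n : ℕ) := Σ b : Fin n, Fin (b + 1)

/-- Ordered triples `a < b < c`. -/
abbrev LtTriple (n : ℕ) := Σ c : Fin n, LtPair c

/-- Triples with `b < c` and `a ≤ c`. -/
abbrev LeTriple (n : ℕ) := Σ c : Fin n, Fin c × Fin (c + 1)

lemma card_LtPair (n : ℕ) : (Fintype.card (LtPair n) : ℚ) = n * (n - 1) / 2 := by
  simp only [Fintype.card_sigma, Fintype.card_fin, Fin.sum_univ_eq_sum_range fun i => i]
  induction n with
  | zero => simp
  | succ k ih => rw [Finset.sum_range_succ]; push_cast at ih ⊢; rw [ih]; ring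

lemma card_LePair (n : ℕ) : (Fintype.card (LePair n) : ℚ) = n * (n + 1) / 2 := by
  simp only [Fintype.card_sigma, Fintype.card_fin, Fin.sum_univ_eq_sum_range fun i => i + 1]
  induction n with
  | zero => simp
  | succ k ih => rw [Finset.sum_range_succ]; push_cast at ih ⊢; rw [ih]; ring

lemma card_LtTriple (n : ℕ) : (Fintype.card (LtTriple n) : ℚ) = n * (n - 1) * (n - 2) / 6 := by
  rw [Fintype.card_sigma, Fin.sum_univ_eq_sum_range fun i => Fintype.card (LtPair i)]
  induction n with
  | zero => simp
  | succ k ih =>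
    rw [Finset.sum_range_succ, Nat.cast_add, ih, card_LtPair]; push_cast; ring

lemma card_LeTriple (n : ℕ) : (Fintype.card (LeTriple n) : ℚ) = n * (n - 1) * (n + 1) / 3 := by
  simp only [Fintype.card_sigma, Fintype.card_prod, Fintype.card_fin,
    Fin.sum_univ_eq_sum_range fun i => i * (i + 1)]
  induction n with
  | zero => simp
  | succ k ih => rw [Finset.sum_range_succ]; push_cast at ih ⊢; rw [ih]; ring

end General

variable {T : Type*} [NormedAddCommGroup T] [InnerProductSpace ℝ T] {F : T →ₗ[ℝ] T} {ξ : T}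

/-- Evaluation of tensors. -/
def evalT (X Y Z : T) : Tensor3 T →ₗ[ℝ] ℝ where
  toFun h := h X Y Z
  map_add' _ _ := rfl
  map_smul' _ _ := rfl

@[simp] lemma evalT_apply (X Y Z : T) (h : Tensor3 T) : evalT X Y Z h = h X Y Z := rfl

variable [FiniteDimensional ℝ T] {n : ℕ} {e : Fin n → T} (he : IsUnitaryFrame F ξ e)
  (hS : IsAlmostContactMetric F ξ) (hT : Module.finrank ℝ T = 2 * n + 1)

section Vanishing

omit [FiniteDimensional ℝ T] in
include hS in
/-- A tensor of `T̄(T)` all of whose components vanish is zero. -/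
lemma Tbar_eq_zero {h : Tensor3 T} (hh : h ∈ Tbar F ξ) (h1 : ZeroVVV ξ h) (h2 : ZeroVVxi ξ h)
    (h3 : ZeroXiVxi ξ h) (h4 : ZeroXiVV ξ h) : h = 0 := by
  have hm := hS.hor_mem
  ext X Y Z
  rw [← hor_add_smul (ξ := ξ) X, ← hor_add_smul (ξ := ξ) Y, ← hor_add_smul (ξ := ξ) Z]
  simp only [map_add, map_smul, LinearMap.add_apply, LinearMap.smul_apply, smul_eq_mul,
      Tbar_self hh, Tbar_swap hh _ ξ (hor ξ Z), h1 _ (hm X) _ (hm Y) _ (hm Z),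
      h2 _ (hm X) _ (hm Y), h2 _ (hm X) _ (hm Z), h3 _ (hm Y), h3 _ (hm Z),
      h4 _ (hm Y) _ (hm Z), LinearMap.zero_apply]
  ring

include he hS hT

/-- A bilinear form on `V` with `b(Y, X) = σ b(X, Y)` and `b(FX, FY) = τ b(X, Y)` vanishes if its
entries `b(e_a, e_b)` and `b(Fe_a, e_b)` do. -/
lemma IsUnitaryFrame.bilin_eq_zero {b : T →ₗ[ℝ] T →ₗ[ℝ] ℝ} {τ : ℝ}
    (hF : ∀ X ∈ V ξ, ∀ Y ∈ V ξ, b (F X) (F Y) = τ * b X Y)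
    (h1 : ∀ i j, b (e i) (e j) = 0) (h2 : ∀ i j, b (F (e i)) (e j) = 0) :
    ∀ X ∈ V ξ, ∀ Y ∈ V ξ, b X Y = 0 := by
  have h3 : ∀ i j, b (F (e i)) (F (e j)) = 0 := fun i j => by
    rw [hF _ (he.mem i) _ (he.mem j), h1, mul_zero]
  have h4 : ∀ i j, b (e i) (F (e j)) = 0 := fun i j => by
    have := hF _ (hS.map_mem (e i)) _ (he.mem j)
    rw [h2, mul_zero, he.map_map hS, map_neg, LinearMap.neg_apply] at this
    linarith
  intro X hX Y hY
  have h5 : ∀ i, ∀ Y ∈ V ξ, b (e i) Y = 0 := fun i =>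
    he.linearMap_eq_zero hS hT (b (e i)) (h1 i) (h4 i)
  have h6 : ∀ i, ∀ Y ∈ V ξ, b (F (e i)) Y = 0 := fun i =>
    he.linearMap_eq_zero hS hT (b (F (e i))) (h2 i) (h3 i)
  exact he.linearMap_eq_zero hS hT (b.flip Y) (fun i => h5 i Y hY) (fun i => h6 i Y hY) X hX

/-- A tensor on `V` that is complex bilinear in the last two arguments, and complex linear or
antilinear in the first, vanishes if its entries `h(e_a, e_b, e_c)` and `h(Fe_a, e_b, e_c)` do. -/
lemma IsUnitaryFrame.zeroVVV {h : Tensor3 T} {τ : ℝ} (hh : h ∈ Tbar F ξ)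
    (hF : ∀ X ∈ V ξ, ∀ Y ∈ V ξ, ∀ Z ∈ V ξ, h (F X) (F Y) Z = τ * h X Y Z)
    (h1 : ∀ i j k, h (e i) (e j) (e k) = 0) (h2 : ∀ i j k, h (F (e i)) (e j) (e k) = 0) :
    ZeroVVV ξ h := by
  have h3 : ∀ X ∈ V ξ, ∀ Y ∈ V ξ, ∀ k, h X Y (e k) = 0 := fun X hX Y hY k =>
    he.bilin_eq_zero hS hT (b := h.compr₂ (LinearMap.applyₗ (e k)))
      (fun X hX Y hY => hF X hX Y hY _ (he.mem k)) (fun i j => h1 i j k) (fun i j => h2 i j k)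
      X hX Y hY
  intro X hX Y hY Z hZ
  refine he.linearMap_eq_zero hS hT (h X Y) (h3 X hX Y hY) (fun k => ?_) Z hZ
  rw [← Tbar_map_left hh hS X hY (he.mem k)]
  exact h3 X hX _ (hS.map_mem Y) k

end Vanishing

include he hS hT

/-- A skew or symmetric form on `V` vanishes if its entries above the diagonal, and those on the
diagonal that are not zero by symmetry, do. -/
lemma IsUnitaryFrame.bilin_vanish {b : T →ₗ[ℝ] T →ₗ[ℝ] ℝ} {σ τ : ℝ}
    (hs : ∀ X ∈ V ξ, ∀ Y ∈ V ξ, b Y X = σ * b X Y)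
    (hF : ∀ X ∈ V ξ, ∀ Y ∈ V ξ, b (F X) (F Y) = τ * b X Y)
    (h1 : ∀ i j, i < j → b (e i) (e j) = 0) (h2 : ∀ i j, i < j → b (F (e i)) (e j) = 0)
    (h3 : σ ≠ -1 → ∀ i, b (e i) (e i) = 0) (h4 : σ * τ ≠ 1 → ∀ i, b (F (e i)) (e i) = 0) :
    ∀ X ∈ V ξ, ∀ Y ∈ V ξ, b X Y = 0 := by
  -- The matrix `b (F e_i) e_j` has symmetry sign `-στ`. Its diagonal is therefore automatically
  -- zero exactly in the case `στ = 1` that `h4` leaves out.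
  have h5 : ∀ i j, b (F (e j)) (e i) = -(σ * τ) * b (F (e i)) (e j) := fun i j => by
    have e1 := hF _ (hS.map_mem (e i)) _ (he.mem j)
    rw [he.map_map hS, map_neg, LinearMap.neg_apply] at e1
    rw [hs _ (he.mem i) _ (hS.map_mem (e j))]
    linear_combination -σ * e1
  refine he.bilin_eq_zero hS hT hF (fun i j => ?_) (fun i j => ?_)
  · rcases lt_trichotomy i j with hij | rfl | hij
    · exact h1 i j hij
    · by_cases h : σ = -1
      · have := hs _ (he.mem i) _ (he.mem i)
        rw [h] at this; linarith
      · exact h3 h i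
    · rw [hs _ (he.mem j) _ (he.mem i), h1 j i hij, mul_zero]
  · rcases lt_trichotomy i j with hij | rfl | hij
    · exact h2 i j hij
    · by_cases h : σ * τ = 1
      · have := h5 i i
        rw [h] at this; linarith
      · exact h4 h i
    · rw [h5 j i, h2 j i hij, mul_zero]

end Dimension

/-! ### Upper bounds for the dimensions of the summands -/

section DimensionBounds

set_option maxSynthPendingDepth 3

section Indices

variable {n : ℕ} {f : Fin n → Fin n → Fin n → ℝ}

lemma eq_zero_of_alternating (h1 : ∀ a b c, f a b c = -f a c b) (h2 : ∀ a b c, f a b c = -f b a c)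
    (h0 : ∀ a b c, a < b → b < c → f a b c = 0) (a b c : Fin n) : f a b c = 0 := by
  have h3 : ∀ a b, f a a b = 0 := fun a b => by linarith [h2 a a b]
  have h4 : ∀ a b, f a b b = 0 := fun a b => by linarith [h1 a b b]
  have h5 : ∀ a b, f a b a = 0 := fun a b => by linarith [h1 a b a, h3 a b]
  rcases lt_trichotomy a b with hab | hab | hab <;> rcases lt_trichotomy b c with hbc | hbc | hbc
    <;> rcases lt_trichotomy a c with hac | hac | hac <;> grind

/-- A component whose first index is the largest is expressed, by the cyclic identity and skewness,
through two components with the largest index last. So the components with `b < c` and `a ≤ c`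
determine the rest. -/
lemma eq_zero_of_cyclic (h1 : ∀ a b c, f a b c = -f a c b)
    (h2 : ∀ a b c, f a b c + f b c a + f c a b = 0)
    (h0 : ∀ a b c, b < c → a ≤ c → f a b c = 0) (a b c : Fin n) : f a b c = 0 := by
  have h3 : ∀ a b c, b < c → f a b c = 0 := fun a b c hbc => by
    rcases le_or_gt a c with h | h
    · exact h0 a b c hbc h
    · linarith [h2 a b c, h0 b c a h (hbc.trans h).le, h1 c a b, h0 c b a (hbc.trans h) h.le]
  rcases lt_trichotomy b c with hbc | rfl | hbc
  · exact h3 a b c hbc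
  · linarith [h1 a b b]
  · rw [h1, h3 a c b hbc, neg_zero]

lemma eq_zero_of_skew (h1 : ∀ a b c, f a b c = -f a c b)
    (h0 : ∀ a b c, b < c → f a b c = 0) (a b c : Fin n) : f a b c = 0 := by
  rcases lt_trichotomy b c with hbc | rfl | hbc
  · exact h0 a b c hbc
  · linarith [h1 a b b]
  · rw [h1, h0 a c b hbc, neg_zero]

end Indices

/-- The inclusion of `{0, …, a - 1}` into `{0, …, n - 1}` for `a < n`. -/
abbrev up {n : ℕ} {a : Fin n} (b : Fin a) : Fin n := b.castLE a.is_lt.le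

/-- The inclusion of `{0, …, a}` into `{0, …, n - 1}` for `a < n`. -/
abbrev up' {n : ℕ} {a : Fin n} (b : Fin (a + 1)) : Fin n := b.castLE a.is_lt

variable {T : Type*} [NormedAddCommGroup T] [InnerProductSpace ℝ T] {F : T →ₗ[ℝ] T} {ξ : T}
  [FiniteDimensional ℝ T] {n : ℕ} {e : Fin n → T}

section Slots

variable (hS : IsAlmostContactMetric F ξ) {h : Tensor3 T} (hh : h ∈ Tbar F ξ)
  (hF : ∀ X ∈ V ξ, ∀ Y ∈ V ξ, ∀ Z ∈ V ξ, h (F X) (F Y) Z = -h X Y Z)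
include hS hF

omit [FiniteDimensional ℝ T] in
-- With `F` as multiplication by `i`, the sign `-1` means complex linearity in the first two slots.
-- Together with `Tbar_map_left`, `F` moves freely among all three slots, so `h (F X) Y Z` inherits
-- the symmetries of `h`.
lemma map_left_eq_map_middle {X Y Z : T} (hX : X ∈ V ξ) (hY : Y ∈ V ξ) (hZ : Z ∈ V ξ) :
    h (F X) Y Z = h X (F Y) Z := by
  have := hF _ (hS.map_mem X) _ hY _ hZ
  rw [hS.sq_eq_neg _ hX, map_neg, LinearMap.neg_apply, LinearMap.neg_apply] at this
  linarith

include hh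

omit [FiniteDimensional ℝ T] in
lemma map_left_eq_map_right {X Y Z : T} (hX : X ∈ V ξ) (hY : Y ∈ V ξ) (hZ : Z ∈ V ξ) :
    h (F X) Y Z = h X Y (F Z) := by
  rw [map_left_eq_map_middle hS hF hX hY hZ, Tbar_map_left hh hS _ hY hZ]

end Slots

variable (he : IsUnitaryFrame F ξ e)
  (hS : IsAlmostContactMetric F ξ) (hT : Module.finrank ℝ T = 2 * n + 1)
include he hS hT

/-- On `V` these are real parts of alternating complex trilinear forms; each triple `a < b < c`
carries one complex, hence two real, coordinates. -/
lemma IsUnitaryFrame.finrank_TbarSub_zero_le :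
    Module.finrank ℝ (TbarSub n F ξ 0) ≤ 2 * Fintype.card (LtTriple n) := by
  refine (finrank_le_of_coords (ι := LtTriple n ⊕ LtTriple n) (Sum.elim
    (fun p => evalT (e (up (up p.2.2))) (e (up p.2.1)) (e p.1))
    (fun p => evalT (F (e (up (up p.2.2)))) (e (up p.2.1)) (e p.1))) ?_).trans_eq
    (by rw [Fintype.card_sum, two_mul])
  intro h hh h0
  have hF := TbarSub_map_VVV_neg hS hh (Or.inl rfl)
  have ha := hh.2.1
  have s := Tbar_swap hh.1
  refine Tbar_eq_zero hS hh.1 (he.zeroVVV hS hT (τ := -1) hh.1 (by simpa using hF) ?_ ?_)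
    hh.2.2.1 hh.2.2.2.1 hh.2.2.2.2
  · exact eq_zero_of_alternating (fun a b c => s _ _ _)
      (fun a b c => ha _ (he.mem a) _ (he.mem b) _ (he.mem c))
      fun a b c hab hbc => h0 (Sum.inl ⟨c, ⟨b, hbc⟩, ⟨a, hab⟩⟩)
  · refine eq_zero_of_alternating (fun a b c => s _ _ _) (fun a b c => ?_)
      fun a b c hab hbc => h0 (Sum.inr ⟨c, ⟨b, hbc⟩, ⟨a, hab⟩⟩)
    rw [map_left_eq_map_middle hS hF (he.mem a) (he.mem b) (he.mem c)]
    exact ha _ (he.mem a) _ (hS.map_mem _) _ (he.mem c)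

/-- Again complex trilinear on `V`, now with vanishing cyclic sum; the free components are those of
`eq_zero_of_cyclic`, each with its `F`-shifted partner. -/
lemma IsUnitaryFrame.finrank_TbarSub_one_le :
    Module.finrank ℝ (TbarSub n F ξ 1) ≤ 2 * Fintype.card (LeTriple n) := by
  refine (finrank_le_of_coords (ι := LeTriple n ⊕ LeTriple n) (Sum.elim
    (fun p => evalT (e (up' p.2.2)) (e (up p.2.1)) (e p.1))
    (fun p => evalT (F (e (up' p.2.2))) (e (up p.2.1)) (e p.1))) ?_).trans_eq
    (by rw [Fintype.card_sum, two_mul])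
  intro h hh h0
  have hF := TbarSub_map_VVV_neg hS hh (Or.inr rfl)
  have ha := hh.2.1
  have s := Tbar_swap hh.1
  refine Tbar_eq_zero hS hh.1 (he.zeroVVV hS hT (τ := -1) hh.1 (by simpa using hF) ?_ ?_)
    hh.2.2.1 hh.2.2.2.1 hh.2.2.2.2
  · exact eq_zero_of_cyclic (fun a b c => s _ _ _)
      (fun a b c => ha _ (he.mem a) _ (he.mem b) _ (he.mem c))
      fun a b c hbc hac => h0 (Sum.inl ⟨c, ⟨b, hbc⟩, ⟨a, Nat.lt_succ_of_le hac⟩⟩)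
  · refine eq_zero_of_cyclic (fun a b c => s _ _ _) (fun a b c => ?_)
      fun a b c hbc hac => h0 (Sum.inr ⟨c, ⟨b, hbc⟩, ⟨a, Nat.lt_succ_of_le hac⟩⟩)
    rw [map_left_eq_map_right hS hh.1 hF (he.mem b) (he.mem c) (he.mem a),
      map_left_eq_map_middle hS hF (he.mem c) (he.mem a) (he.mem b)]
    exact ha _ (hS.map_mem _) _ (he.mem b) _ (he.mem c)

/-- The two are bounded jointly: without the trace condition the entries with `b < c` are
coordinates with no further relation to track. The share of index `3` is found separately. -/
lemma IsUnitaryFrame.finrank_TbarSub_two_three_le :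
    Module.finrank ℝ ↥(TbarSub n F ξ 2 ⊔ TbarSub n F ξ 3) ≤
      2 * (n * Fintype.card (LtPair n)) := by
  refine (finrank_le_of_coords (ι := (Fin n × LtPair n) ⊕ (Fin n × LtPair n)) (Sum.elim
    (fun p => evalT (e p.1) (e (up p.2.2)) (e p.2.1))
    (fun p => evalT (F (e p.1)) (e (up p.2.2)) (e p.2.1))) ?_).trans_eq
    (by rw [Fintype.card_sum, Fintype.card_prod, Fintype.card_fin, two_mul])
  intro h hh h0
  obtain ⟨h2, hh2, h3, hh3, rfl⟩ := Submodule.mem_sup.1 hh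
  have hF : ∀ X ∈ V ξ, ∀ Y ∈ V ξ, ∀ Z ∈ V ξ, (h2 + h3) (F X) (F Y) Z = 1 * (h2 + h3) X Y Z := by
    intro X hX Y hY Z hZ
    simp only [LinearMap.add_apply, TbarSub_map_VVV hS hh2 (Or.inl rfl) X hX Y hY Z hZ,
      TbarSub_map_VVV hS hh3 (Or.inr rfl) X hX Y hY Z hZ, one_mul]
  have hb : h2 + h3 ∈ Tbar F ξ := add_mem hh2.1 hh3.1
  have s := Tbar_swap hb
  refine Tbar_eq_zero hS hb (he.zeroVVV hS hT hb hF ?_ ?_) (fun X hX Y hY => ?_)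
    (fun X hX => ?_) (fun X hX Y hY => ?_)
  · exact eq_zero_of_skew (fun a b c => s _ _ _)
      fun a b c hbc => h0 (Sum.inl ⟨a, c, ⟨b, hbc⟩⟩)
  · exact eq_zero_of_skew (fun a b c => s _ _ _)
      fun a b c hbc => h0 (Sum.inr ⟨a, c, ⟨b, hbc⟩⟩)
  · simp only [LinearMap.add_apply, hh2.2.2.2.1 X hX Y hY, hh3.2.2.1 X hX Y hY, add_zero]
  · simp only [LinearMap.add_apply, hh2.2.2.2.2.1 X hX, hh3.2.2.2.1 X hX, add_zero]
  · simp only [LinearMap.add_apply, hh2.2.2.2.2.2 X hX Y hY, hh3.2.2.2.2 X hX Y hY, add_zero]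

/-- The dimension of a space of tensors that are determined by a form `B h` on `V` with
`b(Y, X) = σ b(X, Y)` and `b(FX, FY) = τ b(X, Y)`. -/
lemma IsUnitaryFrame.finrank_le_of_bilin {W : Submodule ℝ (Tensor3 T)}
    (B : Tensor3 T →ₗ[ℝ] T →ₗ[ℝ] T →ₗ[ℝ] ℝ) {σ τ : ℝ}
    (hs : ∀ h ∈ W, ∀ X ∈ V ξ, ∀ Y ∈ V ξ, B h Y X = σ * B h X Y)
    (hF : ∀ h ∈ W, ∀ X ∈ V ξ, ∀ Y ∈ V ξ, B h (F X) (F Y) = τ * B h X Y)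
    (h0 : ∀ h ∈ W, (∀ X ∈ V ξ, ∀ Y ∈ V ξ, B h X Y = 0) → h = 0) :
    Module.finrank ℝ W ≤ 2 * Fintype.card (LtPair n) +
      ((if σ = -1 then 0 else n) + (if σ * τ = 1 then 0 else n)) := by
  set ev : T → T → Tensor3 T →ₗ[ℝ] ℝ := fun X Y =>
    (LinearMap.applyₗ Y).comp ((LinearMap.applyₗ X).comp B)
  have hcard : ∀ (p : Prop) [Decidable p],
      Fintype.card {_i : Fin n // ¬p} = if p then 0 else n := fun p _ => by
    by_cases hp : p <;> simp [hp]
  refine (finrank_le_of_coords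
    (ι := (LtPair n ⊕ LtPair n) ⊕ {_i : Fin n // ¬(σ = -1)} ⊕ {_i : Fin n // ¬(σ * τ = 1)})
    (Sum.elim
      (Sum.elim (fun p => ev (e (up p.2)) (e p.1)) fun p => ev (F (e (up p.2))) (e p.1))
      (Sum.elim (fun i => ev (e i) (e i)) fun i => ev (F (e i)) (e i))) ?_).trans_eq
    (by rw [Fintype.card_sum, Fintype.card_sum, Fintype.card_sum, hcard, hcard, two_mul])
  intro h hh hz
  refine h0 h hh (he.bilin_vanish hS hT (hs h hh) (hF h hh) (fun i j hij => ?_) (fun i j hij => ?_)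
    (fun hσ i => ?_) (fun hσ i => ?_))
  · exact hz (Sum.inl (Sum.inl ⟨j, ⟨i, hij⟩⟩))
  · exact hz (Sum.inl (Sum.inr ⟨j, ⟨i, hij⟩⟩))
  · exact hz (Sum.inr (Sum.inl ⟨i, hσ⟩))
  · exact hz (Sum.inr (Sum.inr ⟨i, hσ⟩))

/-- The form `h_{XYξ}`. -/
def formXi (ξ : T) : Tensor3 T →ₗ[ℝ] T →ₗ[ℝ] T →ₗ[ℝ] ℝ where
  toFun h := h.compr₂ (LinearMap.applyₗ ξ)
  map_add' _ _ := rfl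
  map_smul' _ _ := rfl

omit he hS hT [FiniteDimensional ℝ T] in
@[simp] lemma formXi_apply (h : Tensor3 T) (X Y : T) : formXi ξ h X Y = h X Y ξ := rfl

omit he hS hT in
/-- A tensor in one of the subspaces `T̄_5, …, T̄_{10}` is determined by the form `h_{XYξ}`. -/
lemma TbarSub_eq_zero_of_formXi (hS : IsAlmostContactMetric F ξ) {i j : Fin 12} (hi : 4 ≤ i)
    (hi' : i < 10) (hj : 4 ≤ j) (hj' : j < 10) {h : Tensor3 T}
    (hh : h ∈ TbarSub n F ξ i ⊔ TbarSub n F ξ j)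
    (h0 : ∀ X ∈ V ξ, ∀ Y ∈ V ξ, formXi ξ h X Y = 0) : h = 0 := by
  obtain ⟨k, hk, l, hl, rfl⟩ := Submodule.mem_sup.1 hh
  refine Tbar_eq_zero hS (add_mem hk.1 hl.1) (fun X hX Y hY Z hZ => ?_) h0 (fun X hX => ?_)
    (fun X hX Y hY => ?_)
  · simp only [LinearMap.add_apply, TbarSub_zeroVVV hk hi X hX Y hY Z hZ,
      TbarSub_zeroVVV hl hj X hX Y hY Z hZ, add_zero]
  · simp only [LinearMap.add_apply, TbarSub_zeroXiVxi hk hi'.ne X hX,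
      TbarSub_zeroXiVxi hl hj'.ne X hX, add_zero]
  · have h1 : i ≠ 11 := by rintro rfl; exact absurd hi' (by decide)
    have h2 : j ≠ 11 := by rintro rfl; exact absurd hj' (by decide)
    simp only [LinearMap.add_apply, TbarSub_zeroXiVV hk h1 X hX Y hY,
      TbarSub_zeroXiVV hl h2 X hX Y hY, add_zero]

/-- Index `6` restores the trace that index `4` lacks. For `σ = -1`, `τ = 1` the diagonal entries `b
(e_i) (e_i)` vanish by skewness, but the `n` entries `b (F e_i) (e_i)` count. -/
lemma IsUnitaryFrame.finrank_TbarSub_four_six_le :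
    Module.finrank ℝ ↥(TbarSub n F ξ 4 ⊔ TbarSub n F ξ 6) ≤ 2 * Fintype.card (LtPair n) + n := by
  refine (he.finrank_le_of_bilin hS hT (formXi ξ) (σ := -1) (τ := 1) ?_ ?_
    fun h hh => TbarSub_eq_zero_of_formXi hS (by decide) (by decide) (by decide) (by decide)
      hh).trans_eq (by norm_num)
  all_goals
    intro h hh X hX Y hY
    obtain ⟨k, hk, l, hl, rfl⟩ := Submodule.mem_sup.1 hh
    simp only [formXi_apply, LinearMap.add_apply]
  · rw [TbarSub_skew hk hS (by decide) X hX Y hY, TbarSub_skew hl hS (by decide) X hX Y hY]; ring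
  · rw [TbarSub_map_eq hk hS (by decide) X hX Y hY, TbarSub_map_eq hl hS (by decide) X hX Y hY]
    ring

/-- The symmetric analogue: for `σ = τ = 1` the entries `b (F e_i) (e_i)` vanish, and the `n`
entries `b (e_i) (e_i)` count. -/
lemma IsUnitaryFrame.finrank_TbarSub_seven_nine_le :
    Module.finrank ℝ ↥(TbarSub n F ξ 7 ⊔ TbarSub n F ξ 9) ≤ 2 * Fintype.card (LtPair n) + n := by
  refine (he.finrank_le_of_bilin hS hT (formXi ξ) (σ := 1) (τ := 1) ?_ ?_
    fun h hh => TbarSub_eq_zero_of_formXi hS (by decide) (by decide) (by decide) (by decide)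
      hh).trans_eq (by norm_num)
  all_goals
    intro h hh X hX Y hY
    obtain ⟨k, hk, l, hl, rfl⟩ := Submodule.mem_sup.1 hh
    simp only [formXi_apply, LinearMap.add_apply]
  · rw [TbarSub_symm hk (by decide) X hX Y hY, TbarSub_symm hl (by decide) X hX Y hY]; ring
  · rw [TbarSub_map_eq hk hS (by decide) X hX Y hY, TbarSub_map_eq hl hS (by decide) X hX Y hY]
    ring

lemma IsUnitaryFrame.finrank_TbarSub_five_le :
    Module.finrank ℝ (TbarSub n F ξ 5) ≤ 2 * Fintype.card (LtPair n) := by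
  refine (he.finrank_le_of_bilin hS hT (formXi ξ) (σ := -1) (τ := -1) ?_ ?_
    fun h hh => TbarSub_eq_zero_of_formXi (i := 5) (j := 5) hS (by decide) (by decide) (by decide)
      (by decide) (Submodule.mem_sup_left hh)).trans_eq (by norm_num)
  all_goals
    intro h hh X hX Y hY
    simp only [formXi_apply]
  · rw [TbarSub_skew hh hS (by decide) X hX Y hY]; ring
  · rw [TbarSub_map_eq_neg hh (by decide) X hX Y hY]; ring

lemma IsUnitaryFrame.finrank_TbarSub_eight_le :
    Module.finrank ℝ (TbarSub n F ξ 8) ≤ 2 * Fintype.card (LtPair n) + 2 * n := by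
  refine (he.finrank_le_of_bilin hS hT (formXi ξ) (σ := 1) (τ := -1) ?_ ?_
    fun h hh => TbarSub_eq_zero_of_formXi (i := 8) (j := 8) hS (by decide) (by decide) (by decide)
      (by decide) (Submodule.mem_sup_left hh)).trans_eq (by norm_num; ring)
  all_goals
    intro h hh X hX Y hY
    simp only [formXi_apply]
  · rw [TbarSub_symm hh (by decide) X hX Y hY]; ring
  · rw [TbarSub_map_eq_neg hh (by decide) X hX Y hY]; ring

lemma IsUnitaryFrame.finrank_TbarSub_eleven_le :
    Module.finrank ℝ (TbarSub n F ξ 11) ≤ 2 * Fintype.card (LtPair n) := by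
  refine (he.finrank_le_of_bilin hS hT (LinearMap.applyₗ ξ) (σ := -1) (τ := -1) ?_ ?_
    fun h hh h0 => ?_).trans_eq (by norm_num)
  · intro h hh X hX Y hY
    rw [LinearMap.applyₗ_apply_apply, hh.2.1 X hX Y hY]; ring
  · intro h hh X hX Y hY
    rw [LinearMap.applyₗ_apply_apply, hh.2.2.1 X hX Y hY]; ring
  · exact Tbar_eq_zero hS hh.1 hh.2.2.2.1 hh.2.2.2.2.1 hh.2.2.2.2.2 h0

lemma IsUnitaryFrame.finrank_TbarSub_ten_le : Module.finrank ℝ (TbarSub n F ξ 10) ≤ 2 * n := by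
  refine (finrank_le_of_coords (ι := Fin n ⊕ Fin n)
    (fun i => evalT ξ (frameV F e i) ξ) ?_).trans_eq (by simp; ring)
  intro h hh h0
  refine Tbar_eq_zero hS hh.1 hh.2.1 hh.2.2.1 ?_ hh.2.2.2
  exact he.linearMap_eq_zero hS hT ((LinearMap.applyₗ ξ).comp (h ξ)) (fun a => h0 (Sum.inl a))
    (fun a => h0 (Sum.inr a))

omit he hS hT in
/-- `h ↦ β(U)` as a linear functional. -/
def betaT (ξ U : T) : Tensor3 T →ₗ[ℝ] ℝ where
  toFun h := beta ξ h U
  map_add' h k := beta_add ξ h k U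
  map_smul' c h := beta_smul ξ c h U

omit he hS hT in
/-- `h ↦ β̄(U)` as a linear functional. -/
def betaBarT (F : T →ₗ[ℝ] T) (ξ U : T) : Tensor3 T →ₗ[ℝ] ℝ where
  toFun h := betaBar F ξ h U
  map_add' h k := betaBar_add F ξ h k U
  map_smul' c h := betaBar_smul F ξ c h U

lemma IsUnitaryFrame.finrank_TbarSub_three_le : Module.finrank ℝ (TbarSub n F ξ 3) ≤ 2 * n := by
  refine (finrank_le_of_coords (ι := Fin n ⊕ Fin n)
    (fun i => betaT ξ (frameV F e i)) ?_).trans_eq (by simp; ring)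
  intro h hh h0
  have h1 : ∀ U ∈ V ξ, beta ξ h U = 0 := he.linearMap_eq_zero hS hT (betaₗ ξ h)
    (fun a => h0 (Sum.inl a)) (fun a => h0 (Sum.inr a))
  refine Tbar_eq_zero hS hh.1 (fun X hX Y hY Z hZ => ?_) hh.2.2.1 hh.2.2.2.1 hh.2.2.2.2
  rw [hh.2.1 X hX Y hY Z hZ, h1 _ hY, h1 _ hZ, h1 _ (hS.map_mem _), h1 _ (hS.map_mem _)]
  ring

/-- Every functional on `V` is the trace of a trace tensor. The exact dimension is needed to extract
that of index `2` from the joint bound. -/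
lemma IsUnitaryFrame.le_finrank_TbarSub_three (hn : 2 ≤ n) :
    2 * n ≤ Module.finrank ℝ (TbarSub n F ξ 3) := by
  have hn1 : (n : ℝ) - 1 ≠ 0 := by
    have : (2 : ℝ) ≤ n := by exact_mod_cast hn
    linarith
  have hsurj : Function.Surjective ((LinearMap.pi fun i => betaT ξ (frameV F e i)).comp
      (TbarSub n F ξ 3).subtype) := by
    intro w
    -- The prefactor cancels the `2(n - 1)` of `beta_traceTensor`, so the trace takes the prescribed
    -- values on the frame.
    set θ : T →ₗ[ℝ] ℝ := (1 / (2 * ((n : ℝ) - 1))) • ∑ i, w i • innerₗ T (frameV F e i)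
    refine ⟨⟨_, horT_traceTensor_mem hS hT hn θ⟩, ?_⟩
    ext j
    change beta ξ (horT (traceTensor F θ) ξ) (frameV F e j) = _
    rw [beta_horT _ (he.frameV_mem hS j), beta_traceTensor hS hT _ (he.frameV_mem hS j)]
    simp only [θ, LinearMap.smul_apply, LinearMap.sum_apply, innerₗ_apply_apply, smul_eq_mul,
      orthonormal_iff_ite.1 (he.orthonormal_frameV hS)]
    simp
    field_simp
  have := LinearMap.finrank_le_finrank_of_surjective hsurj
  rw [Module.finrank_fintype_fun_eq_card, Fintype.card_sum, Fintype.card_fin] at this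
  omega

end DimensionBounds

/-! ### The lower bound for the whole space and the exact dimensions -/

section Dimensions

set_option maxSynthPendingDepth 3

variable {T : Type*} [NormedAddCommGroup T] [InnerProductSpace ℝ T] {F : T →ₗ[ℝ] T} {ξ : T}
  [FiniteDimensional ℝ T] {n : ℕ}

lemma finrank_TbarSub_six_le (hS : IsAlmostContactMetric F ξ) :
    Module.finrank ℝ (TbarSub n F ξ 6) ≤ 1 := by
  refine (finrank_le_of_coords (ι := Unit) (fun _ => betaBarT F ξ ξ) ?_).trans_eq (by simp)
  intro h hh h0
  have h0 : betaBar F ξ h ξ = 0 := h0 ()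
  refine Tbar_eq_zero hS hh.1 hh.2.2.1 (fun X hX Y hY => ?_) hh.2.2.2.1 hh.2.2.2.2
  rw [hh.2.1 X hX Y hY, h0]; ring

lemma finrank_TbarSub_nine_le (hS : IsAlmostContactMetric F ξ) :
    Module.finrank ℝ (TbarSub n F ξ 9) ≤ 1 := by
  refine (finrank_le_of_coords (ι := Unit) (fun _ => betaT ξ ξ) ?_).trans_eq (by simp)
  intro h hh h0
  have h0 : beta ξ h ξ = 0 := h0 ()
  refine Tbar_eq_zero hS hh.1 hh.2.2.1 (fun X hX Y hY => ?_) hh.2.2.2.1 hh.2.2.2.2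
  rw [hh.2.1 X hX Y hY, h0]; ring

/-- Tensors that are symmetric in the last two arguments. -/
def symTensors (T : Type*) [NormedAddCommGroup T] [InnerProductSpace ℝ T] :
    Submodule ℝ (Tensor3 T) where
  carrier := {h | ∀ X Y Z, h X Y Z = h X Z Y}
  zero_mem' := fun _ _ _ => rfl
  add_mem' := fun {h k} hh hk X Y Z => by simp only [LinearMap.add_apply, hh X Y Z, hk X Y Z]
  smul_mem' := fun c h hh X Y Z => by simp only [LinearMap.smul_apply, hh X Y Z]

/-- Tensors that are skew and `F`-invariant in the last two arguments. -/
def skewInvTensors (F : T →ₗ[ℝ] T) : Submodule ℝ (Tensor3 T) where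
  carrier := {h | ∀ X Y Z, h X Y Z = -h X Z Y ∧ h X (F Y) (F Z) = h X Y Z}
  zero_mem' := fun _ _ _ => by simp
  add_mem' := fun {h k} hh hk X Y Z => by
    simp only [LinearMap.add_apply, (hh X Y Z).2, (hk X Y Z).2]
    exact ⟨by rw [(hh X Y Z).1, (hk X Y Z).1]; ring, trivial⟩
  smul_mem' := fun c h hh X Y Z => by
    simp only [LinearMap.smul_apply, (hh X Y Z).2, smul_eq_mul]
    exact ⟨by rw [(hh X Y Z).1]; ring, trivial⟩

lemma finrank_symTensors_le : Module.finrank ℝ (symTensors T) ≤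
    Module.finrank ℝ T * Fintype.card (LePair (Module.finrank ℝ T)) := by
  set b := Module.finBasis ℝ T
  refine (finrank_le_of_coords (ι := Fin (Module.finrank ℝ T) × LePair (Module.finrank ℝ T))
    (fun p => evalT (b p.1) (b (up' p.2.2)) (b p.2.1)) ?_).trans_eq (by simp)
  intro h hh h0
  refine b.ext fun i => b.ext fun j => b.ext fun k => ?_
  have h1 : ∀ j k, j ≤ k → h (b i) (b j) (b k) = 0 := fun j k hjk =>
    h0 (i, ⟨k, ⟨j, Nat.lt_succ_of_le hjk⟩⟩)
  rcases le_total j k with hjk | hjk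
  · exact h1 j k hjk
  · rw [hh (b i) (b j) (b k)]; exact h1 k j hjk

lemma finrank_skewInvTensors_le (hS : IsAlmostContactMetric F ξ)
    (hT : Module.finrank ℝ T = 2 * n + 1) : Module.finrank ℝ (skewInvTensors F) ≤
      Module.finrank ℝ T * (Fintype.card (LtPair n) + Fintype.card (LePair n)) := by
  obtain ⟨e, he⟩ := hS.exists_frame hT
  set b := Module.finBasis ℝ T
  refine (finrank_le_of_coords (ι := Fin (Module.finrank ℝ T) × (LtPair n ⊕ LePair n))
    (fun p => p.2.elim (fun q => evalT (b p.1) (e (up q.2)) (e q.1))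
      (fun q => evalT (b p.1) (F (e (up' q.2))) (e q.1))) ?_).trans_eq (by simp)
  intro h hh h0
  refine b.ext fun i => ?_
  have h1 : ∀ X ∈ V ξ, ∀ Y ∈ V ξ, h (b i) X Y = 0 :=
    he.bilin_vanish hS hT (b := h (b i)) (σ := -1) (τ := 1)
      (fun X _ Y _ => by rw [(hh (b i) Y X).1]; ring)
      (fun X _ Y _ => by rw [(hh (b i) X Y).2]; ring)
      (fun j k hjk => h0 (i, Sum.inl ⟨k, ⟨j, hjk⟩⟩))
      (fun j k hjk => h0 (i, Sum.inr ⟨k, ⟨j, Nat.lt_succ_of_lt hjk⟩⟩))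
      (fun hσ => absurd rfl hσ) (fun _ j => h0 (i, Sum.inr ⟨j, ⟨j, Nat.lt_succ_self _⟩⟩))
  ext X Y
  -- Invariance under `F` moves both arguments into `V`, where the vanishing is known; components
  -- along `ξ` need no separate coordinates.
  rw [← (hh (b i) X Y).2]
  exact h1 _ (hS.map_mem X) _ (hS.map_mem Y)

omit [FiniteDimensional ℝ T] in
-- In the last two slots a form is a symmetric one plus a skew one, and the skew one is an
-- `F`-invariant part plus one that is `F`-anti-invariant on `V`. The terms with `ξ` go to `Tbar`.
lemma sup_tensors_eq_top (hS : IsAlmostContactMetric F ξ) :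
    Tbar F ξ ⊔ symTensors T ⊔ skewInvTensors F = ⊤ := by
  refine eq_top_iff.2 fun h _ => ?_
  have hP : ∀ X, (F.comp F) (F X) = -F X := fun X => hS.sq_eq_neg _ (hS.map_mem X)
  set t : Tensor3 T := cyc (cyc (LinearMap.flip h)) with ht
  have hta : ∀ X Y Z, t X Y Z = h X Z Y := fun _ _ _ => rfl
  -- The average of the skew part over `(F², F²)` and `(F, F)`. Using `F²` in place of the identity
  -- projects to `V` first; the factor `1/4` combines this average with the `1/2` of skew
  -- symmetrization.
  set k : Tensor3 T := (1 / 4 : ℝ) • (pull LinearMap.id (F.comp F) (F.comp F) (h - t) +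
    pull LinearMap.id F F (h - t)) with hk
  have hka : ∀ X Y Z, k X Y Z = 1 / 4 * (h X (F (F Y)) (F (F Z)) - h X (F (F Z)) (F (F Y)) +
    (h X (F Y) (F Z) - h X (F Z) (F Y))) := fun _ _ _ => rfl
  have h1 : (1 / 2 : ℝ) • (h + t) ∈ symTensors T := fun X Y Z => by
    simp only [LinearMap.smul_apply, LinearMap.add_apply, hta]
    rw [add_comm]
  have h2 : k ∈ skewInvTensors F := fun X Y Z => by
    have e1 : ∀ X, F (F (F X)) = -F X := hP
    simp only [hka, e1, map_neg, LinearMap.neg_apply]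
    exact ⟨by ring, by ring⟩
  have h3 : (1 / 2 : ℝ) • (h - t) - k ∈ Tbar F ξ := by
    refine ⟨fun X Y Z => ?_, fun X Y hY Z hZ => ?_⟩
    · simp only [LinearMap.sub_apply, LinearMap.smul_apply, hka, hta, smul_eq_mul]; ring
    · simp only [LinearMap.sub_apply, LinearMap.smul_apply, hka, hta, smul_eq_mul,
        hS.sq_eq_neg _ hY, hS.sq_eq_neg _ hZ, map_neg,
        LinearMap.neg_apply]
      ring
  have h4 : h = ((1 / 2 : ℝ) • (h - t) - k) + (1 / 2 : ℝ) • (h + t) + k := by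
    ext X Y Z
    simp only [LinearMap.sub_apply, LinearMap.smul_apply, LinearMap.add_apply, smul_eq_mul]
    ring
  rw [h4]
  exact Submodule.add_mem_sup (Submodule.add_mem_sup h3 h1) h2

variable (hS : IsAlmostContactMetric F ξ) (hT : Module.finrank ℝ T = 2 * n + 1)
include hS hT

/-- Subtract from `(2n + 1)³` the bounds `(2n + 1)²(n + 1)` for `symTensors` and `(2n + 1)n²` for
`skewInvTensors`; what remains is `(2n + 1)n(n + 1)`. -/
lemma le_finrank_Tbar : ((2 * n + 1) * n * (n + 1) : ℚ) ≤ Module.finrank ℝ (Tbar F ξ) := by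
  have h1 := Submodule.finrank_add_le_finrank_add_finrank (Tbar F ξ ⊔ symTensors T)
    (skewInvTensors F)
  have h2 := Submodule.finrank_add_le_finrank_add_finrank (Tbar F ξ) (symTensors T)
  rw [sup_tensors_eq_top hS, finrank_top, Module.finrank_linearMap, Module.finrank_linearMap,
    Module.finrank_linearMap, Module.finrank_self] at h1
  have h3 := finrank_symTensors_le (T := T)
  have h4 := finrank_skewInvTensors_le hS hT
  rw [hT] at h1 h3 h4
  have h5 := card_LePair (2 * n + 1)
  have h6 := card_LtPair n
  have h7 := card_LePair n
  have h8 : ((2 * n + 1) * ((2 * n + 1) * ((2 * n + 1) * 1)) : ℚ) ≤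
      Module.finrank ℝ (Tbar F ξ) + (2 * n + 1) * Fintype.card (LePair (2 * n + 1)) +
      (2 * n + 1) * (Fintype.card (LtPair n) + Fintype.card (LePair n)) := by
    exact_mod_cast h1.trans (by omega)
  rw [h5, h6, h7] at h8
  push_cast at h8
  linarith

lemma one_le_finrank_TbarSub_six (hn : n ≠ 0) : 1 ≤ Module.finrank ℝ (TbarSub n F ξ 6) := by
  obtain ⟨e, he⟩ := hS.exists_frame hT
  set i : Fin n := ⟨0, Nat.pos_of_ne_zero hn⟩
  refine (Module.finrank_pos_iff_exists_ne_zero (R := ℝ)).2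
    ⟨(⟨_, liftB_omega_mem hS hT hn 1⟩ : TbarSub n F ξ 6), fun h0 => ?_⟩
  have h1 := congrArg (fun h : TbarSub n F ξ 6 => h.1 (e i) (F (e i)) ξ) h0
  simp only [liftB_apply_xi hS _ (he.mem i) (hS.map_mem _)] at h1
  have h2 := hS.inner_map _ (he.mem i) _ (he.mem i)
  rw [he.inner_eq, if_pos rfl] at h2
  simp only [LinearMap.smul_apply, LinearMap.comp_apply, innerₗ_apply_apply, h2] at h1
  norm_num at h1

lemma one_le_finrank_TbarSub_nine (hn : n ≠ 0) : 1 ≤ Module.finrank ℝ (TbarSub n F ξ 9) := by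
  obtain ⟨e, he⟩ := hS.exists_frame hT
  set i : Fin n := ⟨0, Nat.pos_of_ne_zero hn⟩
  refine (Module.finrank_pos_iff_exists_ne_zero (R := ℝ)).2
    ⟨(⟨_, liftB_inner_mem hS hT hn 1⟩ : TbarSub n F ξ 9), fun h0 => ?_⟩
  have h1 := congrArg (fun h : TbarSub n F ξ 9 => h.1 (e i) (e i) ξ) h0
  simp only [liftB_apply_xi hS _ (he.mem i) (he.mem i)] at h1
  have h2 := he.inner_eq i i
  rw [if_pos rfl] at h2
  simp only [LinearMap.smul_apply, innerₗ_apply_apply, h2] at h1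
  norm_num at h1

/-- The dimensions of the twelve subspaces and of `T̄(T)`. -/
lemma finrank_TbarSub_and_Tbar (hn : 2 ≤ n) :
    (∀ i, (Module.finrank ℝ (TbarSub n F ξ i) : ℚ) = tableDim n i) ∧
      Module.finrank ℝ (Tbar F ξ) = (2 * n + 1) * n * (n + 1) := by
  obtain ⟨e, he⟩ := hS.exists_frame hT
  have hd : ∀ i j, i ≠ j → Disjoint (TbarSub n F ξ i) (TbarSub n F ξ j) := fun i j hij =>
    (iSupIndep_TbarSub hS hT).pairwiseDisjoint hij
  have hsum := finrank_iSup_le (TbarSub n F ξ)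
  rw [iSup_TbarSub hS hT hn] at hsum
  simp only [Fin.sum_univ_succ, Fin.sum_univ_zero, Fin.succ_zero_eq_one] at hsum
  have hlow := le_finrank_Tbar hS hT
  set d : Fin 12 → ℕ := fun i => Module.finrank ℝ (TbarSub n F ξ i) with hddef
  have hsum : Module.finrank ℝ (Tbar F ξ) ≤ d 0 + d 1 + d 2 + d 3 + d 4 + d 5 + d 6 + d 7 + d 8 +
      d 9 + d 10 + d 11 := hsum.trans_eq (by simp only [hddef]; simp [add_assoc])
  have c2 := card_LtPair n
  have a0 : d 0 ≤ 2 * Fintype.card (LtTriple n) := he.finrank_TbarSub_zero_le hS hT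
  have a1 : d 1 ≤ 2 * Fintype.card (LeTriple n) := he.finrank_TbarSub_one_le hS hT
  have a23 : d 2 + d 3 ≤ 2 * (n * Fintype.card (LtPair n)) := by
    rw [← finrank_add_of_disjoint (hd 2 3 (by decide))]
    exact he.finrank_TbarSub_two_three_le hS hT
  have a46 : d 4 + d 6 ≤ 2 * Fintype.card (LtPair n) + n := by
    rw [← finrank_add_of_disjoint (hd 4 6 (by decide))]
    exact he.finrank_TbarSub_four_six_le hS hT
  have a79 : d 7 + d 9 ≤ 2 * Fintype.card (LtPair n) + n := by
    rw [← finrank_add_of_disjoint (hd 7 9 (by decide))]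
    exact he.finrank_TbarSub_seven_nine_le hS hT
  have a3 : d 3 = 2 * n := le_antisymm (he.finrank_TbarSub_three_le hS hT)
    (he.le_finrank_TbarSub_three hS hT hn)
  have a6 : d 6 = 1 := le_antisymm (finrank_TbarSub_six_le hS)
    (one_le_finrank_TbarSub_six hS hT (by omega))
  have a9 : d 9 = 1 := le_antisymm (finrank_TbarSub_nine_le hS)
    (one_le_finrank_TbarSub_nine hS hT (by omega))
  have a5 : d 5 ≤ 2 * Fintype.card (LtPair n) := he.finrank_TbarSub_five_le hS hT
  have a8 : d 8 ≤ 2 * Fintype.card (LtPair n) + 2 * n := he.finrank_TbarSub_eight_le hS hT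
  have a10 : d 10 ≤ 2 * n := he.finrank_TbarSub_ten_le hS hT
  have a11 : d 11 ≤ 2 * Fintype.card (LtPair n) := he.finrank_TbarSub_eleven_le hS hT
  have e0 := card_LtTriple n
  have e1 := card_LeTriple n
  set L := Fintype.card (LtPair n)
  set L3 := Fintype.card (LtTriple n)
  set M3 := Fintype.card (LeTriple n)
  set D := Module.finrank ℝ (Tbar F ξ)
  have hdi : ∀ i, Module.finrank ℝ (TbarSub n F ξ i) = d i := fun _ => rfl
  clear_value d L L3 M3 D
  have b0 : (d 0 : ℚ) ≤ 2 * L3 := by exact_mod_cast a0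
  have b1 : (d 1 : ℚ) ≤ 2 * M3 := by exact_mod_cast a1
  have b23 : (d 2 : ℚ) + d 3 ≤ 2 * (n * L) := by exact_mod_cast a23
  have b46 : (d 4 : ℚ) + d 6 ≤ 2 * L + n := by exact_mod_cast a46
  have b79 : (d 7 : ℚ) + d 9 ≤ 2 * L + n := by exact_mod_cast a79
  have b3 : (d 3 : ℚ) = 2 * n := by exact_mod_cast a3
  have b6 : (d 6 : ℚ) = 1 := by exact_mod_cast a6
  have b9 : (d 9 : ℚ) = 1 := by exact_mod_cast a9
  have b5 : (d 5 : ℚ) ≤ 2 * L := by exact_mod_cast a5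
  have b8 : (d 8 : ℚ) ≤ 2 * L + 2 * n := by exact_mod_cast a8
  have b10 : (d 10 : ℚ) ≤ 2 * n := by exact_mod_cast a10
  have b11 : (d 11 : ℚ) ≤ 2 * L := by exact_mod_cast a11
  have bs : (D : ℚ) ≤ d 0 + d 1 + d 2 + d 3 + d 4 + d 5 + d 6 + d 7 + d 8 + d 9 + d 10 + d 11 := by
    exact_mod_cast hsum
  rw [c2] at b23 b46 b79 b5 b8 b11
  rw [e0] at b0
  rw [e1] at b1
  simp only [hdi]
  clear hd e0 e1 c2 a0 a1 a23 a46 a79 a3 a6 a9 a5 a8 a10 a11 hsum hddef hdi he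
  -- The upper bounds sum to the lower bound `hlow`, so every inequality is an equality. The known
  -- values at `3`, `6`, `9` then separate the three joint bounds.
  refine ⟨fun i => ?_, ?_⟩
  · generalize (n : ℚ) = q at *
    fin_cases i <;> simp only [tableDim] <;> simp only [Fin.reduceFinMk, Fin.mk_one, Fin.zero_eta]
      <;> linarith
  · have : (D : ℚ) = (2 * n + 1) * n * (n + 1) := by linarith
    exact_mod_cast this

end Dimensions

/-! ### Torus elements and the weight criterion for irreducibility -/

section Irreducibility

set_option maxSynthPendingDepth 3

variable {T : Type*} [NormedAddCommGroup T] [InnerProductSpace ℝ T] {F : T →ₗ[ℝ] T} {ξ : T}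

section Torus

variable {n : ℕ} {e : Fin n → T}

lemma act_inv_apply (g : T ≃ₗᵢ[ℝ] T) (h : Tensor3 T) (X Y Z : T) :
    act g⁻¹ h X Y Z = h (g X) (g Y) (g Z) := by
  rw [act_apply, inv_inv]

/-- The frame rotated by unit complex numbers, where `F` is multiplication by `i`. -/
def turn (F : T →ₗ[ℝ] T) (e : Fin n → T) (z : Fin n → ℂ) (a : Fin n) : T :=
  (z a).re • e a + (z a).im • F (e a)

lemma IsUnitaryFrame.turn (he : IsUnitaryFrame F ξ e) (hS : IsAlmostContactMetric F ξ)
    {z : Fin n → ℂ} (hz : ∀ a, Complex.normSq (z a) = 1) : IsUnitaryFrame F ξ (turn F e z) := by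
  have h1 : ∀ a b, inner ℝ (F (e a)) (e b) = (0 : ℝ) := fun a b => by
    rw [real_inner_comm]; exact he.inner_map_eq b a
  have h2 : ∀ a b, inner ℝ (F (e a)) (F (e b)) = if a = b then (1 : ℝ) else 0 := fun a b => by
    rw [hS.inner_map _ (he.mem a) _ (he.mem b), he.inner_eq]
  refine ⟨fun a => add_mem (Submodule.smul_mem _ _ (he.mem a))
    (Submodule.smul_mem _ _ (hS.map_mem _)), fun a b => ?_, fun a b => ?_⟩
  · simp only [ACM.turn, inner_add_left, inner_add_right, inner_smul_left, inner_smul_right, h1, h2,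
      he.inner_eq, he.inner_map_eq]
    split_ifs with hab
    · subst hab
      have := hz a
      rw [Complex.normSq_apply] at this
      simpa using this
    · simp
  · simp only [ACM.turn, inner_add_left, inner_add_right, inner_smul_left, inner_smul_right, h1, h2,
      he.inner_eq, he.inner_map_eq, map_add, map_smul, he.map_map hS, inner_neg_right]
    split_ifs with hab
    · simp [hab]; ring
    · simp

lemma IsUnitaryFrame.comp_perm (he : IsUnitaryFrame F ξ e) (σ : Equiv.Perm (Fin n)) :
    IsUnitaryFrame F ξ fun a => e (σ a) where
  mem a := he.mem _
  inner_eq a b := by rw [he.inner_eq]; simp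
  inner_map_eq a b := he.inner_map_eq _ _

/-- Multiplication by `i` in one slot. -/
def quarter (i : Fin n) : Fin n → ℂ := Function.update 1 i Complex.I

/-- Change of sign in one slot. -/
def flip (i : Fin n) : Fin n → ℂ := Function.update 1 i (-1)

lemma normSq_quarter (i a : Fin n) : Complex.normSq (quarter i a) = 1 := by
  unfold quarter; by_cases h : a = i <;> simp [h]

lemma normSq_flip (i a : Fin n) : Complex.normSq (flip i a) = 1 := by
  unfold flip; by_cases h : a = i <;> simp [h]

lemma turn_quarter_self (i : Fin n) : turn F e (quarter i) i = F (e i) := by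
  simp [turn, quarter]

lemma turn_quarter_of_ne {i a : Fin n} (h : a ≠ i) : turn F e (quarter i) a = e a := by
  simp [turn, quarter, h]

/-- The sign `-1` if `a = i`, and `1` otherwise. -/
def sgn (i a : Fin n) : ℝ := if a = i then -1 else 1

lemma turn_flip (i a : Fin n) : turn F e (flip i) a = sgn i a • e a := by
  by_cases h : a = i <;> simp [turn, flip, h, sgn]

/-- The frame rotated by 45 degrees in the plane of `e a` and `e b`. -/
def rotated (e : Fin n → T) (a b c : Fin n) : T :=
  if c = a then (√2)⁻¹ • (e a + e b) else if c = b then (√2)⁻¹ • (e a - e b) else e c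

lemma IsUnitaryFrame.rotated (he : IsUnitaryFrame F ξ e) {a b : Fin n} (hab : a ≠ b) :
    IsUnitaryFrame F ξ (rotated e a b) := by
  have h2 : (√2)⁻¹ * (√2)⁻¹ = (1 / 2 : ℝ) := by
    rw [← mul_inv, Real.mul_self_sqrt (by norm_num)]; norm_num
  have hba := hab.symm
  refine ⟨fun c => ?_, fun c d => ?_, fun c d => ?_⟩
  · unfold ACM.rotated
    split_ifs
    · exact Submodule.smul_mem _ _ (add_mem (he.mem _) (he.mem _))
    · exact Submodule.smul_mem _ _ (sub_mem (he.mem _) (he.mem _))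
    · exact he.mem _
  · unfold ACM.rotated
    split_ifs <;>
    simp only [inner_add_left, inner_add_right, inner_sub_left, inner_sub_right, inner_smul_left,
      inner_smul_right, he.inner_eq, map_inv₀, conj_trivial] <;>
    grind
  · unfold ACM.rotated
    split_ifs <;>
    simp [inner_add_left, inner_add_right, inner_sub_left, inner_sub_right, inner_smul_left,
      inner_smul_right, he.inner_map_eq]

end Torus

section Criterion

/-- Every functional on a subspace is the product with one of its elements, for an anisotropic
form. -/
lemma exists_bilin_eq {E : Type*} [AddCommGroup E] [Module ℝ E] [FiniteDimensional ℝ E]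
    (B : E →ₗ[ℝ] E →ₗ[ℝ] ℝ) (hB : ∀ v, B v v = 0 → v = 0) (W : Submodule ℝ E) (ℓ : E →ₗ[ℝ] ℝ) :
    ∃ v ∈ W, ∀ k ∈ W, B v k = ℓ k := by
  set D : W →ₗ[ℝ] Module.Dual ℝ W := B.domRestrict₁₂ W W
  have hD : Function.Injective D := by
    intro v w hvw
    refine Subtype.ext (sub_eq_zero.1 (hB _ ?_))
    rw [LinearMap.map_sub₂, sub_eq_zero]
    exact LinearMap.congr_fun hvw (v - w)
  have hD' : Function.Surjective D := (LinearMap.injective_iff_surjective_of_finrank_eq_finrank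
    Subspace.dual_finrank_eq.symm).1 hD
  obtain ⟨v, hv⟩ := hD' (ℓ.comp W.subtype)
  exact ⟨v, v.2, fun k hk => LinearMap.congr_fun hv ⟨k, hk⟩⟩

variable [FiniteDimensional ℝ T]

lemma tensorInner_smul_left (c : ℝ) (h k : Tensor3 T) :
    tensorInner (c • h) k = c * tensorInner h k :=
  LinearMap.map_smul₂ (tensorForm T) c h k

lemma tensorInner_sub_left (h h' k : Tensor3 T) :
    tensorInner (h - h') k = tensorInner h k - tensorInner h' k :=
  LinearMap.map_sub₂ (tensorForm T) h h' k

/-- Every functional on a space of tensors is the inner product with one of its elements. -/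
lemma exists_tensorInner_eq (W : Submodule ℝ (Tensor3 T)) (ℓ : Tensor3 T →ₗ[ℝ] ℝ) :
    ∃ v ∈ W, ∀ k ∈ W, tensorInner v k = ℓ k :=
  exists_bilin_eq (tensorForm T) (fun _ hv => eq_zero_of_tensorInner_self hv) W ℓ

lemma eq_zero_of_forall_tensorInner {W : Submodule ℝ (Tensor3 T)} {v : Tensor3 T} (hv : v ∈ W)
    (h : ∀ k ∈ W, tensorInner v k = 0) : v = 0 :=
  eq_zero_of_tensorInner_self (h v hv)

/-- A criterion for irreducibility: the weight functional `ℓ` vanishes on no orbit, and the weight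
space of `ℓ` is at most two-dimensional and turned by `j`. -/
lemma isIrreducible_of_weight {W : Submodule ℝ (Tensor3 T)} (hW : IsInvariant F ξ W)
    (hne : W ≠ ⊥) (ℓ : Tensor3 T →ₗ[ℝ] ℝ) {j : T ≃ₗᵢ[ℝ] T} (hj : j ∈ structureGroup F ξ)
    (hjj : ∀ h ∈ W, ℓ (act j⁻¹ (act j⁻¹ h)) = -ℓ h) {ι : Type*} (r : ι → T ≃ₗᵢ[ℝ] T) (ε : ι → ℝ)
    (hr : ∀ i, r i ∈ structureGroup F ξ) (hε : ∀ i, ε i * ε i = 1)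
    (hrj : ∀ i, r i * j = j * r i) (hrℓ : ∀ i, ∀ h ∈ W, ℓ (act (r i)⁻¹ h) = ε i * ℓ h)
    (hA : ∀ h ∈ W, (∀ g ∈ structureGroup F ξ, ℓ (act g⁻¹ h) = 0) → h = 0)
    (hB : ∀ h ∈ W, (∀ i, act (r i)⁻¹ h = ε i • h) → ℓ h = 0 → ℓ (act j⁻¹ h) = 0 → h = 0) :
    IsIrreducible F ξ W := by
  refine ⟨hne, fun W' hW' hinv => ?_⟩
  -- `v` represents the functional `ℓ` on `W`, and `a` is the orthogonal projection of `v` to `W'`.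
  -- Invariance passes the weight of `ℓ` on to `v`, to `a` and to `b = v - a`.
  obtain ⟨v, hv, hvℓ⟩ := exists_tensorInner_eq W ℓ
  obtain ⟨a, ha, hav⟩ := exists_tensorInner_eq W' (tensorForm T v)
  simp only [tensorForm_apply] at hav
  have weight : ∀ i, ∀ k ∈ W, ℓ (act (r i) k) = ε i * ℓ k := fun i k hk => by
    have h1 := hrℓ i _ (hW _ (hr i) k hk)
    rw [act_inv_act] at h1
    linear_combination (-ε i) * h1 - ℓ (act (r i) k) * hε i
  have hrv : ∀ i, act (r i)⁻¹ v = ε i • v := fun i => by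
    refine sub_eq_zero.1 (eq_zero_of_forall_tensorInner (W := W) (sub_mem
      (hW _ (inv_mem (hr i)) v hv) (Submodule.smul_mem _ _ hv)) fun k hk => ?_)
    rw [tensorInner_sub_left, tensorInner_smul_left, tensorInner_act_left, inv_inv,
      hvℓ _ (hW _ (hr i) k hk), hvℓ k hk, weight i k hk, sub_self]
  have hra : ∀ i, act (r i)⁻¹ a = ε i • a := fun i => by
    refine sub_eq_zero.1 (eq_zero_of_forall_tensorInner (W := W') (sub_mem
      (hinv _ (inv_mem (hr i)) a ha) (Submodule.smul_mem _ _ ha)) fun k hk => ?_)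
    rw [tensorInner_sub_left, tensorInner_smul_left, tensorInner_act_left, inv_inv,
      hav _ (hinv _ (hr i) k hk), hav k hk, hvℓ _ (hW' (hinv _ (hr i) k hk)), hvℓ k (hW' hk),
      weight i k (hW' hk), sub_self]
  set b := v - a with hb
  have hbW : b ∈ W := sub_mem hv (hW' ha)
  have hrb : ∀ i, act (r i)⁻¹ b = ε i • b := fun i => by
    have : act (r i)⁻¹ b = act (r i)⁻¹ v - act (r i)⁻¹ a := map_sub (actₗ (r i)⁻¹) v a
    rw [this, hrv, hra, hb, smul_sub]
  have hb' : ∀ k ∈ W', tensorInner b k = 0 := fun k hk => by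
    rw [hb, tensorInner_sub_left, hav k hk, sub_self]
  have hja : act j⁻¹ a ∈ W' := hinv _ (inv_mem hj) a ha
  have hrja : ∀ i, act (r i)⁻¹ (act j⁻¹ a) = ε i • act j⁻¹ a := fun i => by
    rw [← act_mul, ← mul_inv_rev, ← hrj, mul_inv_rev, act_mul, hra, act_smul]
  -- If `a = 0`, then `ℓ` vanishes on `W'`, hence on the orbits of its elements. Otherwise `a` and
  -- `act j⁻¹ a` span the plane of this weight, and `W'` contains that plane.
  by_cases ha0 : a = 0
  · left
    refine (Submodule.eq_bot_iff _).2 fun h hh => hA h (hW' hh) fun g hg => ?_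
    have hgh := hinv _ (inv_mem hg) h hh
    rw [← hvℓ _ (hW' hgh), ← hav _ hgh, ha0]
    simp [tensorInner]
  · right
    refine le_antisymm hW' ?_
    have hD : ℓ a * ℓ a + ℓ (act j⁻¹ a) * ℓ (act j⁻¹ a) ≠ 0 := fun h0 => by
      have h1 : ℓ a = 0 := by nlinarith [mul_self_nonneg (ℓ a), mul_self_nonneg (ℓ (act j⁻¹ a))]
      have h2 : ℓ (act j⁻¹ a) = 0 := by
        nlinarith [mul_self_nonneg (ℓ a), mul_self_nonneg (ℓ (act j⁻¹ a))]
      exact ha0 (hB a (hW' ha) hra h1 h2)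
    set x := ℓ a
    set y := ℓ (act j⁻¹ a)
    set p := ℓ b with hp
    set q := ℓ (act j⁻¹ b) with hq
    -- Complex division: `c` and `d` solve `p = c x + d y` and `q = c y - d x`, so that `b - w` has
    -- both weight coordinates zero.
    set c := (p * x + q * y) / (x * x + y * y)
    set d := (p * y - q * x) / (x * x + y * y)
    set w := c • a + d • act j⁻¹ a with hw
    have hwW' : w ∈ W' := add_mem (Submodule.smul_mem _ _ ha) (Submodule.smul_mem _ _ hja)
    have hbw : b - w = 0 := by
      refine hB _ (sub_mem hbW (hW' hwW')) (fun i => ?_) ?_ ?_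
      · rw [← actₗ_apply, map_sub, hw, map_add, map_smul, map_smul]
        simp only [actₗ_apply, hrb, hra, hrja]
        module
      · rw [map_sub, hw, map_add, map_smul, map_smul]
        change p - (c * x + d * y) = 0
        rw [sub_eq_zero, div_mul_eq_mul_div, div_mul_eq_mul_div, ← add_div, eq_div_iff hD]
        ring
      · rw [← actₗ_apply, map_sub, hw, map_add, map_smul, map_smul, map_sub, map_add, map_smul,
          map_smul]
        simp only [actₗ_apply, hjj a (hW' ha)]
        change q - (c * y + d * -x) = 0
        rw [sub_eq_zero, div_mul_eq_mul_div, div_mul_eq_mul_div, ← add_div, eq_div_iff hD]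
        ring
    -- `b` equals `w ∈ W'` and is orthogonal to `W'`; hence `v = a` lies in `W'`.
    have hb0 : b = 0 := eq_zero_of_forall_tensorInner (W := W') (by
      rw [sub_eq_zero.1 hbw]; exact hwW') hb'
    have hvW' : v ∈ W' := by rw [sub_eq_zero.1 hb0]; exact ha
    intro k hk
    obtain ⟨k', hk', hkk'⟩ := exists_tensorInner_eq W' (tensorForm T k)
    -- `k'` is the projection of `k` to `W'`. As `W'` contains the orbit of `v`, the difference is
    -- orthogonal to it, so `ℓ` vanishes on the orbit of `k - k'`.
    have : k - k' = 0 := hA _ (sub_mem hk (hW' hk')) fun g hg => by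
      rw [← hvℓ _ (hW _ (inv_mem hg) _ (sub_mem hk (hW' hk'))), tensorInner_comm,
        tensorInner_act_left, inv_inv, tensorInner_sub_left, hkk' _ (hinv _ hg v hvW'),
        tensorForm_apply, sub_self]
    rw [sub_eq_zero.1 this]; exact hk'

end Criterion

end Irreducibility

/-! ### The criterion in unitary frames; linear and bilinear forms on `V` -/

section Weights

set_option maxSynthPendingDepth 3

variable {T : Type*} [NormedAddCommGroup T] [InnerProductSpace ℝ T] {F : T →ₗ[ℝ] T} {ξ : T}
  {n : ℕ} {e : Fin n → T}

lemma apply_turn {g : T ≃ₗᵢ[ℝ] T} (hg : g ∈ structureGroup F ξ) (z : Fin n → ℂ) (a : Fin n) :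
    g (turn F e z a) = turn F (fun b => g (e b)) z a := by
  simp only [turn, map_add, map_smul, hg.1]

lemma turn_turn (hS : IsAlmostContactMetric F ξ) (he : IsUnitaryFrame F ξ e) (z w : Fin n → ℂ) :
    turn F (turn F e z) w = turn F e (z * w) := by
  ext1 a
  simp only [turn, map_add, map_smul, he.map_map hS, Pi.mul_apply, Complex.mul_re, Complex.mul_im]
  module

/-- If the off-diagonal entries vanish in all frames, the rotated frame shows that the diagonal
entries at `a` and `b` agree. -/
lemma bilin_rotated (B : T →ₗ[ℝ] T →ₗ[ℝ] ℝ) {a b : Fin n} (hab : a ≠ b) :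
    B (rotated e a b a) (rotated e a b b) =
      1 / 2 * (B (e a) (e a) - B (e a) (e b) + B (e b) (e a) - B (e b) (e b)) := by
  have h2 : (√2)⁻¹ * (√2)⁻¹ = (1 / 2 : ℝ) := by
    rw [← mul_inv, Real.mul_self_sqrt (by norm_num)]; norm_num
  simp only [rotated, if_true, if_neg hab.symm, map_smul, map_add, map_sub,
    LinearMap.smul_apply, LinearMap.add_apply, smul_eq_mul]
  linear_combination
    (B (e a) (e a) - B (e a) (e b) + B (e b) (e a) - B (e b) (e b)) * h2

lemma rotated_of_ne {a b c : Fin n} (ha : c ≠ a) (hb : c ≠ b) : rotated e a b c = e c := by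
  simp [rotated, ha, hb]

lemma quarter_mul_self (i : Fin n) : quarter i * quarter i = flip i := by
  ext1 a
  by_cases h : a = i <;> simp [quarter, flip, h]

lemma exists_perm_three {i j k a b c : Fin n} (h1 : i ≠ j) (h2 : i ≠ k) (h3 : j ≠ k) (h4 : a ≠ b)
    (h5 : a ≠ c) (h6 : b ≠ c) : ∃ σ : Equiv.Perm (Fin n), σ i = a ∧ σ j = b ∧ σ k = c := by
  set σ := Equiv.swap i a
  set τ := Equiv.swap (σ j) b
  have hσ : σ i = a := Equiv.swap_apply_left _ _
  have hj : σ j ≠ a := fun h => h1 (σ.injective (hσ.trans h.symm))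
  have hτa : τ a = a := Equiv.swap_apply_of_ne_of_ne hj.symm h4
  have hτj : τ (σ j) = b := Equiv.swap_apply_left _ _
  have hk : τ (σ k) ≠ a := fun h => h2 (σ.injective (τ.injective (by rw [hσ, hτa, h])))
  have hk' : τ (σ k) ≠ b := fun h => h3 (σ.injective (τ.injective (by rw [hτj, h])))
  refine ⟨σ.trans (τ.trans (Equiv.swap (τ (σ k)) c)), ?_, ?_, ?_⟩
  · simp only [Equiv.trans_apply, hσ, hτa]
    exact Equiv.swap_apply_of_ne_of_ne hk.symm h5
  · simp only [Equiv.trans_apply, hτj]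
    exact Equiv.swap_apply_of_ne_of_ne hk'.symm h6
  · simp only [Equiv.trans_apply]
    exact Equiv.swap_apply_left _ _

lemma exists_perm_two {i j a b : Fin n} (h1 : i ≠ j) (h4 : a ≠ b) :
    ∃ σ : Equiv.Perm (Fin n), σ i = a ∧ σ j = b := by
  set σ := Equiv.swap i a
  have hσ : σ i = a := Equiv.swap_apply_left _ _
  have hj : σ j ≠ a := fun h => h1 (σ.injective (hσ.trans h.symm))
  refine ⟨σ.trans (Equiv.swap (σ j) b), ?_, ?_⟩
  · simp only [Equiv.trans_apply, hσ]
    exact Equiv.swap_apply_of_ne_of_ne hj.symm h4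
  · simp only [Equiv.trans_apply]
    exact Equiv.swap_apply_left _ _

lemma sgn_mul_self (i a : Fin n) : sgn i a * sgn i a = 1 := by
  unfold sgn; split_ifs <;> norm_num

lemma sgn_self (i : Fin n) : sgn i i = -1 := if_pos rfl

lemma sgn_of_ne {i a : Fin n} (h : a ≠ i) : sgn i a = 1 := if_neg h

variable [FiniteDimensional ℝ T] (hS : IsAlmostContactMetric F ξ)
  (hT : Module.finrank ℝ T = 2 * n + 1)

include hS hT

/-- Both maps are diagonal over the complex numbers in the frame `e`, and both fix `ξ`. -/
lemma IsUnitaryFrame.commute_of_turn (he : IsUnitaryFrame F ξ e) {g k : T ≃ₗᵢ[ℝ] T}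
    (hg : g ∈ structureGroup F ξ) (hk : k ∈ structureGroup F ξ) {z w : Fin n → ℂ}
    (hgz : ∀ a, g (e a) = ACM.turn F e z a) (hkw : ∀ a, k (e a) = ACM.turn F e w a) :
    g * k = k * g := by
  have h1 : ∀ a, g (k (e a)) = k (g (e a)) := fun a => by
    rw [hkw, hgz, apply_turn hg, apply_turn hk, funext hgz, funext hkw, turn_turn hS he,
      turn_turn hS he, mul_comm]
  have h2 := he.linearMap_eq_zero hS hT ((g * k).toLinearEquiv.toLinearMap -
    (k * g).toLinearEquiv.toLinearMap) (fun a => sub_eq_zero.2 (h1 a)) (fun a => sub_eq_zero.2 (by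
      change g (k (F (e a))) = k (g (F (e a)))
      rw [hk.1, hg.1, hg.1, hk.1, h1]))
  ext X
  rw [← hor_add_smul (ξ := ξ) X, map_add, map_add, map_smul, map_smul]
  congr 1
  · exact sub_eq_zero.1 (h2 _ (hS.hor_mem X))
  · change _ • g (k ξ) = _ • k (g ξ)
    rw [hg.2, hk.2, hg.2]

/-- The criterion for irreducibility, for functionals given by the components in a unitary frame
and for weights under the torus of this frame. -/
lemma IsUnitaryFrame.isIrreducible (he : IsUnitaryFrame F ξ e) {W : Submodule ℝ (Tensor3 T)}
    (hW : IsInvariant F ξ W) (hne : W ≠ ⊥) (Λ : (Fin n → T) → Tensor3 T →ₗ[ℝ] ℝ)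
    (hΛ : ∀ g ∈ structureGroup F ξ, ∀ e', IsUnitaryFrame F ξ e' → ∀ h,
      Λ e' (act g⁻¹ h) = Λ (fun a => g (e' a)) h)
    (j : Fin n) (hj : ∀ h ∈ W, Λ (ACM.turn F e (flip j)) h = -Λ e h)
    {ι : Type*} (z : ι → Fin n → ℂ) (hz : ∀ i a, Complex.normSq (z i a) = 1) (ε : ι → ℝ)
    (hε : ∀ i, ε i * ε i = 1) (hzΛ : ∀ i, ∀ h ∈ W, Λ (ACM.turn F e (z i)) h = ε i * Λ e h)
    (hA : ∀ h ∈ W, (∀ e' : Fin n → T, IsUnitaryFrame F ξ e' → Λ e' h = 0) → h = 0)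
    (hB : ∀ h ∈ W, (∀ i, ∃ r ∈ structureGroup F ξ, (∀ a, r (e a) = ACM.turn F e (z i) a) ∧
      act r⁻¹ h = ε i • h) → Λ e h = 0 → Λ (ACM.turn F e (quarter j)) h = 0 → h = 0) :
    IsIrreducible F ξ W := by
  obtain ⟨g, hg, hge⟩ := he.exists_mem_structureGroup hS hT (he.turn hS (normSq_quarter j))
  choose r hr hre using fun i => he.exists_mem_structureGroup hS hT (he.turn hS (hz i))
  refine isIrreducible_of_weight hW hne (Λ e) hg (fun h hh => ?_) r ε hr hε
    (fun i => he.commute_of_turn hS hT (hr i) hg (hre i) hge) (fun i h hh => ?_)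
    (fun h hh h0 => hA h hh fun e' he' => ?_) (fun h hh hr' h0 h1 => hB h hh
      (fun i => ⟨r i, hr i, hre i, hr' i⟩) h0 ?_)
  · rw [hΛ _ hg e he, funext hge, hΛ _ hg _ (he.turn hS (normSq_quarter j)), ← hj h hh]
    congr 2
    ext1 a
    rw [apply_turn hg, funext hge, turn_turn hS he, quarter_mul_self]
  · rw [hΛ _ (hr i) e he, funext (hre i), hzΛ i h hh]
  · obtain ⟨k, hk, hke⟩ := he.exists_mem_structureGroup hS hT he'
    rw [← h0 k hk, hΛ k hk e he, funext hke]
  · rwa [hΛ _ hg e he, funext hge] at h1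

/-- Irreducibility of a space of tensors that are determined by a form on `V`. -/
lemma isIrreducible_of_linear {W : Submodule ℝ (Tensor3 T)} (hW : IsInvariant F ξ W) (hne : W ≠ ⊥)
    (hn : 0 < n) (U : Tensor3 T →ₗ[ℝ] T →ₗ[ℝ] ℝ)
    (hU : ∀ g ∈ structureGroup F ξ, ∀ h, ∀ X ∈ V ξ, U (act g⁻¹ h) X = U h (g X))
    (h0 : ∀ h ∈ W, (∀ X ∈ V ξ, U h X = 0) → h = 0) : IsIrreducible F ξ W := by
  obtain ⟨e, he⟩ := hS.exists_frame hT
  set o : Fin n := ⟨0, hn⟩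
  refine he.isIrreducible hS hT hW hne (fun e' => (LinearMap.applyₗ (e' o)).comp U)
    (fun g hg e' he' h => hU g hg h _ (he'.mem o)) o (fun h _ => ?_) flip normSq_flip
    (fun i => sgn i o) (fun i => sgn_mul_self i o) (fun i h _ => ?_) (fun h hh hA => h0 h hh ?_)
    (fun h hh hr h1 h2 => h0 h hh ?_)
  · simp [turn_flip, sgn_self]
  · simp [turn_flip]
  · refine he.linearMap_eq_zero hS hT (U h) (fun a => ?_) (fun a => ?_)
    · simpa using hA _ (he.comp_perm (Equiv.swap o a))
    · simpa [turn_quarter_self] using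
        hA _ ((he.turn hS (normSq_quarter a)).comp_perm (Equiv.swap o a))
  · have h3 : ∀ a, a ≠ o → U h (e a) = 0 ∧ U h (F (e a)) = 0 := fun a ha => by
      obtain ⟨r, hr, hre, hrh⟩ := hr a
      have h4 := hU r hr h _ (he.mem a)
      have h5 := hU r hr h _ (hS.map_mem (e a))
      rw [hrh, sgn_of_ne ha.symm, one_smul] at h4 h5
      rw [hr.1, hre, turn_flip, sgn_self, map_smul, map_smul] at h5
      rw [hre, turn_flip, sgn_self, map_smul] at h4
      simp only [smul_eq_mul] at h4 h5
      constructor <;> linarith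
    refine he.linearMap_eq_zero hS hT (U h) (fun a => ?_) (fun a => ?_)
    · by_cases ha : a = o
      · simpa [ha] using h1
      · exact (h3 a ha).1
    · by_cases ha : a = o
      · simpa [ha, turn_quarter_self] using h2
      · exact (h3 a ha).2

/-- Irreducibility of a space of tensors that are determined by a bilinear form on `V` with
symmetries. -/
lemma isIrreducible_of_bilin {W : Submodule ℝ (Tensor3 T)} (hW : IsInvariant F ξ W) (hne : W ≠ ⊥)
    (hn : 2 ≤ n) (U : Tensor3 T →ₗ[ℝ] T →ₗ[ℝ] T →ₗ[ℝ] ℝ)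
    (hU : ∀ g ∈ structureGroup F ξ, ∀ h, ∀ X ∈ V ξ, ∀ Y ∈ V ξ, U (act g⁻¹ h) X Y = U h (g X) (g Y))
    (h0 : ∀ h ∈ W, (∀ X ∈ V ξ, ∀ Y ∈ V ξ, U h X Y = 0) → h = 0) {σ τ : ℝ}
    (hs : ∀ h ∈ W, ∀ X ∈ V ξ, ∀ Y ∈ V ξ, U h Y X = σ * U h X Y)
    (hF : ∀ h ∈ W, ∀ X ∈ V ξ, ∀ Y ∈ V ξ, U h (F X) (F Y) = τ * U h X Y)
    (htr : τ = -1 ∨ ∀ h ∈ W, ∀ e' : Fin n → T, IsUnitaryFrame F ξ e' →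
      ∑ a, U h (e' a) (e' a) = 0 ∧ ∑ a, U h (F (e' a)) (e' a) = 0) : IsIrreducible F ξ W := by
  obtain ⟨e, he⟩ := hS.exists_frame hT
  set o : Fin n := ⟨0, by omega⟩ with ho
  set o' : Fin n := ⟨1, by omega⟩ with ho'
  have hoo : o ≠ o' := by simp [ho, ho']
  refine he.isIrreducible hS hT hW hne
    (fun e' => (LinearMap.applyₗ (e' o')).comp ((LinearMap.applyₗ (e' o)).comp U))
    (fun g hg e' he' h => hU g hg h _ (he'.mem o) _ (he'.mem o')) o (fun h _ => ?_) flip normSq_flip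
    (fun i => sgn i o * sgn i o')
    (fun i => by rw [mul_mul_mul_comm, sgn_mul_self, sgn_mul_self, one_mul])
    (fun i h _ => ?_) (fun h hh hA => h0 h hh ?_) (fun h hh hr h1 h2 => h0 h hh ?_)
  · simp [turn_flip, sgn_self, sgn_of_ne hoo.symm]
  · simp [turn_flip, mul_assoc]; ring
  · simp only [LinearMap.comp_apply, LinearMap.applyₗ_apply_apply] at hA
    have off : ∀ e' : Fin n → T, IsUnitaryFrame F ξ e' → ∀ a b, a ≠ b → U h (e' a) (e' b) = 0 :=
      fun e' he' a b hab => by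
        obtain ⟨s, hs1, hs2⟩ := exists_perm_two hoo hab
        simpa [hs1, hs2] using hA _ (he'.comp_perm s)
    have off' : ∀ e' : Fin n → T, IsUnitaryFrame F ξ e' → ∀ a b, a ≠ b →
        U h (F (e' a)) (e' b) = 0 := fun e' he' a b hab => by
      simpa [turn_quarter_self, turn_quarter_of_ne hab.symm] using
        off _ (he'.turn hS (normSq_quarter a)) a b hab
    have hrot : ∀ e' : Fin n → T, IsUnitaryFrame F ξ e' → ∀ a b, a ≠ b →
        U h (e' a) (e' a) = U h (e' b) (e' b) ∧ U h (F (e' a)) (e' a) = U h (F (e' b)) (e' b) :=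
      fun e' he' a b hab => by
        have e1 := off _ (he'.rotated hab) a b hab
        have e2 := off' _ (he'.rotated hab) a b hab
        rw [bilin_rotated _ hab] at e1
        rw [show U h (F (rotated e' a b a)) (rotated e' a b b) =
          (U h).comp F (rotated e' a b a) (rotated e' a b b) from rfl, bilin_rotated _ hab] at e2
        simp only [LinearMap.comp_apply, off e' he' a b hab, off e' he' b a hab.symm,
          off' e' he' a b hab, off' e' he' b a hab.symm] at e1 e2
        constructor <;> linarith
    have diag : ∀ a, U h (e a) (e a) = 0 ∧ U h (F (e a)) (e a) = 0 := by
      -- By `hrot` all diagonal entries agree. If `τ = -1`, a quarter turn at `b` reverses the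
      -- entries at `b` only, so the common value is zero; otherwise it is zero because `n` times it
      -- is a trace.
      rcases htr with rfl | htr
      · intro a
        obtain ⟨b, hb⟩ : ∃ b, a ≠ b := by
          by_cases ha : a = o
          · exact ⟨o', by rwa [ha]⟩
          · exact ⟨o, ha⟩
        have e1 := hrot _ he a b hb
        have e2 := hrot _ (he.turn hS (normSq_quarter b)) a b hb
        rw [turn_quarter_self, turn_quarter_of_ne hb, hF h hh _ (he.mem b) _ (he.mem b),
          hF h hh _ (hS.map_mem _) _ (he.mem b)] at e2
        constructor <;> linarith
      · intro a
        have e1 : ∀ b, U h (e b) (e b) = U h (e a) (e a) := fun b => by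
          by_cases hab : b = a
          · rw [hab]
          · exact (hrot e he b a hab).1
        have e2 : ∀ b, U h (F (e b)) (e b) = U h (F (e a)) (e a) := fun b => by
          by_cases hab : b = a
          · rw [hab]
          · exact (hrot e he b a hab).2
        obtain ⟨e3, e4⟩ := htr h hh e he
        simp only [e1, e2, Finset.sum_const, Finset.card_univ, Fintype.card_fin, nsmul_eq_mul,
          mul_eq_zero, Nat.cast_eq_zero, show n ≠ 0 by omega, false_or] at e3 e4
        exact ⟨e3, e4⟩
    refine he.bilin_eq_zero hS hT (hF h hh) (fun a b => ?_) (fun a b => ?_)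
    · by_cases hab : a = b
      · rw [hab]; exact (diag b).1
      · exact off e he a b hab
    · by_cases hab : a = b
      · rw [hab]; exact (diag b).2
      · exact off' e he a b hab
  · simp only [LinearMap.comp_apply, LinearMap.applyₗ_apply_apply, turn_quarter_self,
      turn_quarter_of_ne hoo.symm] at h1 h2
    -- The sign changes at `o`, `o'`, `a` and `b` leave only entries whose index pair is `{o, o'}`.
    have key : ∀ x : Fin n → Fin n → ℝ,
        (∀ i a b, sgn i a * sgn i b * x a b = sgn i o * sgn i o' * x a b) → x o o' = 0 →
        x o' o = 0 → ∀ a b, x a b = 0 := fun x hx hx1 hx2 a b => by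
      have e1 := hx o a b
      have e2 := hx o' a b
      have e3 := hx a a b
      have e4 := hx b a b
      simp only [sgn] at e1 e2 e3 e4
      grind
    refine he.bilin_eq_zero hS hT (hF h hh) (key _ (fun i a b => ?_) h1 ?_)
      (key _ (fun i a b => ?_) h2 ?_)
    · obtain ⟨r, hr, hre, hrh⟩ := hr i
      have h4 := hU r hr h _ (he.mem a) _ (he.mem b)
      rw [hrh, hre, hre, turn_flip, turn_flip] at h4
      simp only [map_smul, LinearMap.smul_apply, smul_eq_mul] at h4
      linear_combination -h4
    · rw [hs h hh _ (he.mem o) _ (he.mem o'), h1, mul_zero]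
    · obtain ⟨r, hr, hre, hrh⟩ := hr i
      have h4 := hU r hr h _ (hS.map_mem (e a)) _ (he.mem b)
      rw [hrh, hr.1, hre, hre, turn_flip, turn_flip] at h4
      simp only [map_smul, LinearMap.smul_apply, smul_eq_mul] at h4
      linear_combination -h4
    · have e1 := hF h hh _ (hS.map_mem (e o)) _ (he.mem o')
      rw [h2, mul_zero, he.map_map hS, map_neg, LinearMap.neg_apply, neg_eq_zero] at e1
      rw [hs h hh _ (he.mem o) _ (hS.map_mem (e o')), e1, mul_zero]

end Weights

/-! ### Irreducibility of the first three subspaces -/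

section Trilinear

set_option maxSynthPendingDepth 3

variable {T : Type*} [NormedAddCommGroup T] [InnerProductSpace ℝ T]
  {F : T →ₗ[ℝ] T} {ξ : T} {n : ℕ} {e : Fin n → T}

/-- Polarization by a change of frame: vanishing of the diagonal entries in all frames makes the
form skew on the frame. -/
lemma bilin_rotated_self (B : T →ₗ[ℝ] T →ₗ[ℝ] ℝ) (a b : Fin n) :
    B (rotated e a b a) (rotated e a b a) =
      1 / 2 * (B (e a) (e a) + B (e a) (e b) + B (e b) (e a) + B (e b) (e b)) := by
  have h2 : (√2)⁻¹ * (√2)⁻¹ = (1 / 2 : ℝ) := by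
    rw [← mul_inv, Real.mul_self_sqrt (by norm_num)]; norm_num
  simp only [rotated, if_true, map_smul, map_add, LinearMap.smul_apply, LinearMap.add_apply,
    smul_eq_mul]
  linear_combination
    (B (e a) (e a) + B (e a) (e b) + B (e b) (e a) + B (e b) (e b)) * h2

lemma apply_eq_of_act_inv_eq {h : Tensor3 T} {r : T ≃ₗᵢ[ℝ] T} {c : ℝ} (hr : act r⁻¹ h = c • h)
    (X Y Z : T) : h (r X) (r Y) (r Z) = c * h X Y Z := by
  rw [← act_inv_apply, hr]; rfl

lemma apply_turn_of_act_inv_eq {h : Tensor3 T} {r : T ≃ₗᵢ[ℝ] T} {c : ℝ} {z : Fin n → ℂ}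
    (hr : r ∈ structureGroup F ξ) (hre : ∀ a, r (e a) = turn F e z a) (hrh : act r⁻¹ h = c • h)
    (a b d : Fin n) :
    h (turn F e z a) (turn F e z b) (turn F e z d) = c * h (e a) (e b) (e d) ∧
      h.comp F (turn F e z a) (turn F e z b) (turn F e z d) =
        c * h.comp F (e a) (e b) (e d) := by
  simp only [← hre, LinearMap.comp_apply, ← hr.1]
  exact ⟨apply_eq_of_act_inv_eq hrh _ _ _, apply_eq_of_act_inv_eq hrh _ _ _⟩

lemma apply_turn_flip (h : Tensor3 T) (i a b c : Fin n) :
    h (turn F e (flip i) a) (turn F e (flip i) b) (turn F e (flip i) c) =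
      sgn i a * sgn i b * sgn i c * h (e a) (e b) (e c) := by
  simp only [turn_flip, map_smul, LinearMap.smul_apply, smul_eq_mul]
  ring

section Indices

variable {x : Fin n → Fin n → Fin n → ℝ} {o o' o'' : Fin n}

/-- For `a < b < c` the sign changes at `a`, `b`, `c` force each of them to occur among `o, o',
o''`, so the entry is `x o o' o''` up to sign. -/
lemma eq_zero_of_weight_alternating (h1 : ∀ a b c, x a b c = -x a c b)
    (h2 : ∀ a b c, x a b c = -x b a c)
    (hx : ∀ i a b c, sgn i a * sgn i b * sgn i c * x a b c =
      sgn i o * sgn i o' * sgn i o'' * x a b c) (h0 : x o o' o'' = 0) (a b c : Fin n) :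
    x a b c = 0 := by
  refine eq_zero_of_alternating h1 h2 (fun a b c hab hbc => ?_) a b c
  have e1 := hx a a b c
  have e2 := hx b a b c
  have e3 := hx c a b c
  have h3 := h1 o o' o''
  have h4 := h2 o o' o''
  have h5 := h1 o' o o''
  have h6 := h2 o o'' o'
  have h7 := h1 o'' o o'
  simp only [sgn] at e1 e2 e3
  grind

/-- Sign changes see an index only modulo two, so they cannot separate `x o o o'` from `x i i o'`.
The hypothesis `hq` removes the latter. -/
lemma eq_zero_of_weight_double (h1 : ∀ a b c, x a b c = -x a c b)
    (hx : ∀ i a b c, sgn i a * sgn i b * sgn i c * x a b c = sgn i o' * x a b c)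
    (hq : ∀ i, i ≠ o → i ≠ o' → x i i o' = 0) (h0 : x o o o' = 0) (a b c : Fin n) :
    x a b c = 0 := by
  refine eq_zero_of_skew h1 (fun a b c hbc => ?_) a b c
  have e0 := hx o' a b c
  have e1 := hx a a b c
  have e2 := hx b a b c
  have e3 := hx c a b c
  have h3 := h1 o' o' o'
  have h4 := h1 a b c
  have h5 := hq a
  simp only [sgn] at e0 e1 e2 e3
  grind

/-- The sign changes leave the six permutations of `o, o', o''`; skewness in the last two slots
reduces these to the three choices of the first index. -/
lemma eq_zero_of_weight_distinct (h1 : ∀ a b c, x a b c = -x a c b) (h01 : o ≠ o')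
    (h02 : o ≠ o'') (h12 : o' ≠ o'')
    (hx : ∀ i a b c, sgn i a * sgn i b * sgn i c * x a b c =
      sgn i o * sgn i o' * sgn i o'' * x a b c) (h0 : x o o' o'' = 0) (h0' : x o' o o'' = 0)
    (h0'' : x o'' o o' = 0) (a b c : Fin n) :
    x a b c = 0 := by
  have e1 := hx a a b c
  have e2 := hx b a b c
  have e3 := hx c a b c
  have e4 := hx o a b c
  have e5 := hx o' a b c
  have h3 := h1 a b c
  simp only [sgn] at e1 e2 e3 e4 e5
  grind

end Indices

/-- The transfer of the vanishing of a component from all frames to all distinct indices. -/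
lemma distinct_eq_zero {o o' o'' : Fin n} (h01 : o ≠ o') (h02 : o ≠ o'') (h12 : o' ≠ o'')
    (hS : IsAlmostContactMetric F ξ) {h : Tensor3 T}
    (h0 : ∀ e' : Fin n → T, IsUnitaryFrame F ξ e' → h (e' o) (e' o') (e' o'') = 0)
    {e' : Fin n → T} (he' : IsUnitaryFrame F ξ e') {a b c : Fin n} (hab : a ≠ b) (hac : a ≠ c)
    (hbc : b ≠ c) : h (e' a) (e' b) (e' c) = 0 ∧ h.comp F (e' a) (e' b) (e' c) = 0 := by
  have key : ∀ e' : Fin n → T, IsUnitaryFrame F ξ e' → h (e' a) (e' b) (e' c) = 0 :=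
    fun e' he' => by
      obtain ⟨s, h1, h2, h3⟩ := exists_perm_three h01 h02 h12 hab hac hbc
      have := h0 _ (he'.comp_perm s)
      rwa [h1, h2, h3] at this
  refine ⟨key e' he', ?_⟩
  have := key _ (he'.turn hS (normSq_quarter a))
  rwa [turn_quarter_self, turn_quarter_of_ne hab.symm, turn_quarter_of_ne hac.symm] at this

/-- Polarizing the vanishing of entries with equal first indices makes `k` skew in the first two
slots on the frame. It is then totally skew, so its cyclic sum is three times itself. -/
lemma cyclic_eq_zero_of_double {k : Tensor3 T} (he : IsUnitaryFrame F ξ e)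
    (h1 : ∀ X Y Z, k X Y Z = -k X Z Y)
    (h2 : ∀ X ∈ V ξ, ∀ Y ∈ V ξ, ∀ Z ∈ V ξ, k X Y Z + k Y Z X + k Z X Y = 0)
    (h0 : ∀ e' : Fin n → T, IsUnitaryFrame F ξ e' → ∀ a b, a ≠ b → k (e' a) (e' a) (e' b) = 0)
    (a b c : Fin n) : k (e a) (e b) (e c) = 0 := by
  have h3 : ∀ a b, k (e a) (e a) (e b) = 0 := fun a b => by
    by_cases hab : a = b
    · rw [hab]; linarith [h1 (e b) (e b) (e b)]
    · exact h0 e he a b hab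
  have h4 : ∀ X Y, k X Y Y = 0 := fun X Y => by linarith [h1 X Y Y]
  have h5 : ∀ a b c, k (e a) (e b) (e c) = -k (e b) (e a) (e c) := fun a b c => by
    by_cases hab : a = b
    · rw [hab, h3]; simp
    by_cases hac : a = c
    · rw [← hac, h1, h3, h4]
    by_cases hbc : b = c
    · rw [← hbc, h4, h1, h3]; simp
    have e1 := h0 _ (he.rotated hab) a c hac
    rw [rotated_of_ne (Ne.symm hac) (Ne.symm hbc)] at e1
    have e2 := bilin_rotated_self (e := e) (k.compr₂ (LinearMap.applyₗ (e c))) a b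
    simp only [LinearMap.compr₂_apply, LinearMap.applyₗ_apply_apply] at e2
    rw [e1, h3, h3] at e2
    linarith
  linarith [h2 _ (he.mem a) _ (he.mem b) _ (he.mem c), h5 b c a, h1 (e c) (e b) (e a),
    h5 c a b, h1 (e a) (e c) (e b)]

/-- Rotating the frame in the plane of two indices shows that `k (e a) (e a) (e c)` is the same for
all `a ≠ c`. The trace is `n - 1` times this value. -/
lemma eq_zero_of_distinct_of_trace {k : Tensor3 T} (he : IsUnitaryFrame F ξ e) (hn : 2 ≤ n)
    (h1 : ∀ X Y Z, k X Y Z = -k X Z Y)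
    (h0 : ∀ e' : Fin n → T, IsUnitaryFrame F ξ e' → ∀ a b c, a ≠ b → a ≠ c → b ≠ c →
      k (e' a) (e' b) (e' c) = 0)
    (htr : ∀ c, ∑ a, k (e a) (e a) (e c) = 0) (a b c : Fin n) : k (e a) (e b) (e c) = 0 := by
  have h4 : ∀ X Y, k X Y Y = 0 := fun X Y => by linarith [h1 X Y Y]
  have h3 : ∀ a c, k (e a) (e a) (e c) = 0 := fun a c => by
    by_cases hac : a = c
    · rw [hac, h4]
    have h5 : ∀ b ∈ Finset.univ.erase c, k (e b) (e b) (e c) = k (e a) (e a) (e c) :=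
      fun b hb => by
        have hbc := Finset.ne_of_mem_erase hb
        by_cases hab : a = b
        · rw [hab]
        have e1 := h0 _ (he.rotated hab) a b c hab hac hbc
        rw [rotated_of_ne (Ne.symm hac) (Ne.symm hbc)] at e1
        have e2 := bilin_rotated (e := e) (k.compr₂ (LinearMap.applyₗ (e c))) hab
        simp only [LinearMap.compr₂_apply, LinearMap.applyₗ_apply_apply] at e2
        rw [e1, h0 e he a b c hab hac hbc, h0 e he b a c (Ne.symm hab) hbc hac] at e2
        linarith
    have h6 := htr c
    rw [← Finset.add_sum_erase _ _ (Finset.mem_univ c), h4, zero_add, Finset.sum_congr rfl h5,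
      Finset.sum_const, nsmul_eq_mul, mul_eq_zero, Finset.card_erase_of_mem (Finset.mem_univ c),
      Finset.card_univ, Fintype.card_fin, Nat.cast_eq_zero] at h6
    exact h6.resolve_left (by omega)
  by_cases hbc : b = c
  · rw [hbc, h4]
  by_cases hab : a = b
  · rw [hab, h3]
  by_cases hac : a = c
  · rw [hac, h1, h3, neg_zero]
  exact h0 e he a b c hab hac hbc

variable [FiniteDimensional ℝ T] (hS : IsAlmostContactMetric F ξ)
  (hT : Module.finrank ℝ T = 2 * n + 1)

lemma TbarSub_eq_zero_of_zeroVVV (hS : IsAlmostContactMetric F ξ) {i : Fin 12} (hi : i < 4)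
    {h : Tensor3 T} (hh : h ∈ TbarSub n F ξ i) (h0 : ZeroVVV ξ h) : h = 0 :=
  Tbar_eq_zero hS hh.1 h0 (TbarSub_zeroVVxi hh (Or.inl hi))
    (TbarSub_zeroXiVxi hh (by rintro rfl; exact absurd hi (by decide)))
    (TbarSub_zeroXiVV hh (by rintro rfl; exact absurd hi (by decide)))

omit [FiniteDimensional ℝ T] in
lemma comp_swap {h : Tensor3 T} (hh : h ∈ Tbar F ξ) (X Y Z : T) :
    h.comp F X Y Z = -h.comp F X Z Y := Tbar_swap hh (F X) Y Z

include hS hT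

lemma isIrreducible_TbarSub_zero (hn : 3 ≤ n) (hne : TbarSub n F ξ 0 ≠ ⊥) :
    IsIrreducible F ξ (TbarSub n F ξ 0) := by
  obtain ⟨e, he⟩ := hS.exists_frame hT
  set o : Fin n := ⟨0, by omega⟩ with ho
  set o' : Fin n := ⟨1, by omega⟩ with ho'
  set o'' : Fin n := ⟨2, by omega⟩ with ho''
  have h01 : o ≠ o' := by simp [ho, ho']
  have h02 : o ≠ o'' := by simp [ho, ho'']
  have h12 : o' ≠ o'' := by simp [ho', ho'']
  have hF := fun h (hh : h ∈ TbarSub n F ξ 0) => TbarSub_map_VVV_neg hS hh (Or.inl rfl)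
  have alt : ∀ h ∈ TbarSub n F ξ 0, (∀ a b c, h (e a) (e b) (e c) = -h (e b) (e a) (e c)) ∧
      ∀ a b c, h (F (e a)) (e b) (e c) = -h (F (e b)) (e a) (e c) := fun h hh =>
    ⟨fun a b c => hh.2.1 _ (he.mem a) _ (he.mem b) _ (he.mem c), fun a b c => by
      rw [map_left_eq_map_middle hS (hF h hh) (he.mem a) (he.mem b) (he.mem c),
        hh.2.1 _ (he.mem a) _ (hS.map_mem _) _ (he.mem c)]⟩
  have zero : ∀ h ∈ TbarSub n F ξ 0, (∀ a b c, h (e a) (e b) (e c) = 0) →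
      (∀ a b c, h (F (e a)) (e b) (e c) = 0) → h = 0 := fun h hh h1 h2 =>
    TbarSub_eq_zero_of_zeroVVV hS (by decide) hh (he.zeroVVV hS hT (τ := -1) hh.1
      (by simpa using hF h hh) h1 h2)
  refine he.isIrreducible hS hT (isInvariant_TbarSub hS hT 0) hne
    (fun e' => evalT (e' o) (e' o') (e' o''))
    (fun g _ e' _ h => act_inv_apply g h _ _ _) o (fun h _ => ?_) flip normSq_flip
    (fun i => sgn i o * sgn i o' * sgn i o'')
    (fun i => by
      rw [mul_mul_mul_comm, sgn_mul_self, mul_mul_mul_comm, sgn_mul_self, sgn_mul_self, one_mul,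
        one_mul])
    (fun i h _ => apply_turn_flip h i _ _ _) (fun h hh hA => ?_) (fun h hh hr h1 h2 => ?_)
  · refine (apply_turn_flip h o _ _ _).trans ?_
    rw [sgn_self, sgn_of_ne h01.symm, sgn_of_ne h02.symm, mul_one, mul_one, neg_one_mul]; rfl
  · exact zero h hh
      (eq_zero_of_alternating (fun a b c => Tbar_swap hh.1 _ _ _) (alt h hh).1 fun a b c hab hbc =>
        (distinct_eq_zero h01 h02 h12 hS hA he hab.ne (hab.trans hbc).ne hbc.ne).1)
      (eq_zero_of_alternating (fun a b c => Tbar_swap hh.1 _ _ _) (alt h hh).2 fun a b c hab hbc =>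
        (distinct_eq_zero h01 h02 h12 hS hA he hab.ne (hab.trans hbc).ne hbc.ne).2)
  · have h2' : h (F (e o)) (e o') (e o'') = 0 := by
      rwa [turn_quarter_self, turn_quarter_of_ne h01.symm, turn_quarter_of_ne h02.symm] at h2
    refine zero h hh
      (eq_zero_of_weight_alternating (fun a b c => Tbar_swap hh.1 _ _ _) (alt h hh).1
        (fun i a b c => ?_) h1)
      (eq_zero_of_weight_alternating (fun a b c => Tbar_swap hh.1 _ _ _) (alt h hh).2
        (fun i a b c => ?_) h2')
    all_goals
      obtain ⟨r, hr, hre, hrh⟩ := hr i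
      obtain ⟨e1, e2⟩ := apply_turn_of_act_inv_eq hr hre hrh a b c
      rw [apply_turn_flip] at e1 e2
    exacts [e1, e2]

/-- The functional has the repeated index `o` and the single index `o'`. The quarter turn `j` must
be at `o'`, since at `o` it would act by `i² = -1`. Quarter turns at the other indices belong to the
weight data as well, because sign changes alone leave too large a space. -/
lemma isIrreducible_TbarSub_one (hn : 2 ≤ n) (hne : TbarSub n F ξ 1 ≠ ⊥) :
    IsIrreducible F ξ (TbarSub n F ξ 1) := by
  obtain ⟨e, he⟩ := hS.exists_frame hT
  set o : Fin n := ⟨0, by omega⟩ with ho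
  set o' : Fin n := ⟨1, by omega⟩ with ho'
  have h01 : o ≠ o' := by simp [ho, ho']
  have hF := fun h (hh : h ∈ TbarSub n F ξ 1) => TbarSub_map_VVV_neg hS hh (Or.inr rfl)
  have zero : ∀ h ∈ TbarSub n F ξ 1, (∀ a b c, h (e a) (e b) (e c) = 0) →
      (∀ a b c, h.comp F (e a) (e b) (e c) = 0) → h = 0 := fun h hh h1 h2 =>
    TbarSub_eq_zero_of_zeroVVV hS (by decide) hh (he.zeroVVV hS hT (τ := -1) hh.1
      (by simpa using hF h hh) h1 h2)
  refine he.isIrreducible hS hT (isInvariant_TbarSub hS hT 1) hne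
    (fun e' => evalT (e' o) (e' o) (e' o'))
    (fun g _ e' _ h => act_inv_apply g h _ _ _) o' (fun h _ => ?_)
    (ι := Fin n ⊕ {i : Fin n // i ≠ o ∧ i ≠ o'}) (Sum.elim flip fun i => quarter i.1)
    (by rintro (i | i); exacts [normSq_flip i, normSq_quarter i.1])
    (Sum.elim (fun i => sgn i o') fun _ => 1)
    (by rintro (i | i); exacts [sgn_mul_self i o', one_mul 1])
    ?_ (fun h hh hA => ?_) (fun h hh hr h1 h2 => ?_)
  · refine (apply_turn_flip h o' _ _ _).trans ?_
    rw [sgn_self, sgn_of_ne h01, one_mul, one_mul, neg_one_mul]; rfl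
  · rintro (i | ⟨i, hi, hi'⟩) h hh
    · refine (apply_turn_flip h i _ _ _).trans ?_
      rw [sgn_mul_self, one_mul]; rfl
    · change h (turn F e (quarter i) o) (turn F e (quarter i) o) (turn F e (quarter i) o') = 1 * _
      rw [turn_quarter_of_ne hi.symm, turn_quarter_of_ne hi'.symm, one_mul]; rfl
  · have h3 : ∀ e' : Fin n → T, IsUnitaryFrame F ξ e' → ∀ a b, a ≠ b →
        h (e' a) (e' a) (e' b) = 0 := fun e' he' a b hab => by
      obtain ⟨s, hs1, hs2⟩ := exists_perm_two h01 hab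
      have : h (e' (s o)) (e' (s o)) (e' (s o')) = 0 := hA _ (he'.comp_perm s)
      rwa [hs1, hs2] at this
    refine zero h hh (cyclic_eq_zero_of_double he hh.1.1 hh.2.1 h3)
      (cyclic_eq_zero_of_double he (comp_swap hh.1) (fun X hX Y hY Z hZ => ?_)
        fun e' he' a b hab => ?_)
    · simp only [LinearMap.comp_apply]
      rw [map_left_eq_map_right hS hh.1 (hF h hh) hY hZ hX,
        map_left_eq_map_middle hS (hF h hh) hZ hX hY]
      exact hh.2.1 _ (hS.map_mem X) _ hY _ hZ
    · rw [LinearMap.comp_apply,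
        map_left_eq_map_right hS hh.1 (hF h hh) (he'.mem a) (he'.mem a) (he'.mem b)]
      have := h3 _ (he'.turn hS (normSq_quarter b)) a b hab
      rwa [turn_quarter_self, turn_quarter_of_ne hab] at this
  · have h2' : h.comp F (e o) (e o) (e o') = 0 := by
      rw [LinearMap.comp_apply,
        map_left_eq_map_right hS hh.1 (hF h hh) (he.mem o) (he.mem o) (he.mem o')]
      rwa [turn_quarter_self, turn_quarter_of_ne h01] at h2
    -- The quarter turn at `i` fixes `h` by its weight, yet multiplies these entries by `i² = -1`.
    have hq : ∀ i, i ≠ o → i ≠ o' → h (e i) (e i) (e o') = 0 ∧ h.comp F (e i) (e i) (e o') = 0 :=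
      fun i hi hi' => by
        obtain ⟨r, hr, hre, hrh⟩ := hr (Sum.inr ⟨i, hi, hi'⟩)
        obtain ⟨e1, e2⟩ := apply_turn_of_act_inv_eq hr hre hrh i i o'
        simp only [Sum.elim_inr, turn_quarter_self, turn_quarter_of_ne hi'.symm, one_mul,
          LinearMap.comp_apply] at e1 e2 ⊢
        rw [hF h hh _ (he.mem i) _ (he.mem i) _ (he.mem o')] at e1
        rw [hF h hh _ (hS.map_mem (e i)) _ (he.mem i) _ (he.mem o')] at e2
        constructor <;> linarith
    refine zero h hh
      (eq_zero_of_weight_double (fun a b c => Tbar_swap hh.1 _ _ _) (fun i a b c => ?_)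
        (fun i hi hi' => (hq i hi hi').1) h1)
      (eq_zero_of_weight_double (fun a b c => comp_swap hh.1 _ _ _) (fun i a b c => ?_)
        (fun i hi hi' => (hq i hi hi').2) h2')
    all_goals
      obtain ⟨r, hr, hre, hrh⟩ := hr (Sum.inl i)
      obtain ⟨e1, e2⟩ := apply_turn_of_act_inv_eq hr hre hrh a b c
      simp only [Sum.elim_inl] at e1 e2
      rw [apply_turn_flip] at e1 e2
    exacts [e1, e2]

/-- On `V` these tensors are complex antilinear in the first slot and linear in the others.
Simultaneous quarter turns at `o` and one further index therefore detect which index stands first: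
they fix the chosen entry and reverse one of its two competitors each. -/
lemma isIrreducible_TbarSub_two (hn : 3 ≤ n) (hne : TbarSub n F ξ 2 ≠ ⊥) :
    IsIrreducible F ξ (TbarSub n F ξ 2) := by
  obtain ⟨e, he⟩ := hS.exists_frame hT
  set o : Fin n := ⟨0, by omega⟩ with ho
  set o' : Fin n := ⟨1, by omega⟩ with ho'
  set o'' : Fin n := ⟨2, by omega⟩ with ho''
  have h01 : o ≠ o' := by simp [ho, ho']
  have h02 : o ≠ o'' := by simp [ho, ho'']
  have h12 : o' ≠ o'' := by simp [ho', ho'']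
  have hF := fun h (hh : h ∈ TbarSub n F ξ 2) => TbarSub_map_VVV hS hh (Or.inl rfl)
  have hF' : ∀ h ∈ TbarSub n F ξ 2, ∀ X ∈ V ξ, ∀ Y ∈ V ξ, ∀ Z ∈ V ξ,
      h (F X) Y Z = -h X Y (F Z) := fun h hh X hX Y hY Z hZ => by
    have := hF h hh _ hX _ (hS.map_mem Y) _ hZ
    rw [hS.sq_eq_neg _ hY, map_neg, LinearMap.neg_apply, Tbar_map_left hh.1 hS _ hY hZ] at this
    linarith
  have zero : ∀ h ∈ TbarSub n F ξ 2, (∀ a b c, h (e a) (e b) (e c) = 0) →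
      (∀ a b c, h.comp F (e a) (e b) (e c) = 0) → h = 0 := fun h hh h1 h2 =>
    TbarSub_eq_zero_of_zeroVVV hS (by decide) hh (he.zeroVVV hS hT (τ := 1) hh.1
      (by simpa using hF h hh) h1 h2)
  have q01 : ∀ a, turn F e (quarter o * quarter o') a =
      if a = o ∨ a = o' then F (e a) else e a := fun a => by
    by_cases h1 : a = o
    · subst h1; simp [turn, quarter, h01]
    · by_cases h2 : a = o'
      · subst h2; simp [turn, quarter, h1]
      · simp [turn, quarter, h1, h2]
  have q02 : ∀ a, turn F e (quarter o * quarter o'') a =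
      if a = o ∨ a = o'' then F (e a) else e a := fun a => by
    by_cases h1 : a = o
    · subst h1; simp [turn, quarter, h02]
    · by_cases h2 : a = o''
      · subst h2; simp [turn, quarter, h1]
      · simp [turn, quarter, h1, h2]
  refine he.isIrreducible hS hT (isInvariant_TbarSub hS hT 2) hne
    (fun e' => evalT (e' o) (e' o') (e' o''))
    (fun g _ e' _ h => act_inv_apply g h _ _ _) o (fun h _ => ?_)
    (ι := Fin n ⊕ Bool)
    (Sum.elim flip fun b => quarter o * if b then quarter o' else quarter o'')
    ?_
    (Sum.elim (fun i => sgn i o * sgn i o' * sgn i o'') fun _ => 1)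
    ?_ ?_ (fun h hh hA => ?_) (fun h hh hr h1 h2 => ?_)
  · refine (apply_turn_flip h o _ _ _).trans ?_
    rw [sgn_self, sgn_of_ne h01.symm, sgn_of_ne h02.symm, mul_one, mul_one, neg_one_mul]; rfl
  · rintro (i | _ | _) a
    · exact normSq_flip i a
    all_goals simp [normSq_quarter]
  · rintro (i | i)
    · simp only [Sum.elim_inl]
      rw [mul_mul_mul_comm, sgn_mul_self, mul_mul_mul_comm, sgn_mul_self, sgn_mul_self, one_mul,
        one_mul]
    · exact one_mul 1
  · rintro (i | _ | _) h hh
    · exact apply_turn_flip h i _ _ _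
    · change h (turn F e (quarter o * quarter o'') o) (turn F e (quarter o * quarter o'') o')
        (turn F e (quarter o * quarter o'') o'') = 1 * h (e o) (e o') (e o'')
      simp only [q02, true_or, or_true, if_true, h01.symm, h12, or_self, if_false]
      rw [hF' h hh _ (he.mem o) _ (he.mem o') _ (hS.map_mem _), he.map_map hS, map_neg]; ring
    · change h (turn F e (quarter o * quarter o') o) (turn F e (quarter o * quarter o') o')
        (turn F e (quarter o * quarter o') o'') = 1 * h (e o) (e o') (e o'')
      simp only [q01, true_or, or_true, if_true, h02.symm, h12.symm, or_self, if_false]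
      rw [hF h hh _ (he.mem o) _ (he.mem o') _ (he.mem o'')]; ring
  · have tr : ∀ Z ∈ V ξ, ∑ a, h (e a) (e a) Z = 0 := fun Z hZ => by
      have := hh.2.2.1 Z hZ
      rw [he.beta_eq hS hT] at this
      simp only [hF h hh _ (he.mem _) _ (he.mem _) _ hZ, ← two_mul, ← Finset.mul_sum] at this
      linarith
    refine zero h hh (eq_zero_of_distinct_of_trace he (by omega) hh.1.1
      (fun e' he' a b c hab hac hbc => (distinct_eq_zero h01 h02 h12 hS hA he' hab hac hbc).1)
      fun c => tr _ (he.mem c))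
      (eq_zero_of_distinct_of_trace he (by omega) (comp_swap hh.1)
      (fun e' he' a b c hab hac hbc => (distinct_eq_zero h01 h02 h12 hS hA he' hab hac hbc).2)
      fun c => ?_)
    simp only [LinearMap.comp_apply, hF' h hh _ (he.mem _) _ (he.mem _) _ (he.mem c),
      Finset.sum_neg_distrib, tr _ (hS.map_mem (e c)), neg_zero]
  · have h2' : h.comp F (e o) (e o') (e o'') = 0 := by
      rwa [turn_quarter_self, turn_quarter_of_ne h01.symm, turn_quarter_of_ne h02.symm] at h2
    have p1 : h (e o') (e o) (e o'') = 0 ∧ h.comp F (e o') (e o) (e o'') = 0 := by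
      obtain ⟨r, hr, hre, hrh⟩ := hr (Sum.inr false)
      obtain ⟨e1, e2⟩ := apply_turn_of_act_inv_eq hr hre hrh o' o o''
      simp only [Sum.elim_inr, Bool.false_eq_true, q02, true_or, or_true, if_true, h01.symm, h12,
        or_self, if_false, one_mul, LinearMap.comp_apply] at e1 e2 ⊢
      rw [Tbar_map_map hh.1 _ (he.mem o) (he.mem o'')] at e1 e2
      constructor <;> linarith
    have p2 : h (e o'') (e o) (e o') = 0 ∧ h.comp F (e o'') (e o) (e o') = 0 := by
      obtain ⟨r, hr, hre, hrh⟩ := hr (Sum.inr true)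
      obtain ⟨e1, e2⟩ := apply_turn_of_act_inv_eq hr hre hrh o'' o o'
      simp only [Sum.elim_inr, q01, true_or, or_true, if_true, h02.symm, h12.symm,
        or_self, if_false, one_mul, LinearMap.comp_apply] at e1 e2 ⊢
      rw [Tbar_map_map hh.1 _ (he.mem o) (he.mem o')] at e1 e2
      constructor <;> linarith
    refine zero h hh
      (eq_zero_of_weight_distinct (fun a b c => Tbar_swap hh.1 _ _ _) h01 h02 h12
        (fun i a b c => ?_) h1 p1.1 p2.1)
      (eq_zero_of_weight_distinct (fun a b c => comp_swap hh.1 _ _ _) h01 h02 h12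
        (fun i a b c => ?_) h2' p1.2 p2.2)
    all_goals
      obtain ⟨r, hr, hre, hrh⟩ := hr (Sum.inl i)
      obtain ⟨e1, e2⟩ := apply_turn_of_act_inv_eq hr hre hrh a b c
      simp only [Sum.elim_inl] at e1 e2
      rw [apply_turn_flip] at e1 e2
    exacts [e1, e2]

end Trilinear

/-! ### Irreducibility of all summands and the classes of tensors -/

section Decomposition

set_option maxSynthPendingDepth 3

variable {T : Type*} [NormedAddCommGroup T] [InnerProductSpace ℝ T] [FiniteDimensional ℝ T]
  {F : T →ₗ[ℝ] T} {ξ : T} {n : ℕ}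

lemma tableDim_ne_zero (hn : 3 ≤ n) (i : Fin 12) : tableDim n i ≠ 0 := by
  -- With `n = 3 + m` all factors are visibly positive, in particular the factor `n - 2`.
  obtain ⟨m, rfl⟩ := Nat.exists_eq_add_of_le hn
  have h1 : ((3 + m : ℕ) : ℚ) - 1 = m + 2 := by push_cast; ring
  have h2 : ((3 + m : ℕ) : ℚ) - 2 = m + 1 := by push_cast; ring
  have h3 : ((3 + m : ℕ) : ℚ) ^ 2 - 1 = (m + 2) * (m + 4) := by push_cast; ring
  have h4 : ((3 + m : ℕ) : ℚ) ^ 2 - (3 + m : ℕ) = (m + 2) * (m + 3) := by push_cast; ring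
  match i with
  | 0 | 1 | 2 | 3 | 4 | 5 | 6 | 7 | 8 | 9 | 10 | 11 =>
    simp only [tableDim, h1, h2, h3, h4]; positivity

variable (hS : IsAlmostContactMetric F ξ) (hT : Module.finrank ℝ T = 2 * n + 1)

include hS hT

lemma TbarSub_ne_bot (hn : 3 ≤ n) (i : Fin 12) : TbarSub n F ξ i ≠ ⊥ := fun h => by
  refine tableDim_ne_zero hn i ?_
  rw [← (finrank_TbarSub_and_Tbar hS hT (by omega)).1 i, h, finrank_bot, Nat.cast_zero]

/-- These are the two real parts of a complex trace: one vanishes by skewness or symmetry of the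
form, the other is a multiple of `betaBar` or `beta` at `ξ`. -/
lemma sum_TbarSub_map_eq_zero {i : Fin 12} {h : Tensor3 T} (hh : h ∈ TbarSub n F ξ i)
    (hi : i = 4 ∨ i = 7) {e : Fin n → T} (he : IsUnitaryFrame F ξ e) :
    ∑ a, formXi ξ h (e a) (e a) = 0 ∧ ∑ a, formXi ξ h (F (e a)) (e a) = 0 := by
  have hF := TbarSub_map_eq hh hS (by tauto)
  have hF' : ∀ a, h (e a) (F (e a)) ξ = -h (F (e a)) (e a) ξ := fun a => by
    have := hF _ (he.mem a) _ (hS.map_mem (e a))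
    rw [he.map_map hS, map_neg, LinearMap.neg_apply] at this
    linarith
  simp only [formXi_apply]
  rcases hi with rfl | rfl
  · have hs := TbarSub_skew hh hS (Or.inl rfl)
    refine ⟨Finset.sum_eq_zero fun a _ => by linarith [hs _ (he.mem a) _ (he.mem a)], ?_⟩
    have := hh.2.2.2.1
    rw [he.betaBar_eq hS hT] at this
    simp only [hF', ← neg_add', ← two_mul, Finset.sum_neg_distrib, ← Finset.mul_sum] at this
    linarith
  · have hs := TbarSub_symm hh (Or.inl rfl)
    refine ⟨?_, Finset.sum_eq_zero fun a _ => by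
      linarith [hs _ (he.mem a) _ (hS.map_mem (e a)), hF' a]⟩
    have := hh.2.2.2.1
    rw [he.beta_eq hS hT] at this
    simp only [hF _ (he.mem _) _ (he.mem _), ← two_mul, ← Finset.mul_sum] at this
    linarith

lemma isIrreducible_TbarSub_of_formXi (hn : 3 ≤ n) {i : Fin 12}
    (hi : i = 4 ∨ i = 5 ∨ i = 7 ∨ i = 8) : IsIrreducible F ξ (TbarSub n F ξ i) := by
  have hi4 : 4 ≤ i := by rcases hi with rfl | rfl | rfl | rfl <;> decide
  have hi10 : i < 10 := by rcases hi with rfl | rfl | rfl | rfl <;> decide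
  have hU : ∀ g ∈ structureGroup F ξ, ∀ h, ∀ X ∈ V ξ, ∀ Y ∈ V ξ,
      formXi ξ (act g⁻¹ h) X Y = formXi ξ h (g X) (g Y) := fun g hg h X _ Y _ => by
    simp only [formXi_apply]
    rw [act_inv_apply, hg.2]
  have h0 : ∀ h ∈ TbarSub n F ξ i, (∀ X ∈ V ξ, ∀ Y ∈ V ξ, formXi ξ h X Y = 0) → h = 0 :=
    fun h hh => TbarSub_eq_zero_of_formXi hS hi4 hi10 hi4 hi10 (by rwa [sup_idem])
  have hW := isInvariant_TbarSub hS hT i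
  have hne := TbarSub_ne_bot hS hT hn i
  rcases hi with rfl | rfl | rfl | rfl
  · exact isIrreducible_of_bilin hS hT hW hne (by omega) (formXi ξ) hU h0 (σ := -1) (τ := 1)
      (fun h hh X hX Y hY => by simpa using TbarSub_skew hh hS (Or.inl rfl) X hX Y hY)
      (fun h hh X hX Y hY => by simpa using TbarSub_map_eq hh hS (Or.inl rfl) X hX Y hY)
      (Or.inr fun h hh e he => sum_TbarSub_map_eq_zero hS hT hh (Or.inl rfl) he)
  · exact isIrreducible_of_bilin hS hT hW hne (by omega) (formXi ξ) hU h0 (σ := -1) (τ := -1)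
      (fun h hh X hX Y hY => by simpa using TbarSub_skew hh hS (by tauto) X hX Y hY)
      (fun h hh X hX Y hY => by simpa using TbarSub_map_eq_neg hh (Or.inl rfl) X hX Y hY)
      (Or.inl rfl)
  · exact isIrreducible_of_bilin hS hT hW hne (by omega) (formXi ξ) hU h0 (σ := 1) (τ := 1)
      (fun h hh X hX Y hY => by simpa using TbarSub_symm hh (Or.inl rfl) X hX Y hY)
      (fun h hh X hX Y hY => by simpa using TbarSub_map_eq hh hS (by tauto) X hX Y hY)
      (Or.inr fun h hh e he => sum_TbarSub_map_eq_zero hS hT hh (Or.inr rfl) he)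
  · exact isIrreducible_of_bilin hS hT hW hne (by omega) (formXi ξ) hU h0 (σ := 1) (τ := -1)
      (fun h hh X hX Y hY => by simpa using TbarSub_symm hh (by tauto) X hX Y hY)
      (fun h hh X hX Y hY => by simpa using TbarSub_map_eq_neg hh (Or.inr rfl) X hX Y hY)
      (Or.inl rfl)

lemma isIrreducible_TbarSub_of_tableDim (hn : 3 ≤ n) {i : Fin 12} (hi : tableDim n i = 1) :
    IsIrreducible F ξ (TbarSub n F ξ i) := by
  refine ⟨TbarSub_ne_bot hS hT hn i, fun W hW _ => ?_⟩
  have h1 : Module.finrank ℝ (TbarSub n F ξ i) = 1 := by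
    have := (finrank_TbarSub_and_Tbar hS hT (by omega)).1 i
    rw [hi] at this
    exact_mod_cast this
  rcases Nat.eq_zero_or_pos (Module.finrank ℝ W) with h2 | h2
  · exact Or.inl (Submodule.finrank_eq_zero.1 h2)
  · exact Or.inr (Submodule.eq_of_le_of_finrank_le hW (by omega))

/-- The trace form `β`, as a linear function of the tensor. -/
def betaMap (ξ : T) : Tensor3 T →ₗ[ℝ] T →ₗ[ℝ] ℝ where
  toFun h := betaₗ ξ h
  map_add' h k := by ext X; exact beta_add ξ h k X
  map_smul' c h := by ext X; exact beta_smul ξ c h X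

/-- The form `h_{ξXξ}`, as a linear function of the tensor. -/
def formXiXi (ξ : T) : Tensor3 T →ₗ[ℝ] T →ₗ[ℝ] ℝ where
  toFun h := (h ξ).flip ξ
  map_add' _ _ := rfl
  map_smul' _ _ := rfl

lemma isIrreducible_TbarSub_three (hn : 3 ≤ n) : IsIrreducible F ξ (TbarSub n F ξ 3) := by
  refine isIrreducible_of_linear hS hT (isInvariant_TbarSub hS hT 3) (TbarSub_ne_bot hS hT hn 3)
    (by omega) (betaMap ξ) (fun g hg h X _ => ?_) fun h hh h0 => ?_
  · exact (beta_act hS hT (inv_mem hg) h X).trans (by rw [inv_inv]; rfl)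
  · have h1 : ∀ X ∈ V ξ, beta ξ h X = 0 := h0
    refine TbarSub_eq_zero_of_zeroVVV hS (by decide) hh fun X hX Y hY Z hZ => ?_
    rw [hh.2.1 X hX Y hY Z hZ, h1 _ hY, h1 _ hZ, h1 _ (hS.map_mem Y), h1 _ (hS.map_mem Z)]
    ring

lemma isIrreducible_TbarSub_ten (hn : 3 ≤ n) : IsIrreducible F ξ (TbarSub n F ξ 10) := by
  refine isIrreducible_of_linear hS hT (isInvariant_TbarSub hS hT 10) (TbarSub_ne_bot hS hT hn 10)
    (by omega) (formXiXi ξ) (fun g hg h X _ => ?_) fun h hh h0 => ?_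
  · change act g⁻¹ h ξ X ξ = h ξ (g X) ξ
    rw [act_inv_apply, hg.2]
  · exact Tbar_eq_zero hS hh.1 hh.2.1 hh.2.2.1 h0 hh.2.2.2

lemma isIrreducible_TbarSub_eleven (hn : 3 ≤ n) : IsIrreducible F ξ (TbarSub n F ξ 11) := by
  refine isIrreducible_of_bilin hS hT (isInvariant_TbarSub hS hT 11) (TbarSub_ne_bot hS hT hn 11)
    (by omega) (LinearMap.applyₗ ξ) (fun g hg h X _ Y _ => ?_) (fun h hh h0 => ?_) (σ := -1)
    (τ := -1) (fun h hh X _ Y _ => ?_) (fun h hh X hX Y hY => ?_) (Or.inl rfl)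
  · change act g⁻¹ h ξ X Y = h ξ (g X) (g Y)
    rw [act_inv_apply, hg.2]
  · exact Tbar_eq_zero hS hh.1 hh.2.2.2.1 hh.2.2.2.2.1 hh.2.2.2.2.2 h0
  · simpa using Tbar_swap hh.1 ξ Y X
  · simpa using Tbar_map_map hh.1 ξ hX hY

lemma isIrreducible_TbarSub (hn : 3 ≤ n) (i : Fin 12) : IsIrreducible F ξ (TbarSub n F ξ i) := by
  match i with
  | 0 => exact isIrreducible_TbarSub_zero hS hT hn (TbarSub_ne_bot hS hT hn 0)
  | 1 => exact isIrreducible_TbarSub_one hS hT (by omega) (TbarSub_ne_bot hS hT hn 1)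
  | 2 => exact isIrreducible_TbarSub_two hS hT hn (TbarSub_ne_bot hS hT hn 2)
  | 3 => exact isIrreducible_TbarSub_three hS hT hn
  | 4 => exact isIrreducible_TbarSub_of_formXi hS hT hn (by decide)
  | 5 => exact isIrreducible_TbarSub_of_formXi hS hT hn (by decide)
  | 6 => exact isIrreducible_TbarSub_of_tableDim hS hT hn rfl
  | 7 => exact isIrreducible_TbarSub_of_formXi hS hT hn (by decide)
  | 8 => exact isIrreducible_TbarSub_of_formXi hS hT hn (by decide)
  | 9 => exact isIrreducible_TbarSub_of_tableDim hS hT hn rfl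
  | 10 => exact isIrreducible_TbarSub_ten hS hT hn
  | 11 => exact isIrreducible_TbarSub_eleven hS hT hn

lemma isInvariant_TbarClass (α : Finset (Fin 12)) : IsInvariant F ξ (TbarClass n F ξ α) := by
  intro g hg
  have : TbarClass n F ξ α ≤ (TbarClass n F ξ α).comap (actₗ g) :=
    iSup₂_le fun i hi h hh => (le_iSup₂ (f := fun i (_ : i ∈ α) => TbarSub n F ξ i) i hi)
      (isInvariant_TbarSub hS hT i g hg h hh)
  exact fun h hh => this hh

/-- If an index of one set were missing from a larger class, its nonzero summand would lie in the
sum of the others, against independence. -/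
lemma TbarClass_injective (hn : 3 ≤ n) : Function.Injective (TbarClass n F ξ) := by
  have key : ∀ α γ, TbarClass n F ξ α ≤ TbarClass n F ξ γ → α ⊆ γ := fun α γ h i hi => by
    by_contra hiγ
    have h1 : TbarSub n F ξ i ≤ TbarClass n F ξ γ :=
      (le_iSup₂ (f := fun i (_ : i ∈ α) => TbarSub n F ξ i) i hi).trans h
    have h2 : TbarClass n F ξ γ ≤ ⨆ (j) (_ : j ≠ i), TbarSub n F ξ j :=
      iSup₂_le fun j hj => le_iSup₂ (f := fun j (_ : j ≠ i) => TbarSub n F ξ j) j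
        (fun hji => hiγ (hji ▸ hj))
    exact TbarSub_ne_bot hS hT hn i
      (disjoint_self.1 ((iSupIndep_TbarSub hS hT i).mono_right (h1.trans h2)))
  exact fun α γ h => (key α γ h.le).antisymm (key γ α h.ge)

lemma ncard_range_TbarClass (hn : 3 ≤ n) : (Set.range (TbarClass n F ξ)).ncard = 2 ^ 12 := by
  rw [← Set.image_univ, Set.ncard_image_of_injective _ (TbarClass_injective hS hT hn),
    Set.ncard_univ, Nat.card_eq_fintype_card, Fintype.card_finset, Fintype.card_fin]

/-- The subspace `T̄_α` is cut out of `T̄(T)` by the orthogonality to the other subspaces. -/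
lemma mem_TbarClass_iff (hn : 2 ≤ n) (α : Finset (Fin 12)) {h : Tensor3 T} (hh : h ∈ Tbar F ξ) :
    h ∈ TbarClass n F ξ α ↔ ∀ i ∉ α, ∀ k ∈ TbarSub n F ξ i, tensorInner h k = 0 := by
  constructor
  · intro hα i hi k hk
    have : TbarClass n F ξ α ≤ LinearMap.ker ((tensorForm T).flip k) :=
      iSup₂_le fun j hj l hl =>
        tensorInner_TbarSub hS hT (ne_of_mem_of_not_mem hj hi) hl hk
    exact this hα
  · intro h0
    rw [← iSup_TbarSub hS hT hn, Submodule.mem_iSup_iff_exists_finsupp] at hh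
    obtain ⟨f, hf, rfl⟩ := hh
    refine Submodule.sum_mem _ fun i hi => ?_
    by_cases hiα : i ∈ α
    · exact (le_iSup₂ (f := fun i (_ : i ∈ α) => TbarSub n F ξ i) i hiα) (hf i)
    · have h1 := h0 i hiα (f i) (hf i)
      have h2 : tensorInner (∑ j ∈ f.support, f j) (f i) = ∑ j ∈ f.support,
          tensorInner (f j) (f i) := LinearMap.map_sum₂ (tensorForm T) _ _ _
      rw [Finsupp.sum, h2, Finset.sum_eq_single_of_mem i hi
        fun j _ hj => tensorInner_TbarSub hS hT hj (hf j) (hf i)] at h1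
      change f i ∈ _
      rw [eq_zero_of_tensorInner_self h1]
      exact zero_mem _

end Decomposition

/-! ### The second fundamental tensor of a structure on a manifold -/

section Connection

variable {n : ℕ} {M : Type*} [TopologicalSpace M]
  [ChartedSpace (EuclideanSpace ℝ (Fin (2 * n + 1))) M] [IsManifold (𝓡 (2 * n + 1)) ∞ M]

/-- The field `Y` of tangent vectors is differentiable at `p`. -/
abbrev DiffAt (Y : ∀ x : M, TangentSpace (𝓡 (2 * n + 1)) x) (p : M) : Prop :=
  MDifferentiableAt (𝓡 (2 * n + 1)) (𝓡 (2 * n + 1)).tangent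
    (fun x => (⟨x, Y x⟩ : TangentBundle (𝓡 (2 * n + 1)) M)) p

variable [RiemannianBundle (fun x : M => TangentSpace (𝓡 (2 * n + 1)) x)]

namespace AlmostContactMetricStructure

variable (S : AlmostContactMetricStructure n M)
  (cov : CovariantDerivative (𝓡 (2 * n + 1)) (EuclideanSpace ℝ (Fin (2 * n + 1)))
      (TangentSpace (𝓡 (2 * n + 1)) : M → Type _))

/-- The field `F Y`. -/
def mapField (Y : ∀ x : M, TangentSpace (𝓡 (2 * n + 1)) x) (x : M) :
    TangentSpace (𝓡 (2 * n + 1)) x :=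
  S.F x (Y x)

variable {S} {Y Z : ∀ x : M, TangentSpace (𝓡 (2 * n + 1)) x} {p : M}

lemma map_map_map (x : M) (v : TangentSpace (𝓡 (2 * n + 1)) x) :
    S.F x (S.F x (S.F x v)) = -S.F x v :=
  (S.isAlmostContactMetric x).sq_eq_neg _ ((S.isAlmostContactMetric x).map_mem v)

lemma mapField_mapField_mapField :
    S.mapField (S.mapField (S.mapField Y)) = (-1 : ℝ) • S.mapField Y := by
  ext1 x
  exact (map_map_map x _).trans (neg_one_smul ℝ _).symm

lemma diffAt_mapField (hY : DiffAt Y p) : DiffAt (S.mapField Y) p :=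
  haveI : IsManifold (𝓡 (2 * n + 1)) 1 M := IsManifold.of_le (n := ∞) (by norm_cast)
  (S.smooth_F.mdifferentiableAt (by norm_num)).clm_bundle_apply hY

omit [RiemannianBundle (fun x : M => TangentSpace (𝓡 (2 * n + 1)) x)] in
lemma cov_neg (hY : DiffAt Y p) : cov ((-1 : ℝ) • Y) p = -cov Y p := by
  rw [cov.isCovariantDerivativeOnUniv.smul_const _ hY, neg_one_smul]

/-- The difference of the two connections in terms of the fields `Y`, `FY` and `F²Y`. -/
lemma cov_sub_canonicalConnection (hY : DiffAt Y p) (X : TangentSpace (𝓡 (2 * n + 1)) p) :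
    cov Y p X - S.canonicalConnection cov Y p X =
      -cov (S.mapField (S.mapField Y)) p X - S.F p (S.F p (cov Y p X)) -
        (3 / 2 : ℝ) • S.F p (S.F p (cov (S.mapField (S.mapField Y)) p X)) +
        (1 / 2 : ℝ) • S.F p (cov (S.mapField Y) p X) := by
  have hB := diffAt_mapField (S := S) (diffAt_mapField (S := S) hY)
  have h1 : (fun x => S.proj1 x (Y x)) = Y + S.mapField (S.mapField Y) := rfl
  have h2 : (fun x => S.proj2 x (Y x)) = (-1 : ℝ) • S.mapField (S.mapField Y) := by
    ext1 x; exact (neg_one_smul ℝ _).symm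
  have h3 : (fun x => S.F x (S.proj2 x (Y x))) = S.mapField Y := by
    ext1 x
    change S.F x (-(S.F x (S.F x (Y x)))) = _
    rw [map_neg, map_map_map, neg_neg]; rfl
  unfold canonicalConnection
  rw [h3, h1, h2, cov.isCovariantDerivativeOnUniv.add hY hB, cov_neg cov hB]
  simp only [proj1, proj2, add_apply, neg_apply,
    ContinuousLinearMap.comp_apply, ContinuousLinearMap.id_apply, map_add, map_sub, map_neg,
    map_map_map]
  module

variable (S) in
/-- The difference `∇_X Y - ∇̄_X Y` at `p`, for a differentiable field `Y`, as a linear function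
of `X`. -/
def connectionDifference (p : M) (Y : ∀ x : M, TangentSpace (𝓡 (2 * n + 1)) x) :
    TangentSpace (𝓡 (2 * n + 1)) p →L[ℝ] TangentSpace (𝓡 (2 * n + 1)) p :=
  -cov (S.mapField (S.mapField Y)) p - (S.F p).comp ((S.F p).comp (cov Y p)) -
    (3 / 2 : ℝ) • (S.F p).comp ((S.F p).comp (cov (S.mapField (S.mapField Y)) p)) +
    (1 / 2 : ℝ) • (S.F p).comp (cov (S.mapField Y) p)

lemma connectionDifference_apply (hY : DiffAt Y p) (X : TangentSpace (𝓡 (2 * n + 1)) p) :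
    S.connectionDifference cov p Y X = cov Y p X - S.canonicalConnection cov Y p X :=
  (cov_sub_canonicalConnection cov hY X).symm

/-- Replacing `Y` by `f Y` adds `df(X)` times a multiple of `F²Y`. The four terms contribute `-1`,
`-1`, `3/2` (from `F⁴ = -F²`) and `1/2`, which cancel. -/
lemma tensorialAt_connectionDifference (p : M) :
    TensorialAt (𝓡 (2 * n + 1)) (EuclideanSpace ℝ (Fin (2 * n + 1)))
      (S.connectionDifference cov p) p where
  smul {f Y} hf hY := by
    have hA := diffAt_mapField (S := S) hY
    have hB := diffAt_mapField (S := S) hA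
    have h1 : S.mapField (f • Y) = f • S.mapField Y := by
      ext1 x; exact map_smul (S.F x) _ _
    have h2 : S.mapField (f • S.mapField Y) = f • S.mapField (S.mapField Y) := by
      ext1 x; exact map_smul (S.F x) _ _
    ext1 X
    unfold connectionDifference
    rw [h1, h2, cov.isCovariantDerivativeOnUniv.leibniz hY hf,
      cov.isCovariantDerivativeOnUniv.leibniz hA hf, cov.isCovariantDerivativeOnUniv.leibniz hB hf]
    simp only [add_apply, sub_apply, neg_apply, smul_apply, ContinuousLinearMap.comp_apply,
      ContinuousLinearMap.smulRight_apply, map_add, map_smul, mapField, map_map_map, map_neg]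
    module
  add {Y Z} hY hZ := by
    have hA := diffAt_mapField (S := S) hY
    have hB := diffAt_mapField (S := S) hA
    have hA' := diffAt_mapField (S := S) hZ
    have hB' := diffAt_mapField (S := S) hA'
    have h1 : ∀ Y Z, S.mapField (Y + Z) = S.mapField Y + S.mapField Z := fun Y Z => by
      ext1 x; exact map_add (S.F x) _ _
    ext1 X
    unfold connectionDifference
    rw [h1, h1, cov.isCovariantDerivativeOnUniv.add hY hZ,
      cov.isCovariantDerivativeOnUniv.add hA hA', cov.isCovariantDerivativeOnUniv.add hB hB']
    simp only [add_apply, sub_apply, neg_apply, smul_apply, ContinuousLinearMap.comp_apply,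
      map_add]
    module

omit [RiemannianBundle (fun x : M => TangentSpace (𝓡 (2 * n + 1)) x)] in
lemma exists_diffAt (p : M) (v : TangentSpace (𝓡 (2 * n + 1)) p) :
    ∃ Y : ∀ x : M, TangentSpace (𝓡 (2 * n + 1)) x, DiffAt Y p ∧ Y p = v :=
  haveI : IsManifold (𝓡 (2 * n + 1)) 1 M := IsManifold.of_le (n := ∞) (by norm_cast)
  ⟨FiberBundle.extend (EuclideanSpace ℝ (Fin (2 * n + 1))) v,
    FiberBundle.mdifferentiableAt_extend ..,
    FiberBundle.extend_apply_self ..⟩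

variable (S) in
/-- The second fundamental tensor. -/
def secondFundamentalTensor (p : M) : Tensor3 (TangentSpace (𝓡 (2 * n + 1)) p) :=
  haveI : IsManifold (𝓡 (2 * n + 1)) 1 M := IsManifold.of_le (n := ∞) (by norm_cast)
  let D := TensorialAt.mkHom (S.connectionDifference cov p) p
    (tensorialAt_connectionDifference cov p)
  LinearMap.mk₂ ℝ (fun X Y => (innerₗ (TangentSpace (𝓡 (2 * n + 1)) p)) (D Y X))
    (fun X X' Y => by rw [map_add, map_add]) (fun c X Y => by rw [map_smul, map_smul])
    (fun X Y Y' => by rw [map_add, add_apply, map_add])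
    (fun c X Y => by rw [map_smul, smul_apply, map_smul])

lemma isSecondFundamentalTensorAt_secondFundamentalTensor (p : M) :
    S.IsSecondFundamentalTensorAt cov p (S.secondFundamentalTensor cov p) := by
  intro X Z Y hY
  have : IsManifold (𝓡 (2 * n + 1)) 1 M := IsManifold.of_le (n := ∞) (by norm_cast)
  have h1 := TensorialAt.mkHom_apply (tensorialAt_connectionDifference (S := S) cov p) hY
  rw [← connectionDifference_apply cov hY, ← h1]
  rfl

variable {cov} in
lemma IsSecondFundamentalTensorAt.unique {h h' : Tensor3 (TangentSpace (𝓡 (2 * n + 1)) p)}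
    (hh : S.IsSecondFundamentalTensorAt cov p h) (hh' : S.IsSecondFundamentalTensorAt cov p h') :
    h = h' := by
  ext X v Z
  obtain ⟨Y, hY, rfl⟩ := exists_diffAt p v
  rw [hh X Z Y hY, hh' X Z Y hY]

lemma inner_mapField_left (x : M) (v w : TangentSpace (𝓡 (2 * n + 1)) x) :
    inner ℝ (S.F x v) w = -(inner ℝ v (S.F x w) : ℝ) :=
  (S.isAlmostContactMetric x).inner_map_left v w

variable {cov} in
lemma IsSecondFundamentalTensorAt.apply_eq {h : Tensor3 (TangentSpace (𝓡 (2 * n + 1)) p)}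
    (hh : S.IsSecondFundamentalTensorAt cov p h) (X v : TangentSpace (𝓡 (2 * n + 1)) p)
    (hY : DiffAt Y p) :
    h X (Y p) v = -inner ℝ (cov (S.mapField (S.mapField Y)) p X) v -
      inner ℝ (cov Y p X) (S.F p (S.F p v)) -
      3 / 2 * inner ℝ (cov (S.mapField (S.mapField Y)) p X) (S.F p (S.F p v)) -
      1 / 2 * inner ℝ (cov (S.mapField Y) p X) (S.F p v) := by
  rw [hh X v Y hY, cov_sub_canonicalConnection cov hY]
  simp only [inner_add_left, inner_sub_left, inner_neg_left, real_inner_smul_left,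
    inner_mapField_left]
  ring

variable {cov} in
-- The vector `-v` is extended by `F²Y` rather than `-Y`. By `F³ = -F` both sides then involve only
-- the derivatives of `FY` and `F²Y`, and can be compared directly.
lemma IsSecondFundamentalTensorAt.map_map {h : Tensor3 (TangentSpace (𝓡 (2 * n + 1)) p)}
    (hh : S.IsSecondFundamentalTensorAt cov p h) (X : TangentSpace (𝓡 (2 * n + 1)) p)
    {v w : TangentSpace (𝓡 (2 * n + 1)) p} (hv : v ∈ V (S.ξ p)) (hw : w ∈ V (S.ξ p)) :
    h X v w = -h X (S.F p v) (S.F p w) := by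
  obtain ⟨Y, hY, rfl⟩ := exists_diffAt p v
  have hA := diffAt_mapField (S := S) hY
  have hB := diffAt_mapField (S := S) hA
  have e1 := hh.apply_eq X (S.F p w) hA
  have e2 := hh.apply_eq X w hB
  have hw' : S.F p (S.F p w) = -w := (S.isAlmostContactMetric p).sq_eq_neg w hw
  have hv' : S.F p (S.F p (Y p)) = -Y p := (S.isAlmostContactMetric p).sq_eq_neg _ hv
  rw [mapField_mapField_mapField, cov_neg cov hA] at e1
  have hA' : S.mapField Y p = S.F p (Y p) := rfl
  have hB' : S.mapField (S.mapField Y) p = -Y p := hv'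
  rw [mapField_mapField_mapField, mapField_mapField_mapField, cov_neg cov hA, cov_neg cov hB] at e2
  simp only [hA', hB', hw', map_neg, neg_apply, LinearMap.neg_apply, inner_neg_left,
    inner_neg_right] at e1 e2
  linarith

section MetricCompatible

variable [IsContMDiffRiemannianBundle (𝓡 (2 * n + 1)) ∞
  (EuclideanSpace ℝ (Fin (2 * n + 1))) (fun x : M => TangentSpace (𝓡 (2 * n + 1)) x)]

variable {cov}

omit [IsContMDiffRiemannianBundle (𝓡 (2 * n + 1)) ∞
  (EuclideanSpace ℝ (Fin (2 * n + 1))) (fun x : M => TangentSpace (𝓡 (2 * n + 1)) x)] in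
lemma inner_eq_neg_inner_mapField (x : M) :
    inner ℝ (S.mapField Y x) (Z x) = -(inner ℝ (Y x) (S.mapField Z x) : ℝ) :=
  inner_mapField_left x _ _

/-- By metric compatibility each side is the derivative along `X` of one and the same function. -/
lemma _root_.ACM.IsLeviCivita.inner_add_inner_eq (hcov : IsLeviCivita cov)
    (X : TangentSpace (𝓡 (2 * n + 1)) p) {Y Z Y' Z' : ∀ x : M, TangentSpace (𝓡 (2 * n + 1)) x}
    (hY : DiffAt Y p) (hZ : DiffAt Z p) (hY' : DiffAt Y' p) (hZ' : DiffAt Z' p)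
    (h : ∀ x, inner ℝ (Y x) (Z x) = (inner ℝ (Y' x) (Z' x) : ℝ)) :
    (inner ℝ (cov Y p X) (Z p) + inner ℝ (cov Z p X) (Y p) : ℝ) =
      inner ℝ (cov Y' p X) (Z' p) + inner ℝ (cov Z' p X) (Y' p) := by
  have : IsManifold (𝓡 (2 * n + 1)) 1 M := IsManifold.of_le (n := ∞) (by norm_cast)
  have : IsContMDiffRiemannianBundle (𝓡 (2 * n + 1)) 1 (EuclideanSpace ℝ (Fin (2 * n + 1)))
      (TangentSpace (𝓡 (2 * n + 1)) : M → Type _) :=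
    IsContMDiffRiemannianBundle.of_le (n := ∞)
      (E := fun x : M => TangentSpace (𝓡 (2 * n + 1)) x) (by norm_cast)
  obtain ⟨X, -, rfl⟩ := exists_diffAt p X
  have h1 := hcov.2.mvfderiv_inner_eq X hY hZ
  have h2 := hcov.2.mvfderiv_inner_eq X hY' hZ'
  rw [funext h, h2] at h1
  rw [real_inner_comm (Y p), real_inner_comm (Y' p)]
  exact h1.symm

lemma IsSecondFundamentalTensorAt.mem_Tbar (hcov : IsLeviCivita cov)
    {h : Tensor3 (TangentSpace (𝓡 (2 * n + 1)) p)}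
    (hh : S.IsSecondFundamentalTensorAt cov p h) :
    h ∈ Tbar (S.F p).toLinearMap (S.ξ p) := by
  refine ⟨fun X v w => ?_, fun X v hv w hw => hh.map_map X hv hw⟩
  obtain ⟨Y, hY, rfl⟩ := exists_diffAt p v
  obtain ⟨Z, hZ, rfl⟩ := exists_diffAt p w
  have hY1 := diffAt_mapField (S := S) hY
  have hY2 := diffAt_mapField (S := S) hY1
  have hZ1 := diffAt_mapField (S := S) hZ
  have hZ2 := diffAt_mapField (S := S) hZ1
  have hY' : DiffAt ((-1 : ℝ) • Y) p := mdifferentiableAt_const.smul_section hY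
  -- Three pointwise identities are differentiated: `⟨F²Y, Z⟩`, `-⟨FY, FZ⟩` and `-⟨F²Y, F²Z⟩` all
  -- equal `⟨Y, F²Z⟩`. Skewness of `h` is a linear combination of the results.
  have q1 := hcov.inner_add_inner_eq X hY2 hZ hY hZ2 fun x => by
    rw [inner_eq_neg_inner_mapField, inner_eq_neg_inner_mapField, neg_neg]
  have q2 := hcov.inner_add_inner_eq X hY1 hZ1 hY' hZ2 fun x => by
    rw [inner_eq_neg_inner_mapField]
    simp [inner_neg_left]
  have q3 := hcov.inner_add_inner_eq X hY2 hZ2 hY' hZ2 fun x => by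
    rw [inner_eq_neg_inner_mapField, inner_eq_neg_inner_mapField, mapField_mapField_mapField]
    simp [inner_neg_left, inner_neg_right]
  have e1 := hh.apply_eq X (Z p) hY
  have e2 := hh.apply_eq X (Y p) hZ
  rw [cov_neg cov hY] at q2 q3
  have hB : ∀ Y, S.F p (S.F p (Y p)) = S.mapField (S.mapField Y) p := fun Y => rfl
  have hA : ∀ Y, S.F p (Y p) = S.mapField Y p := fun Y => rfl
  rw [hB, hA] at e1 e2
  simp only [neg_apply, inner_neg_left, inner_neg_right, Pi.smul_apply, neg_one_smul] at q2 q3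
  linarith

variable (S) in
/-- The class of a structure is given by the least set `α`. -/
lemma existsUnique_isOfClass (hn : 3 ≤ n) (hcov : IsLeviCivita cov) :
    ∃! α : Finset (Fin 12), ∀ γ : Finset (Fin 12), S.IsOfClass cov γ ↔ α ⊆ γ := by
  classical
  have hT : ∀ p : M, Module.finrank ℝ (TangentSpace (𝓡 (2 * n + 1)) p) = 2 * n + 1 := fun p =>
    finrank_euclideanSpace_fin (𝕜 := ℝ) (n := 2 * n + 1)
  have hs := fun p => isSecondFundamentalTensorAt_secondFundamentalTensor (S := S) cov p
  -- An index belongs to the least class when the tensor has a nonzero component in that summand at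
  -- some point; by orthogonality, inner products detect this.
  set α₀ : Finset (Fin 12) := Finset.univ.filter fun i => ∃ p : M,
    ∃ k ∈ TbarSub n (S.F p).toLinearMap (S.ξ p) i,
      tensorInner (S.secondFundamentalTensor cov p) k ≠ 0
  have key : ∀ γ, S.IsOfClass cov γ ↔ α₀ ⊆ γ := fun γ => by
    have h1 : S.IsOfClass cov γ ↔ ∀ p : M, S.secondFundamentalTensor cov p ∈
        TbarClass n (S.F p).toLinearMap (S.ξ p) γ :=
      forall_congr' fun p => ⟨fun ⟨h, hh, hh'⟩ => (hs p).unique hh' ▸ hh, fun hh => ⟨_, hh, hs p⟩⟩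
    rw [h1]
    constructor
    · intro hγ i hi
      by_contra hiγ
      obtain ⟨p, k, hk, hne⟩ := (Finset.mem_filter.1 hi).2
      exact hne ((mem_TbarClass_iff (S.isAlmostContactMetric p) (hT p) (by omega) γ
        ((hs p).mem_Tbar hcov)).1 (hγ p) i hiγ k hk)
    · intro hγ p
      refine (mem_TbarClass_iff (S.isAlmostContactMetric p) (hT p) (by omega) γ
        ((hs p).mem_Tbar hcov)).2 fun i hi k hk => ?_
      by_contra hne
      exact hi (hγ (Finset.mem_filter.2 ⟨Finset.mem_univ i, p, k, hk, hne⟩))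
  exact ⟨α₀, key, fun α hα => ((hα _).1 ((key _).2 subset_rfl)).antisymm
    ((key _).1 ((hα _).2 subset_rfl))⟩

end MetricCompatible

end AlmostContactMetricStructure

end Connection

end ACM

end

theorem theorem6p3 (n : ℕ) (hn : 3 ≤ n) :
    -- the decomposition, for every almost contact metric vector space of dimension `2n + 1`
    (∀ (T : Type*) [NormedAddCommGroup T] [InnerProductSpace ℝ T] [FiniteDimensional ℝ T]
        (F : T →ₗ[ℝ] T) (ξ : T),
      Module.finrank ℝ T = 2 * n + 1 → ACM.IsAlmostContactMetric F ξ →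
        iSupIndep (ACM.TbarSub n F ξ) ∧
        (⨆ i, ACM.TbarSub n F ξ i) = ACM.Tbar F ξ ∧
        (∀ i j, i ≠ j → ∀ h ∈ ACM.TbarSub n F ξ i, ∀ h' ∈ ACM.TbarSub n F ξ j,
          ACM.tensorInner h h' = 0) ∧
        (∀ i, ACM.IsInvariant F ξ (ACM.TbarSub n F ξ i)) ∧
        (∀ i, ACM.IsIrreducible F ξ (ACM.TbarSub n F ξ i)) ∧
        (∀ i, (Module.finrank ℝ (ACM.TbarSub n F ξ i) : ℚ) = ACM.tableDim n i) ∧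
        Module.finrank ℝ (ACM.Tbar F ξ) = (2 * n + 1) * n * (n + 1) ∧
        (∀ α, ACM.IsInvariant F ξ (ACM.TbarClass n F ξ α)) ∧
        (Set.range (ACM.TbarClass n F ξ)).ncard = 2 ^ 12) ∧
    -- the classes of almost contact metric structures on manifolds of dimension `2n + 1`
    (∀ (M : Type*) [TopologicalSpace M] [ChartedSpace (EuclideanSpace ℝ (Fin (2 * n + 1))) M]
        [IsManifold (𝓡 (2 * n + 1)) ∞ M]
        [RiemannianBundle (fun x : M => TangentSpace (𝓡 (2 * n + 1)) x)]
        [IsContMDiffRiemannianBundle (𝓡 (2 * n + 1)) ∞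
          (EuclideanSpace ℝ (Fin (2 * n + 1))) (fun x : M => TangentSpace (𝓡 (2 * n + 1)) x)]
        (S : ACM.AlmostContactMetricStructure n M)
        (cov : CovariantDerivative (𝓡 (2 * n + 1)) (EuclideanSpace ℝ (Fin (2 * n + 1)))
          (TangentSpace (𝓡 (2 * n + 1)) : M → Type _)),
      ACM.IsLeviCivita cov →
        (∀ p : M, ∃! h, S.IsSecondFundamentalTensorAt cov p h) ∧
        (∀ (p : M) h, S.IsSecondFundamentalTensorAt cov p h →
          h ∈ ACM.Tbar (S.F p).toLinearMap (S.ξ p)) ∧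
        (∃! α : Finset (Fin 12), ∀ γ : Finset (Fin 12), S.IsOfClass cov γ ↔ α ⊆ γ)) := by
  refine ⟨fun T _ _ _ F ξ hT hS => ?_, ?_⟩
  · obtain ⟨h1, h2⟩ := ACM.finrank_TbarSub_and_Tbar hS hT (by omega)
    exact ⟨ACM.iSupIndep_TbarSub hS hT, ACM.iSup_TbarSub hS hT (by omega),
      fun _ _ hij _ hh _ hk => ACM.tensorInner_TbarSub hS hT hij hh hk,
      ACM.isInvariant_TbarSub hS hT, ACM.isIrreducible_TbarSub hS hT hn, h1, h2,
      ACM.isInvariant_TbarClass hS hT, ACM.ncard_range_TbarClass hS hT hn⟩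
  · intro M _ _ _ _ _ S cov hcov
    have hs := fun p =>
      ACM.AlmostContactMetricStructure.isSecondFundamentalTensorAt_secondFundamentalTensor
        (S := S) cov p
    exact ⟨fun p => ⟨_, hs p, fun h hh => hh.unique (hs p)⟩, fun p h hh => hh.mem_Tbar hcov,
      S.existsUnique_isOfClass hn hcov⟩
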